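/- Consider circuits on a finite register of qubits with all-to-all connectivity, built from the gates CNOT, $T$, $T^\dagger$, $S$, $S^\dagger$, $H$, $R_{\hat x}(\theta)=e^{-i\theta X/2}$ and $R_{\hat z}(\theta)=e^{-i\theta Z/2}$ ($\theta\in\mathbb R$), where $S=\mathrm{diag}(1,i)$ and $T=\mathrm{diag}(1,e^{i\pi/4})$. A circuit is a sequence of time slots, each holding gates that act on pairwise disjoint sets of qubits. The cost of a gate type is the number of gates of that type in the circuit, and its depth is the number of time slots that hold at least one gate of that type; $T^\dagger$ counts as a $T$ gate and $S^\dagger$ as an $S$ gate. **Theorem.** Let $n\ge 6$, let $C$ be a set of $n$ control qubits, let $t\notin C$ be a target qubit, and let $W\in SU(2)$. The multi-controlled gate that applies $W$ to $t$ when all qubits of $C$ are in the state $|1\rangle$, and the identity otherwise, is implemented exactly (with no global phase and without ancilla: all gates act on qubits of $C\cup\{t\}$) by a circuit with exactly eight gates from $\{R_{\hat x},R_{\hat z}\}$ in addition to - CNOT gates of cost $12.5n-30$ for even $n$ and $12.5n-26.5$ for odd $n$, and depth $12n-27$ for even $n$ and $12n-24$ for odd $n$; - $T$ gates of cost $16n-48$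 and depth $4n$; - $H$ gates of cost $9n-36$ for even $n$ and $9n-37$ for odd $n$, and depth $4n-10$; - $S$ gates of cost $0.5n-2$ for even $n$ and $0.5n-2.5$ for odd $n$, and depth $1$. All costs and depths are attained by one and the same circuit. -/

import Mathlib

/-!
Quantum circuits over the gates `CNOT`, `T`, `T†`, `S`, `S†`, `H`, `R_x(θ)`, `R_z(θ)` on a finite
register `Q` of qubits with all-to-all connectivity.  A computational basis state is a function
`Q → Fin 2`, and an operator on the register is a matrix indexed by basis states.
-/

namespace QCircuit

open Matrix

/-- The rotation `R_x(θ) = exp(-i θ X / 2)`. -/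
noncomputable def rotX (θ : ℝ) : Matrix (Fin 2) (Fin 2) ℂ :=
  !![(Real.cos (θ / 2) : ℂ), -Complex.I * (Real.sin (θ / 2) : ℂ);
     -Complex.I * (Real.sin (θ / 2) : ℂ), (Real.cos (θ / 2) : ℂ)]

/-- The rotation `R_z(θ) = exp(-i θ Z / 2)`. -/
noncomputable def rotZ (θ : ℝ) : Matrix (Fin 2) (Fin 2) ℂ :=
  !![Complex.exp (-(Complex.I * ((θ / 2 : ℝ) : ℂ))), 0;
     0, Complex.exp (Complex.I * ((θ / 2 : ℝ) : ℂ))]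

/-- The phase gate `P(θ) = diag(1, e^{iθ})`. -/
noncomputable def phase (θ : ℝ) : Matrix (Fin 2) (Fin 2) ℂ :=
  !![1, 0; 0, Complex.exp (Complex.I * (θ : ℂ))]

/-- The Hadamard gate. -/
noncomputable def hadamard : Matrix (Fin 2) (Fin 2) ℂ :=
  !![((1 / Real.sqrt 2 : ℝ) : ℂ), ((1 / Real.sqrt 2 : ℝ) : ℂ);
     ((1 / Real.sqrt 2 : ℝ) : ℂ), -((1 / Real.sqrt 2 : ℝ) : ℂ)]

/-- The Pauli `X` gate. -/
def pauliX : Matrix (Fin 2) (Fin 2) ℂ := !![0, 1; 1, 0]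

/-- The operator on the register that applies the one-qubit operator `U` to the qubit `t` when all
the qubits of `C` are in the state `1`, and the identity otherwise (here `t ∉ C` is intended).
For `C = ∅` this is `U` on the qubit `t` tensored with the identity on the other qubits. -/
noncomputable def controlled {Q : Type*} [DecidableEq Q] [Fintype Q]
    (C : Finset Q) (t : Q) (U : Matrix (Fin 2) (Fin 2) ℂ) :
    Matrix (Q → Fin 2) (Q → Fin 2) ℂ :=
  Matrix.of fun x y =>
    if ∀ q, q ≠ t → x q = y q then
      (if ∀ q ∈ C, y q = 1 then U (x t) (y t) else (1 : Matrix (Fin 2) (Fin 2) ℂ) (x t) (y t))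
    else 0

/-- The available gates, each with the qubits that it acts on. -/
inductive Gate (Q : Type*) where
  | cnot (c t : Q) (h : c ≠ t)
  | gateT (q : Q)
  | gateTdg (q : Q)
  | gateS (q : Q)
  | gateSdg (q : Q)
  | gateH (q : Q)
  | rx (θ : ℝ) (q : Q)
  | rz (θ : ℝ) (q : Q)

/-- The kinds of gates that are counted separately. -/
inductive Kind where
  | cnot
  | t
  | s
  | h
  | rot
  deriving DecidableEq

namespace Gate

variable {Q : Type*}

/-- `T†` counts as a `T` gate, `S†` as an `S` gate, and `R_x`, `R_z` as rotations. -/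
def kind : Gate Q → Kind
  | cnot _ _ _ => Kind.cnot
  | gateT _ => Kind.t
  | gateTdg _ => Kind.t
  | gateS _ => Kind.s
  | gateSdg _ => Kind.s
  | gateH _ => Kind.h
  | rx _ _ => Kind.rot
  | rz _ _ => Kind.rot

/-- The qubits that a gate acts on. -/
def qubits [DecidableEq Q] : Gate Q → Finset Q
  | cnot c t _ => {c, t}
  | gateT q => {q}
  | gateTdg q => {q}
  | gateS q => {q}
  | gateSdg q => {q}
  | gateH q => {q}
  | rx _ q => {q}
  | rz _ q => {q}

/-- The operator that a gate applies to the register. -/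
noncomputable def op [DecidableEq Q] [Fintype Q] : Gate Q → Matrix (Q → Fin 2) (Q → Fin 2) ℂ
  | cnot c t _ => controlled {c} t pauliX
  | gateT q => controlled ∅ q (phase (Real.pi / 4))
  | gateTdg q => controlled ∅ q (phase (-(Real.pi / 4)))
  | gateS q => controlled ∅ q (phase (Real.pi / 2))
  | gateSdg q => controlled ∅ q (phase (-(Real.pi / 2)))
  | gateH q => controlled ∅ q hadamard
  | rx θ q => controlled ∅ q (rotX θ)
  | rz θ q => controlled ∅ q (rotZ θ)

end Gate

/-- The operator applied by a list of gates, the head of the list being executed first. -/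
noncomputable def gatesOp {Q : Type*} [DecidableEq Q] [Fintype Q] :
    List (Gate Q) → Matrix (Q → Fin 2) (Q → Fin 2) ℂ
  | [] => 1
  | g :: l => gatesOp l * g.op

/-- A circuit: a sequence of time slots, each holding gates which act on pairwise disjoint sets of
qubits and hence are executed in parallel. -/
structure Circuit (Q : Type*) [DecidableEq Q] where
  slots : List (List (Gate Q))
  parallel : ∀ L ∈ slots, L.Pairwise fun g g' => Disjoint g.qubits g'.qubits

namespace Circuit

variable {Q : Type*} [DecidableEq Q]

/-- All the gates of a circuit, in order of execution. -/
def gates (c : Circuit Q) : List (Gate Q) := c.slots.flatten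

/-- The operator applied by a circuit. -/
noncomputable def op [Fintype Q] (c : Circuit Q) : Matrix (Q → Fin 2) (Q → Fin 2) ℂ :=
  gatesOp c.gates

/-- The number of gates of the kind `k`. -/
def cost (c : Circuit Q) (k : Kind) : ℕ := c.gates.countP fun g => decide (g.kind = k)

/-- The number of time slots that hold at least one gate of the kind `k`. -/
def depth (c : Circuit Q) (k : Kind) : ℕ :=
  c.slots.countP fun L => L.any fun g => decide (g.kind = k)

/-- The circuit acts only on qubits of the set `A`. -/
def ActsOn (c : Circuit Q) (A : Finset Q) : Prop := ∀ g ∈ c.gates, g.qubits ⊆ A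

end Circuit

end QCircuit

/-!
The multi-controlled `W` is a commutator. Write `W` as a rotation about the `x`- or the `y`-axis,
conjugated by two rotations (`exists_rotX_conj`, `exists_rotY_conj`); the outer rotations cancel when
the inner part is the identity, so only the inner one has to be controlled. Split the
controls into two parts, and let `E` and `D` be operators on the target which, up to a phase, invert the
rotations about the `x`-axis by conjugation when all the controls of the first, respectively second,
part are `1`, and commute with these rotations otherwise. Then the word
`D · (E R(α) E R(-α)) · D⁻¹ · (R(α) E R(-α) E)` is the rotation by `4 α` when all controls are `1`, and
the identity otherwise (`commutator_word`). It contains four rotations, and there are four outer ones.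

Both operators are controlled Pauli operators in which only few qubits act on the target: `E` is an
`X` surrounded by `T`-twisted `CNOT` gates (`twist_px_twist`) or a controlled `Z` gate (`cz_mux`), and
`D` consists of four `T` gates on parities of the target with two qubits, between Hadamard gates and
another twist (`dlow_eq`, `dhigh_eq`). Phases of `D` do not matter, since `D` and an inverse of it both
occur in the word.

The qubits which control `D` hold the outputs of a reversible computation on the controls. Its steps
are Toffoli gates up to relative phases: four `T` gates on parities make a doubly controlled `Z` up to a
phase, and two Hadamard gates turn it into a flip (`slow_realizes`, `fast_realizes`). After the operator
`D` the computation is undone. Since a Toffoli gate up to phases and its inverse are applied to the same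
basis states of the controls, the relative phases cancel, even when the two are implemented by different
gates (`Mux.conj`). No ancillas are needed: the controls which `E` tests may be assumed to be `1` in
the computation for `D`, as the word is trivial anyway if `E` does not invert. A node can
thus flip such a qubit in order to record that its inputs are active, and the inputs of active nodes
are known to be `1` in their turn and serve as targets of later nodes (`tree_spec`, `sweep_spec`).
The nodes form two chains, each consuming two new controls per step, in such a way that the depth is
linear with the required constants (`tree`).

Costs and depths are read off from time labels. A program is a list of instructions with labels such
that instructions on a common qubit are in the order of their labels (`Fits`, established by keeping
track of the label up to which each qubit is occupied). Gates with the same label share a slot, and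
exchanging gates on disjoint qubits shows that the resulting circuit has the operator of the list
(`schedule_op`). Its depths are bounded by the numbers of labels in use. The `T` gates have labels
divisible by `8`, most Hadamard gates have labels in one residue class modulo `16`, and all `S` gates
have a common label. The costs are made exact by different implementations of single nodes, by the
replacement of a `T` gate by `S` and an inverse `T` gate, and by pairs of gates that cancel (`pads`).
Finally a depth that is less than required is raised by moving gates to slots of their own
(`Circuit.exists_depth_eq`). The general construction needs eight controls (`core_op`, `big_meets`); six
and seven controls use smaller programs of the same kind, with feasibility and costs decided by
computation (`meets_of_checks`).
-/

namespace QCircuit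

open Matrix Function

set_option linter.unusedSectionVars false
set_option linter.unusedSimpArgs false

/-! ### Basis states, commuting gates, and time slots -/

section Ket

variable {Q : Type*} [DecidableEq Q] [Fintype Q]

/-- The computational basis vector of the basis state `y`. -/
def ket (y : Q → Fin 2) : (Q → Fin 2) → ℂ := Pi.single y 1

theorem mulVec_ket_apply (M : Matrix (Q → Fin 2) (Q → Fin 2) ℂ) (x y : Q → Fin 2) :
    (M *ᵥ ket y) x = M x y := by
  simp [ket]

theorem ext_ket {M N : Matrix (Q → Fin 2) (Q → Fin 2) ℂ}
    (h : ∀ y, M *ᵥ ket y = N *ᵥ ket y) : M = N := by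
  ext x y
  have := congrFun (h y) x
  rwa [mulVec_ket_apply, mulVec_ket_apply] at this

theorem controlled_mulVec_ket (C : Finset Q) (t : Q) (U : Matrix (Fin 2) (Fin 2) ℂ)
    (y : Q → Fin 2) :
    controlled C t U *ᵥ ket y =
      ∑ σ, (if ∀ q ∈ C, y q = 1 then U else 1) σ (y t) • ket (update y t σ) := by
  ext x
  rw [mulVec_ket_apply]
  simp only [controlled, Matrix.of_apply, Finset.sum_apply, Pi.smul_apply, smul_eq_mul, ket,
    Pi.single_apply]
  by_cases hx : ∀ q, q ≠ t → x q = y q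
  · have key : ∀ σ, (x = update y t σ) ↔ x t = σ := by
      intro σ
      constructor
      · intro h; rw [h]; simp
      · rintro rfl
        funext q
        by_cases hq : q = t
        · subst hq; simp
        · simp [hq, hx q hq]
    simp only [key, if_pos hx, mul_ite, mul_one, mul_zero, Finset.sum_ite_eq, Finset.mem_univ,
      if_true]
    split_ifs <;> rfl
  · rw [if_neg hx]
    symm
    apply Finset.sum_eq_zero
    intro σ _
    have hne : x ≠ update y t σ := by
      rintro rfl
      exact hx fun q hq => by simp [hq]
    simp [hne]

theorem controlled_empty_mulVec_ket (t : Q) (U : Matrix (Fin 2) (Fin 2) ℂ) (y : Q → Fin 2) :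
    controlled ∅ t U *ᵥ ket y = ∑ σ, U σ (y t) • ket (update y t σ) := by
  rw [controlled_mulVec_ket]; simp

/-- Controlled operators commute when neither target is touched by the other operator. -/
theorem controlled_commute {C C' : Finset Q} {t t' : Q} (U U' : Matrix (Fin 2) (Fin 2) ℂ)
    (htt : t ≠ t') (ht : t ∉ C') (ht' : t' ∉ C) :
    Commute (controlled C t U) (controlled C' t' U') := by
  apply ext_ket
  intro y
  have h1 : ∀ σ, (∀ q ∈ C, update y t' σ q = 1) ↔ ∀ q ∈ C, y q = 1 := fun σ =>
    forall₂_congr fun q hq => by rw [update_of_ne (ne_of_mem_of_not_mem hq ht')]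
  have h2 : ∀ σ, (∀ q ∈ C', update y t σ q = 1) ↔ ∀ q ∈ C', y q = 1 := fun σ =>
    forall₂_congr fun q hq => by rw [update_of_ne (ne_of_mem_of_not_mem hq ht)]
  simp only [← mulVec_mulVec, controlled_mulVec_ket, mulVec_sum, mulVec_smul, h1, h2,
    update_of_ne htt, update_of_ne htt.symm, Finset.smul_sum, smul_smul]
  rw [Finset.sum_comm]
  refine Finset.sum_congr rfl fun σ _ => Finset.sum_congr rfl fun τ _ => ?_
  rw [update_comm htt, mul_comm]

namespace Gate

/-- The control qubits of a gate. -/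
def controls : Gate Q → Finset Q
  | cnot c _ _ => {c}
  | _ => ∅

/-- The qubit on which a gate acts. -/
def target : Gate Q → Q
  | cnot _ t _ => t
  | gateT q => q
  | gateTdg q => q
  | gateS q => q
  | gateSdg q => q
  | gateH q => q
  | rx _ q => q
  | rz _ q => q

/-- The operator that a gate applies to its target. -/
noncomputable def block : Gate Q → Matrix (Fin 2) (Fin 2) ℂ
  | cnot _ _ _ => pauliX
  | gateT _ => phase (Real.pi / 4)
  | gateTdg _ => phase (-(Real.pi / 4))
  | gateS _ => phase (Real.pi / 2)
  | gateSdg _ => phase (-(Real.pi / 2))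
  | gateH _ => hadamard
  | rx θ _ => rotX θ
  | rz θ _ => rotZ θ

theorem op_eq (g : Gate Q) : g.op = controlled g.controls g.target g.block := by
  cases g <;> rfl

theorem mem_qubits {g : Gate Q} {q : Q} : q ∈ g.qubits ↔ q ∈ g.controls ∨ q = g.target := by
  cases g <;> simp [qubits, controls, target]

theorem commute {g g' : Gate Q} (h : Disjoint g.qubits g'.qubits) : Commute g.op g'.op := by
  rw [Finset.disjoint_left] at h
  rw [op_eq, op_eq]
  have h1 := h (mem_qubits.2 (Or.inr rfl))
  have h2 : g'.target ∉ g.qubits := fun hh => h hh (mem_qubits.2 (Or.inr rfl))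
  rw [mem_qubits, not_or] at h1 h2
  exact controlled_commute _ _ h1.2 h1.1 h2.1

end Gate

theorem gatesOp_append (l l' : List (Gate Q)) : gatesOp (l ++ l') = gatesOp l' * gatesOp l := by
  induction l with
  | nil => simp [gatesOp]
  | cons g l ih => simp [gatesOp, ih, mul_assoc]

/-- A gate can be pulled in front of gates that act on other qubits. -/
theorem gatesOp_append_cons {l : List (Gate Q)} {g : Gate Q} (l' : List (Gate Q))
    (h : ∀ x ∈ l, Disjoint x.qubits g.qubits) :
    gatesOp (l ++ g :: l') = gatesOp (g :: (l ++ l')) := by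
  induction l with
  | nil => rfl
  | cons x l ih =>
    have hx := (Gate.commute (h x (by simp))).eq
    simp only [List.cons_append, gatesOp] at ih ⊢
    rw [ih fun y hy => h y (by simp [hy])]
    rw [mul_assoc, mul_assoc, hx]

end Ket

section Schedule

variable {Q : Type*} [DecidableEq Q]

/-- The condition on two labelled gates, the first preceding the second in a list, under which they may
be executed in the order of the labels. -/
def Before (x y : ℕ × Gate Q) : Prop := Disjoint x.2.qubits y.2.qubits ∨ x.1 < y.1

/-- The gates with the time label `i`. -/
def slotAt (L : List (ℕ × Gate Q)) (i : ℕ) : List (Gate Q) :=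
  (L.filter fun x => x.1 = i).map Prod.snd

theorem mem_slotAt {L : List (ℕ × Gate Q)} {i : ℕ} {g : Gate Q} :
    g ∈ slotAt L i ↔ (i, g) ∈ L := by
  simp [slotAt]

theorem slotAt_pairwise {L : List (ℕ × Gate Q)} (hL : L.Pairwise Before) (i : ℕ) :
    (slotAt L i).Pairwise fun g g' => Disjoint g.qubits g'.qubits := by
  unfold slotAt
  rw [List.pairwise_map, List.pairwise_filter]
  refine hL.imp ?_
  rintro x y (h | h) hx hy
  · exact h
  · simp only [decide_eq_true_eq] at hx hy
    omega

/-- The circuit whose time slots collect the gates with the same time label. -/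
def schedule (L : List (ℕ × Gate Q)) (hL : L.Pairwise Before) (N : ℕ) : Circuit Q where
  slots := (List.range N).map (slotAt L)
  parallel := by
    intro s hs
    obtain ⟨i, -, rfl⟩ := List.mem_map.1 hs
    exact slotAt_pairwise hL i

/-- A gate added at the head of the list comes, in the circuit, only after gates with smaller labels,
which act on other qubits when the list satisfies `Before`. -/
theorem flatten_slotAt_cons (x : ℕ × Gate Q) (L : List (ℕ × Gate Q)) (N : ℕ) (hx : x.1 < N) :
    ∃ A B : List (Gate Q), ((List.range N).map (slotAt (x :: L))).flatten = A ++ x.2 :: B ∧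
      ((List.range N).map (slotAt L)).flatten = A ++ B ∧
      ∀ g ∈ A, ∃ i < x.1, (i, g) ∈ L := by
  obtain ⟨k, rfl⟩ := Nat.exists_eq_add_of_lt hx
  have hr : List.range (x.1 + k + 1) =
      List.range x.1 ++ x.1 :: (List.range k).map (fun j => x.1 + (1 + j)) := by
    rw [show x.1 + k + 1 = x.1 + (1 + k) by ring, List.range_add, List.range_add]
    simp [Function.comp_def]
  have hne : ∀ i, i ≠ x.1 → slotAt (x :: L) i = slotAt L i := by
    intro i hi
    simp [slotAt, hi.symm]
  have heq : slotAt (x :: L) x.1 = x.2 :: slotAt L x.1 := by simp [slotAt]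
  refine ⟨((List.range x.1).map (slotAt L)).flatten, slotAt L x.1 ++
    (((List.range k).map (fun j => x.1 + (1 + j))).map (slotAt L)).flatten, ?_, ?_, ?_⟩
  · rw [hr, List.map_append, List.flatten_append, List.map_cons, List.flatten_cons, heq]
    congr 1
    · congr 1
      refine List.map_congr_left fun i hi => hne i ?_
      rw [List.mem_range] at hi
      omega
    · rw [List.cons_append]
      congr 3
      refine List.map_congr_left fun i hi => hne i ?_
      obtain ⟨j, -, rfl⟩ := List.mem_map.1 hi
      omega
  · rw [hr, List.map_append, List.flatten_append, List.map_cons, List.flatten_cons]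
  · intro g hg
    rw [List.mem_flatten] at hg
    obtain ⟨s, hs, hgs⟩ := hg
    obtain ⟨i, hi, rfl⟩ := List.mem_map.1 hs
    exact ⟨i, List.mem_range.1 hi, mem_slotAt.1 hgs⟩

theorem schedule_gates_perm (L : List (ℕ × Gate Q)) (hL : L.Pairwise Before) (N : ℕ)
    (hN : ∀ x ∈ L, x.1 < N) : (schedule L hL N).gates.Perm (L.map Prod.snd) := by
  show ((List.range N).map (slotAt L)).flatten.Perm _
  clear hL
  induction L with
  | nil =>
    have : ((List.range N).map (slotAt ([] : List (ℕ × Gate Q)))).flatten = [] := by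
      simp [slotAt]
    rw [this]; rfl
  | cons x L ih =>
    obtain ⟨A, B, h1, h2, -⟩ := flatten_slotAt_cons x L N (hN x (by simp))
    rw [h1, List.map_cons]
    refine List.perm_middle.trans (List.Perm.cons _ ?_)
    rw [← h2]
    exact ih fun y hy => hN y (by simp [hy])

/-- Executing the gates slot by slot has the same effect as executing them in the order of the list,
since only gates on disjoint sets of qubits are exchanged. -/
theorem schedule_op [Fintype Q] (L : List (ℕ × Gate Q)) (hL : L.Pairwise Before) (N : ℕ)
    (hN : ∀ x ∈ L, x.1 < N) : (schedule L hL N).op = gatesOp (L.map Prod.snd) := by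
  show gatesOp ((List.range N).map (slotAt L)).flatten = _
  induction L with
  | nil =>
    have : ((List.range N).map (slotAt ([] : List (ℕ × Gate Q)))).flatten = [] := by
      simp [slotAt]
    rw [this]; rfl
  | cons x L ih =>
    obtain ⟨A, B, h1, h2, h3⟩ := flatten_slotAt_cons x L N (hN x (by simp))
    rw [List.pairwise_cons] at hL
    rw [h1, List.map_cons, gatesOp_append_cons, ← h2]
    · simp only [gatesOp]
      rw [ih hL.2 fun y hy => hN y (by simp [hy])]
    · intro g hg
      obtain ⟨i, hi, hm⟩ := h3 g hg
      rcases hL.1 _ hm with h | h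
      · exact h.symm
      · exact absurd h (by simp only; omega)

/-- The depth of a kind of gates in a scheduled circuit is at most the number of the time labels that
these gates use. -/
theorem schedule_depth_le (L : List (ℕ × Gate Q)) (hL : L.Pairwise Before) (N : ℕ) (k : Kind)
    (A : Finset ℕ) (hA : ∀ x ∈ L, x.2.kind = k → x.1 ∈ A) :
    (schedule L hL N).depth k ≤ A.card := by
  show List.countP _ ((List.range N).map (slotAt L)) ≤ _
  rw [List.countP_map, List.countP_eq_length_filter]
  have hnd := (List.nodup_range (n := N)).filter
    ((fun L : List (Gate Q) => L.any fun g => decide (g.kind = k)) ∘ slotAt L)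
  rw [← List.toFinset_card_of_nodup hnd]
  refine Finset.card_le_card fun i hi => ?_
  simp only [List.mem_toFinset, List.mem_filter, Function.comp, List.any_eq_true,
    decide_eq_true_eq] at hi
  obtain ⟨-, g, hg, hk⟩ := hi
  exact hA _ (mem_slotAt.1 hg) hk

end Schedule

namespace Circuit

variable {Q : Type*} [DecidableEq Q] [Fintype Q]

/-- The pigeonhole principle: when the depth is less than the cost, a slot holds two gates. -/
theorem exists_slot_two_le (k : Kind) (S : List (List (Gate Q)))
    (h : (S.countP fun L => L.any fun g => decide (g.kind = k)) <
      S.flatten.countP fun g => decide (g.kind = k)) :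
    ∃ s ∈ S, 2 ≤ s.countP fun g => decide (g.kind = k) := by
  induction S with
  | nil => simp at h
  | cons s S ih =>
    by_cases h2 : 2 ≤ s.countP fun g => decide (g.kind = k)
    · exact ⟨s, by simp, h2⟩
    · rw [List.flatten_cons, List.countP_append, List.countP_cons] at h
      have : (S.countP fun L => L.any fun g => decide (g.kind = k)) <
          S.flatten.countP fun g => decide (g.kind = k) := by
        by_cases h0 : 0 < s.countP fun g => decide (g.kind = k)
        · have : (s.any fun g => decide (g.kind = k)) = true := by
            obtain ⟨g, hg, hk⟩ := List.countP_pos_iff.1 h0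
            exact List.any_eq_true.2 ⟨g, hg, hk⟩
          rw [this] at h
          simp only [if_true] at h
          omega
        · omega
      obtain ⟨s', hs', h2'⟩ := ih this
      exact ⟨s', by simp [hs'], h2'⟩

/-- If two gates of the kind `k` share a time slot, then one of them can be moved to a slot of its
own: this raises the depth of the kind `k` by one and changes no other depth. -/
theorem exists_depth_succ (c : Circuit Q) (k : Kind) (h : c.depth k < c.cost k) :
    ∃ c' : Circuit Q, c'.op = c.op ∧ c'.gates.Perm c.gates ∧ c'.depth k = c.depth k + 1 ∧
      ∀ k', k' ≠ k → c'.depth k' = c.depth k' := by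
  obtain ⟨s, hs, h2⟩ := exists_slot_two_le k c.slots h
  obtain ⟨g, hg, hgk⟩ := List.countP_pos_iff.1 (by omega : 0 < s.countP fun g => decide (g.kind = k))
  obtain ⟨u, v, rfl⟩ := List.append_of_mem hg
  obtain ⟨pre, post, hsl⟩ := List.append_of_mem hs
  have hpar := c.parallel _ hs
  have hdu : ∀ x ∈ u, Disjoint x.qubits g.qubits := by
    intro x hx
    rw [List.pairwise_append] at hpar
    exact hpar.2.2 x hx g (by simp)
  have huv : (u ++ v).Pairwise fun g g' => Disjoint g.qubits g'.qubits :=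
    hpar.sublist ((List.Sublist.refl u).append (List.sublist_cons_self g v))
  simp only [decide_eq_true_eq] at hgk
  refine ⟨⟨pre ++ [g] :: (u ++ v) :: post, ?_⟩, ?_, ?_, ?_, ?_⟩
  · intro L hL
    simp only [List.mem_append, List.mem_cons] at hL
    rcases hL with hL | rfl | rfl | hL
    · exact c.parallel L (by rw [hsl]; simp [hL])
    · simp
    · exact huv
    · exact c.parallel L (by rw [hsl]; simp [hL])
  · simp only [op, gates, hsl, List.flatten_append, List.flatten_cons, gatesOp_append]
    rw [← gatesOp_append u (g :: v), gatesOp_append_cons v hdu]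
    simp only [gatesOp, gatesOp_append, one_mul, mul_assoc]
  · simp only [gates, hsl, List.flatten_append, List.flatten_cons]
    refine List.Perm.append_left _ ?_
    rw [← List.append_assoc]
    refine List.Perm.append_right _ ?_
    simpa using (List.perm_middle (a := g) (l₁ := u) (l₂ := v)).symm
  · have h1 : ((u ++ g :: v).any fun g => decide (g.kind = k)) = true :=
      List.any_eq_true.2 ⟨g, by simp, by simp [hgk]⟩
    have h3 : ((u ++ v).any fun g => decide (g.kind = k)) = true := by
      have : 0 < (u ++ v).countP fun g => decide (g.kind = k) := by
        rw [List.countP_append, List.countP_cons] at h2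
        simp only [hgk, decide_true, if_true] at h2
        rw [List.countP_append]
        omega
      obtain ⟨g', hg', hk⟩ := List.countP_pos_iff.1 this
      exact List.any_eq_true.2 ⟨g', hg', hk⟩
    simp only [depth, hsl, List.countP_append, List.countP_cons, h1, h3]
    simp [hgk]
    omega
  · intro k' hk'
    have hgk' : g.kind ≠ k' := by rw [hgk]; exact hk'.symm
    have h1 : ((u ++ g :: v).any fun g => decide (g.kind = k')) =
        ((u ++ v).any fun g => decide (g.kind = k')) := by
      simp [List.any_append, hgk']
    simp only [depth, hsl, List.countP_append, List.countP_cons, h1]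
    simp [hgk']

/-- The depth of one kind of gates can be raised to any value up to its cost. -/
theorem exists_depth_eq (c : Circuit Q) (k : Kind) (d : ℕ) (h1 : c.depth k ≤ d)
    (h2 : d ≤ c.cost k) :
    ∃ c' : Circuit Q, c'.op = c.op ∧ c'.gates.Perm c.gates ∧ c'.depth k = d ∧
      ∀ k', k' ≠ k → c'.depth k' = c.depth k' := by
  induction d, h1 using Nat.le_induction with
  | base => exact ⟨c, rfl, .refl _, rfl, fun _ _ => rfl⟩
  | succ d hd ih =>
    obtain ⟨c', a1, a2, a3, a4⟩ := ih (by omega)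
    have hc : c'.cost k = c.cost k := a2.countP_eq _
    obtain ⟨c'', b1, b2, b3, b4⟩ := exists_depth_succ c' k (by omega)
    exact ⟨c'', b1.trans a1, b2.trans a2, by omega, fun k' hk => (b4 k' hk).trans (a4 k' hk)⟩

end Circuit

/-! ### Gates with time labels, and relative-phase Toffoli nodes -/

/-- Instructions on qubits numbered by natural numbers. The Boolean in `tg` and `sg` is `true` for
`T` and `S`, and `false` for their inverses. -/
inductive Ins where
  | cx (c t : ℕ)
  | tg (s : Bool) (q : ℕ)
  | sg (s : Bool) (q : ℕ)
  | hg (q : ℕ)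
  | rx (θ : ℝ) (q : ℕ)
  | rz (θ : ℝ) (q : ℕ)

namespace Ins

variable {Q : Type*} [DecidableEq Q] [Fintype Q]

/-- The gate of an instruction, the qubit number `i` being `f i`. The instruction `cx c t` is
meant for `f c ≠ f t`; otherwise its gate is an unused default. -/
def gate (f : ℕ → Q) : Ins → Gate Q
  | cx c t => if h : f c ≠ f t then .cnot (f c) (f t) h else .gateH (f c)
  | tg true q => .gateT (f q)
  | tg false q => .gateTdg (f q)
  | sg true q => .gateS (f q)
  | sg false q => .gateSdg (f q)
  | hg q => .gateH (f q)
  | rx θ q => .rx θ (f q)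
  | rz θ q => .rz θ (f q)

/-- The qubit numbers of an instruction. -/
def qs : Ins → List ℕ
  | cx c t => [c, t]
  | tg _ q => [q]
  | sg _ q => [q]
  | hg q => [q]
  | rx _ q => [q]
  | rz _ q => [q]

/-- The inverse instruction. -/
def inv : Ins → Ins
  | cx c t => cx c t
  | tg s q => tg (!s) q
  | sg s q => sg (!s) q
  | hg q => hg q
  | rx θ q => rx (-θ) q
  | rz θ q => rz (-θ) q

end Ins

open Ins

/-- A sequence of instructions with time labels. Its operator is that of the instructions in the order
of the list; the labels determine the time slots. -/
abbrev Prog := List (ℕ × Ins)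

theorem fin2_cases (v : Fin 2) : v = 0 ∨ v = 1 := by omega

section Op

variable {Q : Type*} [DecidableEq Q] [Fintype Q] (f : ℕ → Q)

/-- The operator of a program. -/
noncomputable def opL (L : Prog) : Matrix (Q → Fin 2) (Q → Fin 2) ℂ :=
  gatesOp (L.map fun x => x.2.gate f)

@[simp] theorem opL_nil : opL f [] = 1 := rfl

theorem opL_cons (x : ℕ × Ins) (L : Prog) : opL f (x :: L) = opL f L * (x.2.gate f).op := rfl

theorem opL_append (L L' : Prog) : opL f (L ++ L') = opL f L' * opL f L := by
  simp [opL, gatesOp_append]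

/-- The primitive eighth root of unity that the `T` gate applies. -/
noncomputable def omega8 : ℂ := Complex.exp (Complex.I * ((Real.pi / 4 : ℝ) : ℂ))

theorem omega8_mul_self : omega8 * omega8 = Complex.I := by
  rw [omega8, ← Complex.exp_add]
  convert Complex.exp_pi_div_two_mul_I using 2
  push_cast; ring

theorem omega8_ne_zero : omega8 ≠ 0 := Complex.exp_ne_zero _

theorem omega8_inv : omega8⁻¹ = -Complex.I * omega8 := by
  rw [inv_eq_iff_eq_inv, eq_comm, inv_eq_of_mul_eq_one_left]
  linear_combination (-Complex.I) * omega8_mul_self - Complex.I_mul_I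

/-- The phase that `T` (or its inverse) applies to the basis state `v`. -/
noncomputable def tph (s : Bool) (v : Fin 2) : ℂ :=
  if v = 1 then (if s then omega8 else omega8⁻¹) else 1

/-- The phase that `S` (or its inverse) applies to the basis state `v`. -/
noncomputable def sph (s : Bool) (v : Fin 2) : ℂ :=
  if v = 1 then (if s then Complex.I else -Complex.I) else 1

/-- An `S` gate turns a `T` gate into one of the opposite sign. -/
theorem sph_mul_tph_not (s : Bool) (v : Fin 2) : sph s v * tph (!s) v = tph s v := by
  have h := omega8_mul_self
  have h0 := omega8_ne_zero
  unfold sph tph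
  by_cases hv : v = 1 <;> cases s <;> simp [hv]
  · rw [omega8_inv]; ring
  · rw [← h]; field_simp

theorem phase_mulVec_ket (θ : ℝ) (q : Q) (y : Q → Fin 2) :
    controlled ∅ q (phase θ) *ᵥ ket y =
      (if y q = 1 then Complex.exp (Complex.I * (θ : ℂ)) else 1) • ket y := by
  rw [controlled_empty_mulVec_ket, Fin.sum_univ_two]
  have hy : update y q (y q) = y := update_eq_self _ _
  rcases fin2_cases (y q) with hv | hv <;> rw [hv] at hy ⊢ <;> simp [phase, hy]

theorem tg_ket (s : Bool) (q : ℕ) (y : Q → Fin 2) :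
    ((tg s q).gate f).op *ᵥ ket y = tph s (y (f q)) • ket y := by
  cases s
  · show controlled ∅ (f q) (phase (-(Real.pi / 4))) *ᵥ _ = _
    rw [phase_mulVec_ket, tph, omega8, ← Complex.exp_neg]
    simp
  · show controlled ∅ (f q) (phase (Real.pi / 4)) *ᵥ _ = _
    rw [phase_mulVec_ket, tph, omega8]
    simp

theorem sg_ket (s : Bool) (q : ℕ) (y : Q → Fin 2) :
    ((sg s q).gate f).op *ᵥ ket y = sph s (y (f q)) • ket y := by
  have h1 : Complex.exp (Complex.I * ((Real.pi / 2 : ℝ) : ℂ)) = Complex.I := by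
    convert Complex.exp_pi_div_two_mul_I using 2
    push_cast; ring
  cases s
  · show controlled ∅ (f q) (phase (-(Real.pi / 2))) *ᵥ _ = _
    have h2 : Complex.exp (Complex.I * ((-(Real.pi / 2) : ℝ) : ℂ)) = -Complex.I := by
      rw [Complex.ofReal_neg, mul_neg, Complex.exp_neg, h1, Complex.inv_I]
    rw [phase_mulVec_ket, sph, h2]
    simp
  · show controlled ∅ (f q) (phase (Real.pi / 2)) *ᵥ _ = _
    rw [phase_mulVec_ket, sph, h1]
    simp

theorem cx_ket {c t : ℕ} (h : f c ≠ f t) (y : Q → Fin 2) :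
    ((cx c t).gate f).op *ᵥ ket y = ket (update y (f t) (y (f t) + y (f c))) := by
  have : (cx c t).gate f = .cnot (f c) (f t) h := by simp [gate, h]
  rw [this]
  show controlled {f c} (f t) pauliX *ᵥ _ = _
  rw [controlled_mulVec_ket, Fin.sum_univ_two]
  simp only [Finset.mem_singleton, forall_eq]
  rcases fin2_cases (y (f t)) with hv | hv <;> rcases fin2_cases (y (f c)) with hw | hw <;>
    simp [pauliX, hv, hw] <;> rw [hv] <;> simp

/-- The amplitude of the Hadamard gate. -/
noncomputable def hamp : ℂ := ((1 / Real.sqrt 2 : ℝ) : ℂ)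

theorem hamp_mul_self : hamp * hamp = 1 / 2 := by
  rw [hamp, ← Complex.ofReal_mul, div_mul_div_comm, Real.mul_self_sqrt (by norm_num)]
  push_cast; norm_num

/-- The sign `(-1) ^ v`. -/
def sgn (v : Fin 2) : ℂ := if v = 1 then -1 else 1

theorem hg_ket (q : ℕ) (y : Q → Fin 2) :
    ((hg q).gate f).op *ᵥ ket y =
      hamp • (ket (update y (f q) 0) + sgn (y (f q)) • ket (update y (f q) 1)) := by
  show controlled ∅ (f q) hadamard *ᵥ _ = _
  rw [controlled_empty_mulVec_ket, Fin.sum_univ_two]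
  rcases fin2_cases (y (f q)) with hv | hv <;> simp [hadamard, hamp, sgn, hv]

end Op

section Node

/-- A node of a tree of relative-phase Toffoli gates: the bit of the qubit `b` is flipped when the
qubits `c` and `a` are both active. A qubit is active when its bit is `1` if the corresponding flag
is `true`, and when its bit is `0` otherwise. -/
structure Node where
  b : ℕ
  c : ℕ
  a : ℕ
  ch : Bool
  ah : Bool

/-- The bit value of an active qubit. -/
def act (h : Bool) : Fin 2 := if h then 1 else 0

namespace Node

/-- Whether both inputs of a node are active, as a bit. -/
def flip (N : Node) (va vc : Fin 2) : Fin 2 := if vc = act N.ch ∧ va = act N.ah then 1 else 0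

/-- The phase of the diagonal part of a node: one `T` gate, with a sign, on each of the four parities
that contain `vb`. -/
noncomputable def diag (N : Node) (va vb vc : Fin 2) : ℂ :=
  tph true vb * tph (!N.ch) (vb + vc) * tph (N.ch == N.ah) (vb + vc + va) * tph (!N.ah) (vb + va)

/-- The relative phase of a node. The last factor comes from the `CNOT` gate from `a` to `b` that the
diagonal part leaves behind and that the Hadamard gates turn into a sign. -/
noncomputable def rph (N : Node) (va vb vc : Fin 2) : ℂ :=
  N.diag va 0 vc * (if va = 1 ∧ vb + N.flip va vc = 1 then -1 else 1)

/-- Up to a relative phase, the diagonal part is a doubly controlled `Z` gate with the target `b`. -/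
theorem diag_one (N : Node) (va vc : Fin 2) :
    N.diag va 1 vc = sgn (N.flip va vc) * N.diag va 0 vc := by
  have h := omega8_mul_self
  have h0 := omega8_ne_zero
  have hI : omega8 * omega8 * (omega8 * omega8) = -1 := by rw [h, Complex.I_mul_I]
  have hi2 : omega8⁻¹ * omega8⁻¹ = -(omega8 * omega8) := by
    rw [← mul_inv, h, Complex.inv_I]
  rcases N with ⟨b, c, a, ch, ah⟩
  rcases fin2_cases va with rfl | rfl <;> rcases fin2_cases vc with rfl | rfl <;>
    cases ch <;> cases ah <;>
    simp [diag, flip, tph, sgn, act, h0] <;> first | linear_combination hI | linear_combination hi2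

/-- The bit assignment after a node. -/
def map (N : Node) (y : ℕ → Fin 2) : ℕ → Fin 2 :=
  update y N.b (y N.b + N.flip (y N.a) (y N.c))

end Node

/-- The `S` gate that precedes a `T` gate of the opposite sign, if there is one. -/
def sPart (b : ℕ) (s : Bool) (o : Option ℕ) : Prog :=
  match o with
  | none => []
  | some l => [(l, sg s b)]

/-- The `T` gate that completes `sPart` to a `T` gate of the sign `s`. -/
def tPart (b : ℕ) (s : Bool) (o : Option ℕ) (l : ℕ) : Prog :=
  match o with
  | none => [(l, tg s b)]
  | some _ => [(l, tg (!s) b)]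

/-- A node implemented with three `CNOT` gates and four layers of `T` gates. The parameters `h0`, `p`,
`x`, `q` are the time labels of its parts; `o0` and `o2` are those of optional `S` gates. -/
def slow (N : Node) (h0 p x q : ℕ) (o0 o2 : Option ℕ) : Prog :=
  (h0, hg N.b) :: (sPart N.b true o0 ++ tPart N.b true o0 p ++
    [(p + 1, cx N.c N.b), (p + 8, tg (!N.ch) N.b), (x, cx N.a N.b)] ++
    sPart N.b (N.ch == N.ah) o2 ++ tPart N.b (N.ch == N.ah) o2 q ++
    [(q + 1, cx N.c N.b), (q + 8, tg (!N.ah) N.b)]) ++ [(q + 12, hg N.b)]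

/-- A node implemented with four `CNOT` gates and two layers of `T` gates, two of which act on the
qubit `c`. The parameters are as in `slow`, and `he` is the label of the last gate. -/
def fast (N : Node) (h0 p x q he : ℕ) (o0 o1 : Option ℕ) : Prog :=
  (h0, hg N.b) :: (sPart N.b true o0 ++ [(p - 1, cx N.b N.c)] ++ tPart N.b true o0 p ++
    [(p, tg (!N.ch) N.c), (x, cx N.a N.b), (x + 1, cx N.a N.c)] ++
    sPart N.b (!N.ah) o1 ++ tPart N.b (!N.ah) o1 q ++
    [(q, tg (N.ch == N.ah) N.c), (q + 1, cx N.b N.c)]) ++ [(he, hg N.b)]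

end Node

section Realize

variable {Q : Type*} [DecidableEq Q] [Fintype Q] (f : ℕ → Q)

namespace Node

/-- The three qubits of a node are distinct. -/
def Distinct (N : Node) : Prop := f N.a ≠ f N.b ∧ f N.c ≠ f N.b ∧ f N.a ≠ f N.c

/-- The basis state after a node, on the register. -/
def regMap (N : Node) (y : Q → Fin 2) : Q → Fin 2 :=
  update y (f N.b) (y (f N.b) + N.flip (y (f N.a)) (y (f N.c)))

/-- The relative phase of a node, on the register. -/
noncomputable def regPhase (N : Node) (y : Q → Fin 2) : ℂ :=
  N.rph (y (f N.a)) (y (f N.b)) (y (f N.c))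

/-- The basis state `y` with new values of the bits of the three qubits of a node. -/
def st (N : Node) (y : Q → Fin 2) (va vb vc : Fin 2) : Q → Fin 2 := fun q =>
  if q = f N.a then va else if q = f N.b then vb else if q = f N.c then vc else y q

variable {f} {N : Node} (hN : N.Distinct f) (y : Q → Fin 2) (va vb vc : Fin 2)
include hN

theorem st_a : N.st f y va vb vc (f N.a) = va := by simp [st]

theorem st_b : N.st f y va vb vc (f N.b) = vb := by simp [st, hN.1.symm]

theorem st_c : N.st f y va vb vc (f N.c) = vc := by simp [st, hN.2.1, hN.2.2.symm]

theorem update_st_b (v : Fin 2) :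
    update (N.st f y va vb vc) (f N.b) v = N.st f y va v vc := by
  funext q
  by_cases h : q = f N.b
  · subst h; rw [update_self, st_b hN]
  · rw [update_of_ne h]; simp [st, h]

theorem update_st_c (v : Fin 2) :
    update (N.st f y va vb vc) (f N.c) v = N.st f y va vb v := by
  funext q
  by_cases h : q = f N.c
  · subst h; rw [update_self, st_c hN]
  · rw [update_of_ne h]; simp [st, h]

theorem st_self : N.st f y (y (f N.a)) (y (f N.b)) (y (f N.c)) = y := by
  funext q
  simp only [st]
  split_ifs <;> simp_all

theorem regMap_eq :
    N.regMap f y =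
      N.st f y (y (f N.a)) (y (f N.b) + N.flip (y (f N.a)) (y (f N.c))) (y (f N.c)) := by
  rw [← update_st_b hN y _ (y (f N.b)), st_self hN, regMap]

end Node

theorem opL_cons_ket (x : ℕ × Ins) (L : Prog) (v : (Q → Fin 2) → ℂ) :
    opL f (x :: L) *ᵥ v = opL f L *ᵥ ((x.2.gate f).op *ᵥ v) := by
  rw [opL_cons, mulVec_mulVec]

theorem opL_append_ket (L L' : Prog) (v : (Q → Fin 2) → ℂ) :
    opL f (L ++ L') *ᵥ v = opL f L' *ᵥ (opL f L *ᵥ v) := by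
  rw [opL_append, mulVec_mulVec]

/-- A program acts on the basis states as the node `N`, up to its relative phase. -/
def Realizes1 (L : Prog) (N : Node) : Prop :=
  ∀ y, opL f L *ᵥ ket y = N.regPhase f y • ket (N.regMap f y)

variable {f}

/-- Conjugating a suitable diagonal operator, followed by a `CNOT`, with Hadamard gates makes it a
relative-phase Toffoli gate. -/
theorem realizes1_of_mid {N : Node} (hN : N.Distinct f) (M : Prog) (l l' : ℕ)
    (hM : ∀ y va vb vc, opL f M *ᵥ ket (N.st f y va vb vc) =
      N.diag va vb vc • ket (N.st f y va (vb + va) vc)) :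
    Realizes1 f ((l, hg N.b) :: M ++ [(l', hg N.b)]) N := by
  intro y
  rw [opL_append_ket, opL_cons_ket, opL_cons_ket, Node.regMap_eq hN, Node.regPhase, Node.rph]
  conv_lhs => rw [← Node.st_self hN y]
  generalize y (f N.a) = va
  generalize y (f N.b) = vb
  generalize y (f N.c) = vc
  simp only [hg_ket, Node.st_b hN, Node.update_st_b hN, mulVec_smul, mulVec_add, hM,
    Node.diag_one, opL_nil, one_mulVec]
  have h2 := hamp_mul_self
  generalize N.diag va 0 vc = D
  generalize N.flip va vc = w
  rcases fin2_cases va with rfl | rfl <;> rcases fin2_cases vb with rfl | rfl <;>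
    rcases fin2_cases w with rfl | rfl <;> simp [sgn] <;>
    match_scalars <;> first | ring1 | linear_combination 2 * D * h2 | linear_combination -2 * D * h2

theorem slow_realizes {N : Node} (hN : N.Distinct f) (h0 p x q : ℕ) (o0 o2 : Option ℕ) :
    Realizes1 f (slow N h0 p x q o0 o2) N := by
  refine realizes1_of_mid hN _ _ _ fun y va vb vc => ?_
  have e1 : ∀ v w : Fin 2, v + w + w = v := by decide
  cases o0 <;> cases o2 <;>
  · simp only [sPart, tPart, List.nil_append, List.cons_append, opL_cons_ket, opL_nil, one_mulVec,
      tg_ket, sg_ket, cx_ket f hN.1, cx_ket f hN.2.1, mulVec_smul, Node.st_a hN, Node.st_b hN,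
      Node.st_c hN, Node.update_st_b hN, smul_smul]
    rw [show vb + vc + va + vc = vb + va by rw [add_right_comm, e1]]
    congr 1
    simp only [Node.diag, ← sph_mul_tph_not true vb, ← sph_mul_tph_not (N.ch == N.ah)]
    ring

theorem fast_realizes {N : Node} (hN : N.Distinct f) (h0 p x q he : ℕ) (o0 o1 : Option ℕ) :
    Realizes1 f (fast N h0 p x q he o0 o1) N := by
  refine realizes1_of_mid hN _ _ _ fun y va vb vc => ?_
  have e1 : ∀ v w u : Fin 2, v + w + u + (w + u) = v := by decide
  cases o0 <;> cases o1 <;>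
  · simp only [sPart, tPart, List.nil_append, List.cons_append, opL_cons_ket, opL_nil, one_mulVec,
      tg_ket, sg_ket, cx_ket f hN.1, cx_ket f hN.2.2, cx_ket f hN.2.1.symm, mulVec_smul,
      Node.st_a hN, Node.st_b hN,
      Node.st_c hN, Node.update_st_b hN, Node.update_st_c hN, smul_smul, e1]
    congr 1
    simp only [Node.diag, ← sph_mul_tph_not true vb, ← sph_mul_tph_not (!N.ah), add_comm vc vb]
    ring

end Realize

/-! ### Reversible computations and operators on the target -/

section Realize

variable {Q : Type*} [DecidableEq Q] [Fintype Q] (f : ℕ → Q)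

/-- The bit assignment after a list of nodes. -/
def mapL : List Node → (ℕ → Fin 2) → ℕ → Fin 2
  | [], y => y
  | N :: Ns, y => mapL Ns (N.map y)

/-- The basis state after a list of nodes, on the register. -/
def regMapL : List Node → (Q → Fin 2) → Q → Fin 2
  | [], y => y
  | N :: Ns, y => regMapL Ns (N.regMap f y)

/-- The phase that a list of nodes produces, on the register. -/
noncomputable def regPhaseL : List Node → (Q → Fin 2) → ℂ
  | [], _ => 1
  | N :: Ns, y => N.regPhase f y * regPhaseL Ns (N.regMap f y)

/-- A program acts on the basis states as the list of nodes `Ns`, up to their relative phases. -/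
def Realizes (L : Prog) (Ns : List Node) : Prop :=
  ∀ y, opL f L *ᵥ ket y = regPhaseL f Ns y • ket (regMapL f Ns y)

variable {f}

theorem mapL_append (Ns Ns' : List Node) (y : ℕ → Fin 2) :
    mapL (Ns ++ Ns') y = mapL Ns' (mapL Ns y) := by
  induction Ns generalizing y with
  | nil => rfl
  | cons N Ns ih => exact ih _

theorem regMapL_append (Ns Ns' : List Node) (y : Q → Fin 2) :
    regMapL f (Ns ++ Ns') y = regMapL f Ns' (regMapL f Ns y) := by
  induction Ns generalizing y with
  | nil => rfl
  | cons N Ns ih => exact ih _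

theorem regPhaseL_append (Ns Ns' : List Node) (y : Q → Fin 2) :
    regPhaseL f (Ns ++ Ns') y = regPhaseL f Ns y * regPhaseL f Ns' (regMapL f Ns y) := by
  induction Ns generalizing y with
  | nil => simp [regPhaseL, regMapL]
  | cons N Ns ih => simp only [List.cons_append, regPhaseL, ih, regMapL, mul_assoc]

theorem Realizes.append {L L' : Prog} {Ns Ns' : List Node} (h : Realizes f L Ns)
    (h' : Realizes f L' Ns') : Realizes f (L ++ L') (Ns ++ Ns') := by
  intro y
  rw [opL_append_ket, h y, mulVec_smul, h' _, smul_smul, regPhaseL_append, regMapL_append]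

theorem Realizes1.realizes {L : Prog} {N : Node} (h : Realizes1 f L N) : Realizes f L [N] := by
  intro y
  rw [h y]
  simp [regPhaseL, regMapL]

/-- The nodes use distinct qubits among those with the numbers `1, …, n`. -/
def Node.Ok (n : ℕ) (N : Node) : Prop :=
  (1 ≤ N.a ∧ N.a ≤ n) ∧ (1 ≤ N.b ∧ N.b ≤ n) ∧ (1 ≤ N.c ∧ N.c ≤ n) ∧
    N.a ≠ N.b ∧ N.c ≠ N.b ∧ N.a ≠ N.c

instance (n : ℕ) (N : Node) : Decidable (N.Ok n) := by unfold Node.Ok; infer_instance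

variable {n : ℕ} (hf : Set.InjOn f {i | i ≤ n})
include hf

theorem f_ne {i j : ℕ} (hi : i ≤ n) (hj : j ≤ n) (h : i ≠ j) : f i ≠ f j := fun he =>
  h (hf hi hj he)

theorem Node.Ok.distinct {N : Node} (h : N.Ok n) : N.Distinct f := by
  obtain ⟨⟨_, h1⟩, ⟨_, h2⟩, ⟨_, h3⟩, h4, h5, h6⟩ := h
  exact ⟨f_ne hf h1 h2 h4, f_ne hf h3 h2 h5, f_ne hf h1 h3 h6⟩

theorem regMap_comp {N : Node} (hN : N.Ok n) {y : Q → Fin 2} {z : ℕ → Fin 2}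
    (h : ∀ i ≤ n, y (f i) = z i) : ∀ i ≤ n, N.regMap f y (f i) = N.map z i := by
  intro i hi
  obtain ⟨⟨_, h1⟩, ⟨_, h2⟩, ⟨_, h3⟩, -⟩ := hN
  unfold Node.regMap Node.map
  by_cases hb : i = N.b
  · subst hb; simp [h _ h1, h _ h2, h _ h3]
  · rw [update_of_ne (f_ne hf hi h2 hb), update_of_ne hb, h i hi]

theorem regMapL_comp {Ns : List Node} (hN : ∀ N ∈ Ns, N.Ok n) {y : Q → Fin 2} {z : ℕ → Fin 2}
    (h : ∀ i ≤ n, y (f i) = z i) : ∀ i ≤ n, regMapL f Ns y (f i) = mapL Ns z i := by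
  induction Ns generalizing y z with
  | nil => exact h
  | cons N Ns ih =>
    exact ih (fun M hM => hN M (by simp [hM])) (regMap_comp hf (hN N (by simp)) h)

theorem regMap_update {N : Node} (hN : N.Ok n) (y : Q → Fin 2) (v : Fin 2) :
    N.regMap f (update y (f 0) v) = update (N.regMap f y) (f 0) v ∧
      N.regPhase f (update y (f 0) v) = N.regPhase f y := by
  obtain ⟨⟨h1', h1⟩, ⟨h2', h2⟩, ⟨h3', h3⟩, -⟩ := hN
  have e : ∀ i, 1 ≤ i → i ≤ n → f i ≠ f 0 := fun i a b => f_ne hf b (by omega) (by omega)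
  unfold Node.regMap Node.regPhase
  simp only [update_of_ne (e _ h1' h1), update_of_ne (e _ h2' h2), update_of_ne (e _ h3' h3)]
  exact ⟨update_comm (e _ h2' h2).symm _ _ _, trivial⟩

theorem regMapL_update {Ns : List Node} (hN : ∀ N ∈ Ns, N.Ok n) (y : Q → Fin 2) (v : Fin 2) :
    regMapL f Ns (update y (f 0) v) = update (regMapL f Ns y) (f 0) v ∧
      regPhaseL f Ns (update y (f 0) v) = regPhaseL f Ns y := by
  induction Ns generalizing y with
  | nil => exact ⟨rfl, rfl⟩
  | cons N Ns ih =>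
    obtain ⟨a, b⟩ := regMap_update hf (hN N (by simp)) y v
    obtain ⟨c, d⟩ := ih (fun M hM => hN M (by simp [hM])) (N.regMap f y)
    simp only [regMapL, regPhaseL, a, b, c, d, and_self]

theorem regMapL_target {Ns : List Node} (hN : ∀ N ∈ Ns, N.Ok n) (y : Q → Fin 2) :
    regMapL f Ns y (f 0) = y (f 0) := by
  have := (regMapL_update hf hN y (y (f 0))).1
  rw [update_eq_self] at this
  rw [this, update_self]

end Realize

section Pauli

theorem rotX_add (a b : ℝ) : rotX a * rotX b = rotX (a + b) := by
  have hI := Complex.I_mul_I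
  simp only [rotX, add_div, Real.cos_add, Real.sin_add]
  ext i j
  fin_cases i <;> fin_cases j <;> simp [Matrix.mul_apply, Fin.sum_univ_two] <;>
    first | ring1 | linear_combination (Complex.sin (a / 2) * Complex.sin (b / 2)) * hI

theorem rotX_zero : rotX 0 = 1 := by
  ext i j
  fin_cases i <;> fin_cases j <;> simp [rotX]

theorem rotZ_add (a b : ℝ) : rotZ a * rotZ b = rotZ (a + b) := by
  ext i j
  fin_cases i <;> fin_cases j <;> simp [rotZ, Matrix.mul_apply, Fin.sum_univ_two, ← Complex.exp_add]
  <;> ring_nf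

theorem rotZ_zero : rotZ 0 = 1 := by
  ext i j
  fin_cases i <;> fin_cases j <;> simp [rotZ]

theorem pauliX_mul_self : pauliX * pauliX = 1 := by
  ext i j
  fin_cases i <;> fin_cases j <;> simp [pauliX]

/-- The matrix of `T` (or of its inverse). -/
noncomputable def matT (s : Bool) : Matrix (Fin 2) (Fin 2) ℂ := !![1, 0; 0, tph s 1]

theorem hadamard_eq : hadamard = !![hamp, hamp; hamp, -hamp] := rfl

theorem hadamard_mul_self : hadamard * hadamard = 1 := by
  have h2 := hamp_mul_self
  ext i j
  fin_cases i <;> fin_cases j <;> simp [hadamard_eq, Matrix.mul_apply, Fin.sum_univ_two] <;>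
    linear_combination 2 * h2

end Pauli

section Mux

variable {Q : Type*} [DecidableEq Q] [Fintype Q] (f : ℕ → Q)

/-- A program applies to the qubit number `0` the one-qubit operator `F y`, where `y` is the basis
state of the other qubits. The field `update` says that `F` ignores the bit of the qubit `0`. -/
structure Mux (L : Prog) (F : (Q → Fin 2) → Matrix (Fin 2) (Fin 2) ℂ) : Prop where
  ket : ∀ y, opL f L *ᵥ ket y = ∑ σ, F y σ (y (f 0)) • ket (update y (f 0) σ)
  update : ∀ y v, F (update y (f 0) v) = F y

variable {f}

theorem mux_nil : Mux f [] fun _ => 1 := by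
  refine ⟨fun y => ?_, fun _ _ => rfl⟩
  rw [opL_nil, one_mulVec, Finset.sum_eq_single (y (f 0))]
  · simp
  · intro σ _ h; simp [h]
  · simp

theorem Mux.append {L L' : Prog} {F F' : (Q → Fin 2) → Matrix (Fin 2) (Fin 2) ℂ}
    (h : Mux f L F) (h' : Mux f L' F') : Mux f (L ++ L') fun y => F' y * F y := by
  refine ⟨fun y => ?_, fun y v => by rw [h.update, h'.update]⟩
  rw [opL_append_ket, h.ket y, mulVec_sum]
  simp only [mulVec_smul, h'.ket, h'.update, update_self, update_idem, Finset.smul_sum, smul_smul]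
  rw [Finset.sum_comm]
  refine Finset.sum_congr rfl fun σ _ => ?_
  rw [← Finset.sum_smul, Matrix.mul_apply]
  congr 1
  exact Finset.sum_congr rfl fun τ _ => mul_comm _ _

/-- A program is the multi-controlled `W` if it applies `W` when all controls are `1`, and the identity
otherwise. -/
theorem Mux.op_eq_controlled {L : Prog} {F : (Q → Fin 2) → Matrix (Fin 2) (Fin 2) ℂ}
    (h : Mux f L F) (C : Finset Q) (W : Matrix (Fin 2) (Fin 2) ℂ)
    (hF : ∀ y, F y = if ∀ q ∈ C, y q = 1 then W else 1) :
    opL f L = controlled C (f 0) W := by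
  refine ext_ket fun y => ?_
  rw [h.ket, controlled_mulVec_ket]
  simp only [hF]

variable (f) in
/-- The one-qubit operator that an instruction with target `0` applies to its target. -/
noncomputable def tmat (y : Q → Fin 2) : Ins → Matrix (Fin 2) (Fin 2) ℂ
  | cx c _ => if y (f c) = 1 then pauliX else 1
  | tg s _ => matT s
  | sg _ _ => 1
  | hg _ => hadamard
  | rx θ _ => rotX θ
  | rz θ _ => rotZ θ

variable (f) in
/-- The one-qubit operator that instructions with target `0` apply to their target. -/
noncomputable def tmatL (y : Q → Fin 2) : Prog → Matrix (Fin 2) (Fin 2) ℂ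
  | [] => 1
  | x :: L => tmatL y L * tmat f y x.2

/-- The instructions that act on the qubit `0`, with controls among `1, …, n`. -/
def OnTarget (n : ℕ) : Ins → Prop
  | cx c t => (1 ≤ c ∧ c ≤ n) ∧ t = 0
  | tg _ q => q = 0
  | sg _ _ => False
  | hg q => q = 0
  | rx _ q => q = 0
  | rz _ q => q = 0

theorem tmat_tg_eq (s : Bool) :
    ((tg s 0).gate f).op = controlled ∅ (f 0) (matT s) := by
  refine ext_ket fun y => ?_
  rw [tg_ket, controlled_empty_mulVec_ket, Fin.sum_univ_two]
  have hy := update_eq_self (f 0) y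
  rcases fin2_cases (y (f 0)) with hv | hv <;> rw [hv] at hy ⊢ <;> simp [matT, tph, hy]

theorem mux_single {n : ℕ} (hf : Set.InjOn f {i | i ≤ n}) {x : ℕ × Ins} (hx : OnTarget n x.2) :
    Mux f [x] fun y => tmat f y x.2 := by
  obtain ⟨l, i⟩ := x
  have h1 : ∀ U, ((i.gate f).op = controlled ∅ (f 0) U) → (∀ y, tmat f y i = U) →
      Mux f [(l, i)] fun y => tmat f y i := by
    intro U hU ht
    refine ⟨fun y => ?_, fun y v => by simp [ht]⟩
    simp only [ht]
    rw [opL_cons, opL_nil, one_mul, hU, controlled_empty_mulVec_ket]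
  cases i with
  | cx c t =>
    obtain ⟨⟨hc, hc'⟩, rfl⟩ := hx
    have hne : f c ≠ f 0 := f_ne hf hc' (by omega) (by omega)
    refine ⟨fun y => ?_, fun y v => ?_⟩
    · rw [opL_cons, opL_nil, one_mul, gate, dif_pos hne]
      show controlled {f c} (f 0) pauliX *ᵥ _ = _
      rw [controlled_mulVec_ket]
      simp [tmat]
    · simp [tmat, update_of_ne hne]
  | tg s q => obtain rfl := hx; exact h1 _ (tmat_tg_eq s) fun _ => rfl
  | sg s q => exact absurd hx (by simp [OnTarget])
  | hg q => obtain rfl := hx; exact h1 _ rfl fun _ => rfl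
  | rx θ q => obtain rfl := hx; exact h1 _ rfl fun _ => rfl
  | rz θ q => obtain rfl := hx; exact h1 _ rfl fun _ => rfl

theorem mux_target {n : ℕ} (hf : Set.InjOn f {i | i ≤ n}) {L : Prog}
    (hL : ∀ x ∈ L, OnTarget n x.2) : Mux f L fun y => tmatL f y L := by
  induction L with
  | nil => exact mux_nil
  | cons x L ih =>
    exact (mux_single hf (hL x (by simp))).append (ih fun z hz => hL z (by simp [hz]))

/-- The inverse of a program, with mirrored time labels. -/
def invP (Λ : ℕ) (L : Prog) : Prog := (L.map fun x => (Λ - x.1, x.2.inv)).reverse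

theorem tph_not_mul (s : Bool) (v : Fin 2) : tph (!s) v * tph s v = 1 := by
  unfold tph
  split_ifs <;> cases s <;> simp [omega8_ne_zero] at *

theorem sph_not_mul (s : Bool) (v : Fin 2) : sph (!s) v * sph s v = 1 := by
  unfold sph
  split_ifs <;> cases s <;> simp at *

theorem controlled_empty_mul (t : Q) (U V : Matrix (Fin 2) (Fin 2) ℂ) :
    controlled ∅ t U * controlled ∅ t V = controlled ∅ t (U * V) := by
  refine ext_ket fun y => ?_
  simp only [← mulVec_mulVec, controlled_empty_mulVec_ket, mulVec_sum, mulVec_smul,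
    update_self, update_idem, Finset.smul_sum, smul_smul]
  rw [Finset.sum_comm]
  refine Finset.sum_congr rfl fun σ _ => ?_
  rw [← Finset.sum_smul, Matrix.mul_apply]
  congr 1
  exact Finset.sum_congr rfl fun τ _ => mul_comm _ _

theorem controlled_empty_one (t : Q) : controlled ∅ t (1 : Matrix (Fin 2) (Fin 2) ℂ) = 1 := by
  refine ext_ket fun y => ?_
  rw [controlled_empty_mulVec_ket, Finset.sum_eq_single (y t), one_mulVec]
  · simp
  · intro σ _ h; simp [h]
  · simp

theorem inv_op_mul_op (i : Ins) : (i.inv.gate f).op * (i.gate f).op = 1 := by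
  cases i with
  | cx c t =>
    by_cases h : f c ≠ f t
    · refine ext_ket fun y => ?_
      rw [← mulVec_mulVec, cx_ket f h, Ins.inv, cx_ket f h, one_mulVec]
      have e : ∀ v w : Fin 2, v + w + w = v := by decide
      simp [update_of_ne h, e]
    · simp only [Ins.inv, gate, dif_neg h]
      show controlled ∅ _ hadamard * controlled ∅ _ hadamard = 1
      rw [controlled_empty_mul, hadamard_mul_self, controlled_empty_one]
  | tg s q =>
    refine ext_ket fun y => ?_
    rw [← mulVec_mulVec, tg_ket, mulVec_smul, Ins.inv, tg_ket, smul_smul, mul_comm, tph_not_mul,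
      one_mulVec, one_smul]
  | sg s q =>
    refine ext_ket fun y => ?_
    rw [← mulVec_mulVec, sg_ket, mulVec_smul, Ins.inv, sg_ket, smul_smul, mul_comm, sph_not_mul,
      one_mulVec, one_smul]
  | hg q =>
    show controlled ∅ _ hadamard * controlled ∅ _ hadamard = 1
    rw [controlled_empty_mul, hadamard_mul_self, controlled_empty_one]
  | rx θ q =>
    show controlled ∅ _ (rotX (-θ)) * controlled ∅ _ (rotX θ) = 1
    rw [controlled_empty_mul, rotX_add, neg_add_cancel, rotX_zero, controlled_empty_one]
  | rz θ q =>
    show controlled ∅ _ (rotZ (-θ)) * controlled ∅ _ (rotZ θ) = 1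
    rw [controlled_empty_mul, rotZ_add, neg_add_cancel, rotZ_zero, controlled_empty_one]

theorem opL_invP_mul (Λ : ℕ) (L : Prog) : opL f (invP Λ L) * opL f L = 1 := by
  induction L with
  | nil => simp [invP]
  | cons x L ih =>
    have : invP Λ (x :: L) = invP Λ L ++ [(Λ - x.1, x.2.inv)] := by simp [invP]
    rw [this, opL_append, opL_cons, opL_cons, opL_nil, one_mul, mul_assoc,
      ← mul_assoc (opL f (invP Λ L)), ih, one_mul, inv_op_mul_op]

theorem opL_append_invP (Λ : ℕ) (L : Prog) : opL f (L ++ invP Λ L) = 1 := by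
  rw [opL_append, opL_invP_mul]

/-- Conjugating by a classical reversible computation evaluates the controls on its output. The
computation and its inverse may be implemented differently, as `K` and `K'`: the relative phases, which
depend on the nodes only, still cancel. -/
theorem Mux.conj {n : ℕ} (hf : Set.InjOn f {i | i ≤ n}) {K K' D : Prog} {Ns : List Node}
    {F : (Q → Fin 2) → Matrix (Fin 2) (Fin 2) ℂ}
    (hN : ∀ N ∈ Ns, N.Ok n) (hK : Realizes f K Ns) (hK' : Realizes f K' Ns) (hD : Mux f D F)
    (Λ : ℕ) : Mux f (K ++ D ++ invP Λ K') fun y => F (regMapL f Ns y) := by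
  refine ⟨fun y => ?_, fun y v => ?_⟩
  · rw [opL_append_ket, opL_append_ket, hK y, mulVec_smul, hD.ket, mulVec_smul, mulVec_sum,
      Finset.smul_sum]
    refine Finset.sum_congr rfl fun σ _ => ?_
    rw [mulVec_smul, smul_comm, ← mulVec_smul]
    have h := regMapL_update hf hN y σ
    rw [← h.1, ← h.2, ← hK' (Function.update y (f 0) σ), mulVec_mulVec, opL_invP_mul, one_mulVec,
      regMapL_target hf hN]
  · rw [(regMapL_update hf hN y v).1, hD.update]

end Mux

/-! ### Rotations and the commutator word -/

section Quaternion

/-- The quaternion `w + x i + y j + z k` as the matrix `w - i (x X + y Y + z Z)`. -/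
noncomputable def quat (w x y z : ℝ) : Matrix (Fin 2) (Fin 2) ℂ :=
  !![(w : ℂ) - Complex.I * z, -Complex.I * x - y; -Complex.I * x + y, w + Complex.I * z]

theorem quat_mul (w x y z w' x' y' z' : ℝ) :
    quat w x y z * quat w' x' y' z' =
      quat (w * w' - x * x' - y * y' - z * z') (w * x' + x * w' + y * z' - z * y')
        (w * y' - x * z' + y * w' + z * x') (w * z' + x * y' - y * x' + z * w') := by
  have hI := Complex.I_mul_I
  ext i j
  fin_cases i <;> fin_cases j <;> simp [quat, Matrix.mul_apply, Fin.sum_univ_two] <;> ring_nf <;>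
    rw [Complex.I_sq] <;> ring

theorem rotX_eq_quat (θ : ℝ) : rotX θ = quat (Real.cos (θ / 2)) (Real.sin (θ / 2)) 0 0 := by
  ext i j
  fin_cases i <;> fin_cases j <;> simp [quat, rotX]

theorem rotZ_eq_quat (θ : ℝ) : rotZ θ = quat (Real.cos (θ / 2)) 0 0 (Real.sin (θ / 2)) := by
  have h := Complex.exp_mul_I ((θ / 2 : ℝ) : ℂ)
  have h' := Complex.exp_mul_I (-((θ / 2 : ℝ) : ℂ))
  rw [Complex.cos_neg, Complex.sin_neg] at h'
  ext i j
  fin_cases i <;> fin_cases j <;> simp [quat, rotZ]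
  · push_cast at h'
    rw [show -(Complex.I * ((θ : ℂ) / 2)) = -((θ : ℂ) / 2) * Complex.I by ring, h']
    ring
  · push_cast at h
    rw [mul_comm, h]
    ring

/-- An element of `SU(2)` is a unit quaternion. -/
theorem exists_quat {W : Matrix (Fin 2) (Fin 2) ℂ}
    (hW : W ∈ Matrix.specialUnitaryGroup (Fin 2) ℂ) :
    ∃ w x y z : ℝ, w ^ 2 + x ^ 2 + y ^ 2 + z ^ 2 = 1 ∧ W = quat w x y z := by
  rw [Matrix.mem_specialUnitaryGroup_iff] at hW
  obtain ⟨h1, h2⟩ := hW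
  have hadj : star W = W.adjugate := by
    have h3 := (Matrix.mem_unitaryGroup_iff').1 h1
    calc star W = star W * (W * W.adjugate) := by rw [Matrix.mul_adjugate, h2]; simp
      _ = W.adjugate := by rw [← mul_assoc, h3, one_mul]
  rw [Matrix.adjugate_fin_two] at hadj
  have e1 : star (W 0 0) = W 1 1 := by
    have := congrFun (congrFun hadj 0) 0
    simpa using this
  have e2 : star (W 1 0) = -W 0 1 := by
    have := congrFun (congrFun hadj 0) 1
    simpa using this
  rw [Matrix.det_fin_two] at h2
  refine ⟨(W 0 0).re, -(W 1 0).im, (W 1 0).re, -(W 0 0).im, ?_, ?_⟩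
  · rw [← e1, ← neg_eq_iff_eq_neg.2 e2] at h2
    have := congrArg Complex.re h2
    simp at this
    nlinarith [this]
  · have e3 : W 0 1 = -star (W 1 0) := by rw [e2, neg_neg]
    ext i j
    fin_cases i <;> fin_cases j <;> simp [quat, e3, ← e1] <;> apply Complex.ext <;> simp

theorem exists_cos_sin {a b : ℝ} (h : a ^ 2 + b ^ 2 = 1) :
    ∃ θ : ℝ, a = Real.cos θ ∧ b = Real.sin θ := by
  have hn : ‖(⟨a, b⟩ : ℂ)‖ = 1 := by
    rw [Complex.norm_def, Complex.normSq_mk, Real.sqrt_eq_one]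
    linarith
  refine ⟨Complex.arg ⟨a, b⟩, ?_, ?_⟩
  · rw [Complex.cos_arg (by intro h0; rw [h0] at hn; simp at hn), hn]; simp
  · rw [Complex.sin_arg, hn]; simp

/-- A point of the plane in polar coordinates. -/
theorem exists_polar (a b : ℝ) : ∃ r θ : ℝ, a = r * Real.cos θ ∧ b = r * Real.sin θ :=
  ⟨‖(⟨a, b⟩ : ℂ)‖, Complex.arg ⟨a, b⟩, by rw [Complex.norm_mul_cos_arg], by
    rw [Complex.norm_mul_sin_arg]⟩

/-- A unit quaternion in polar coordinates: a rotation angle and an axis in spherical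
coordinates. -/
theorem exists_spherical {w x y z : ℝ} (h : w ^ 2 + x ^ 2 + y ^ 2 + z ^ 2 = 1) :
    ∃ θ φ β : ℝ, w = Real.cos θ ∧ x = Real.sin θ * Real.cos φ ∧
      y = Real.sin θ * (Real.sin φ * Real.cos β) ∧ z = Real.sin θ * (Real.sin φ * Real.sin β) := by
  obtain ⟨r, β, rfl, rfl⟩ := exists_polar y z
  obtain ⟨s, φ, rfl, rfl⟩ := exists_polar x r
  have hb := Real.cos_sq_add_sin_sq β
  have hp := Real.cos_sq_add_sin_sq φ
  obtain ⟨θ, rfl, rfl⟩ := exists_cos_sin (a := w) (b := s) (by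
    linear_combination h - s ^ 2 * Real.sin φ ^ 2 * hb - s ^ 2 * hp)
  exact ⟨θ, φ, β, rfl, rfl, by ring, by ring⟩

theorem cos_eq_half (φ : ℝ) : Real.cos φ = Real.cos (φ / 2) ^ 2 - Real.sin (φ / 2) ^ 2 := by
  rw [← Real.cos_two_mul', mul_div_cancel₀ _ two_ne_zero]

theorem sin_eq_half (φ : ℝ) : Real.sin φ = 2 * Real.sin (φ / 2) * Real.cos (φ / 2) := by
  rw [← Real.sin_two_mul, mul_div_cancel₀ _ two_ne_zero]

theorem rotX_conj_quat (β w x y z : ℝ) :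
    rotX β * quat w x y z * rotX (-β) =
      quat w x (y * Real.cos β - z * Real.sin β) (y * Real.sin β + z * Real.cos β) := by
  have h := Real.cos_sq_add_sin_sq (β / 2)
  rw [rotX_eq_quat, rotX_eq_quat, quat_mul, quat_mul, neg_div, Real.cos_neg, Real.sin_neg,
    cos_eq_half β, sin_eq_half β]
  congr 1
  · linear_combination w * h
  · linear_combination x * h
  · ring
  · ring

theorem rotZ_conj_quat (φ w x y z : ℝ) :
    rotZ φ * quat w x y z * rotZ (-φ) =
      quat w (x * Real.cos φ - y * Real.sin φ) (x * Real.sin φ + y * Real.cos φ) z := by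
  have h := Real.cos_sq_add_sin_sq (φ / 2)
  rw [rotZ_eq_quat, rotZ_eq_quat, quat_mul, quat_mul, neg_div, Real.cos_neg, Real.sin_neg,
    cos_eq_half φ, sin_eq_half φ]
  congr 1
  · linear_combination w * h
  · ring
  · ring
  · linear_combination z * h

/-- Every element of `SU(2)` is a rotation about an axis in general position, obtained by turning
the `x`-axis. -/
theorem exists_rotX_conj {W : Matrix (Fin 2) (Fin 2) ℂ}
    (hW : W ∈ Matrix.specialUnitaryGroup (Fin 2) ℂ) :
    ∃ α φ β : ℝ, W = rotX β * rotZ φ * rotX (4 * α) * rotZ (-φ) * rotX (-β) := by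
  obtain ⟨w, x, y, z, h, rfl⟩ := exists_quat hW
  obtain ⟨θ, φ, β, rfl, rfl, rfl, rfl⟩ := exists_spherical h
  refine ⟨θ / 2, φ, β, ?_⟩
  rw [mul_assoc (rotX β), mul_assoc (rotX β), rotX_eq_quat (4 * (θ / 2)), rotZ_conj_quat,
    rotX_conj_quat]
  rw [show 4 * (θ / 2) / 2 = θ by ring]
  congr 1 <;> ring

/-- Every element of `SU(2)` is a rotation about an axis in general position, obtained by turning
the `y`-axis. -/
theorem exists_rotY_conj {W : Matrix (Fin 2) (Fin 2) ℂ}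
    (hW : W ∈ Matrix.specialUnitaryGroup (Fin 2) ℂ) :
    ∃ θ φ β : ℝ, W =
      rotZ φ * rotX β * quat (Real.cos θ) 0 (Real.sin θ) 0 * rotX (-β) * rotZ (-φ) := by
  obtain ⟨w, x, y, z, h, rfl⟩ := exists_quat hW
  obtain ⟨θ, β, φ, rfl, h1, h2, h3⟩ := exists_spherical (w := w) (x := z) (y := y) (z := -x)
    (by linear_combination h)
  refine ⟨θ, φ, Real.pi / 2 - β, ?_⟩
  rw [mul_assoc (rotZ φ), mul_assoc (rotZ φ), rotX_conj_quat, rotZ_conj_quat,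
    Real.cos_pi_div_two_sub, Real.sin_pi_div_two_sub]
  congr 1
  · linarith
  · linarith
  · linarith

end Quaternion

section Word

/-- The operator `X ^ v`. -/
def px (v : Fin 2) : Matrix (Fin 2) (Fin 2) ℂ := if v = 1 then pauliX else 1

/-- The operator that the `T` gates around `px v` make of it: `1` for `v = 0`, and an equatorial
involution exchanging the `x`- and `y`-axes for `v = 1`. -/
noncomputable def twist (v : Fin 2) : Matrix (Fin 2) (Fin 2) ℂ := matT true * px v * matT false

theorem px_mul_self (v : Fin 2) : px v * px v = 1 := by
  rcases fin2_cases v with rfl | rfl <;> simp [px, pauliX_mul_self]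

theorem matT_mul (s : Bool) : matT s * matT (!s) = 1 := by
  cases s <;> ext i j <;> fin_cases i <;> fin_cases j <;> simp [matT, tph, omega8_ne_zero]

theorem twist_mul_self (v : Fin 2) : twist v * twist v = 1 := by
  have h1 := matT_mul true
  have h2 := matT_mul false
  simp only [Bool.not_true, Bool.not_false] at h1 h2
  calc twist v * twist v = matT true * px v * (matT false * matT true) * px v * matT false := by
        simp only [twist, mul_assoc]
    _ = matT true * (px v * px v) * matT false := by rw [h2, mul_one, mul_assoc (matT true)]
    _ = 1 := by rw [px_mul_self, mul_one, h1]

theorem twist_one_eq : twist 1 = !![0, omega8⁻¹; omega8, 0] := by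
  ext i j
  fin_cases i <;> fin_cases j <;> simp [twist, matT, px, pauliX, tph]

theorem twist_zero : twist 0 = 1 := by
  have h1 := matT_mul true
  simpa [twist, px] using h1

theorem twist_rotX (θ : ℝ) :
    twist 1 * rotX θ * twist 1 = quat (Real.cos (θ / 2)) 0 (Real.sin (θ / 2)) 0 := by
  have h0 := omega8_ne_zero
  have h1 := omega8_mul_self
  have hI := Complex.I_mul_I
  rw [twist_one_eq]
  have h3 : omega8⁻¹ * omega8⁻¹ = -Complex.I := by rw [← mul_inv, h1, Complex.inv_I]
  ext i j
  fin_cases i <;> fin_cases j <;> simp [rotX, quat, Matrix.mul_apply, Fin.sum_univ_two]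
  · field_simp
  · linear_combination (Complex.I * Complex.sin (θ / 2)) * h3 - Complex.sin (θ / 2) * hI
  · linear_combination (-(Complex.I * Complex.sin (θ / 2))) * h1 - Complex.sin (θ / 2) * hI
  · field_simp

/-- The pair `U`, `V` of operators conjugates every rotation about the `x`-axis to itself, or to
its inverse if `b` holds. -/
def ConjX (U V : Matrix (Fin 2) (Fin 2) ℂ) (b : Prop) [Decidable b] : Prop :=
  ∀ θ, U * rotX θ * V = rotX (if b then -θ else θ)

/-- The group commutator word at the heart of the construction: `E` and `D` are involutions up to a
phase, each of which inverts `rotX` or commutes with it, depending on one half of the controls. The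
four rotations cancel unless both invert. -/
theorem commutator_word {E Dp Dm : Matrix (Fin 2) (Fin 2) ℂ} {b b' : Prop} [Decidable b]
    [Decidable b'] (hE : ConjX E E b) (hD : ConjX Dp Dm b') (α : ℝ) :
    Dp * (E * rotX α * E * rotX (-α)) * Dm * (rotX α * E * rotX (-α) * E) =
      if b ∧ b' then rotX (4 * α) else 1 := by
  rw [hE α, rotX_add, hD, mul_assoc (rotX α), mul_assoc (rotX α), hE (-α), rotX_add, rotX_add]
  by_cases hb : b <;> by_cases hb' : b' <;> simp [hb, hb', rotX_zero]
  ring_nf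

theorem commute_pauliX_rotX (θ : ℝ) : pauliX * rotX θ * pauliX = rotX θ := by
  ext i j
  fin_cases i <;> fin_cases j <;> simp [pauliX, rotX, Matrix.mul_apply, Fin.sum_univ_two]

/-- The Pauli `Y` operator. -/
def pauliY : Matrix (Fin 2) (Fin 2) ℂ := !![0, -Complex.I; Complex.I, 0]

/-- The Pauli `Z` operator. -/
def pauliZ : Matrix (Fin 2) (Fin 2) ℂ := !![1, 0; 0, -1]

theorem conjX_pauliX : ConjX pauliX pauliX False := fun θ => by
  simp [commute_pauliX_rotX]

theorem conjX_pauliY : ConjX pauliY pauliY True := fun θ => by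
  have hI := Complex.I_mul_I
  ext i j
  fin_cases i <;> fin_cases j <;>
    simp [pauliY, rotX, Matrix.mul_apply, Fin.sum_univ_two, neg_div] <;> ring_nf <;>
    simp [Complex.I_sq]

theorem conjX_pauliZ : ConjX pauliZ pauliZ True := fun θ => by
  ext i j
  fin_cases i <;> fin_cases j <;>
    simp [pauliZ, rotX, Matrix.mul_apply, Fin.sum_univ_two, neg_div]

theorem twist_pauliX : twist 1 * pauliX * twist 1 = pauliY := by
  have h1 := omega8_mul_self
  rw [twist_one_eq]
  have h3 : omega8⁻¹ * omega8⁻¹ = -Complex.I := by rw [← mul_inv, h1, Complex.inv_I]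
  ext i j
  fin_cases i <;> fin_cases j <;> simp [pauliX, pauliY, Matrix.mul_apply, Fin.sum_univ_two]
  · exact h3
  · exact h1

/-- The operator of the four `T` gates on the parities of the target with two controls. -/
noncomputable def quad (s : Bool) (e l : Fin 2) : Matrix (Fin 2) (Fin 2) ℂ :=
  matT s * (px l * (matT s * (px e * (matT s * (px l * (matT s * px e))))))

/-- The operator is `Z` when both controls are `0`, and a multiple of the identity otherwise. -/
theorem quad_eq (s : Bool) (e l : Fin 2) :
    quad s e l = if e = 0 ∧ l = 0 then pauliZ else (sph s 1) • 1 := by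
  have h1 := omega8_mul_self
  have hI := Complex.I_mul_I
  have h3 : omega8⁻¹ * omega8⁻¹ = -Complex.I := by rw [← mul_inv, h1, Complex.inv_I]
  rcases fin2_cases e with rfl | rfl <;> rcases fin2_cases l with rfl | rfl <;> cases s <;>
    ext i j <;> fin_cases i <;> fin_cases j <;>
    simp [quad, matT, px, pauliX, pauliZ, tph, sph, Matrix.mul_apply, Fin.sum_univ_two, h1, h3]
  · linear_combination Complex.I * h3 - hI
  · linear_combination Complex.I * h1 + hI

/-- A variant of `quad`, with the parities in a different order. -/
noncomputable def quad' (s : Bool) (e l : Fin 2) : Matrix (Fin 2) (Fin 2) ℂ :=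
  px l * (matT s * (px e * (matT s * (px l * (matT s * (px e * matT s))))))

theorem quad'_eq (s : Bool) (e l : Fin 2) :
    quad' s e l = if e = 0 ∧ l = 0 then pauliZ else (sph s 1) • 1 := by
  have h1 := omega8_mul_self
  have hI := Complex.I_mul_I
  have h3 : omega8⁻¹ * omega8⁻¹ = -Complex.I := by rw [← mul_inv, h1, Complex.inv_I]
  rcases fin2_cases e with rfl | rfl <;> rcases fin2_cases l with rfl | rfl <;> cases s <;>
    ext i j <;> fin_cases i <;> fin_cases j <;>
    simp [quad', matT, px, pauliX, pauliZ, tph, sph, Matrix.mul_apply, Fin.sum_univ_two, h1, h3]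
  · linear_combination Complex.I * h3 - hI
  · linear_combination Complex.I * h1 + hI

theorem hadamard_pauliZ : hadamard * pauliZ * hadamard = pauliX := by
  have h2 := hamp_mul_self
  ext i j
  fin_cases i <;> fin_cases j <;>
    simp [hadamard_eq, pauliX, pauliZ, Matrix.mul_apply, Fin.sum_univ_two] <;>
    linear_combination 2 * h2

theorem hadamard_quad (s : Bool) (e l : Fin 2) :
    hadamard * quad s e l * hadamard = if e = 0 ∧ l = 0 then pauliX else (sph s 1) • 1 := by
  rw [quad_eq]
  split_ifs
  · exact hadamard_pauliZ
  · simp [hadamard_mul_self]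

theorem hadamard_quad' (s : Bool) (e l : Fin 2) :
    hadamard * quad' s e l * hadamard = if e = 0 ∧ l = 0 then pauliX else (sph s 1) • 1 := by
  rw [quad'_eq]
  split_ifs
  · exact hadamard_pauliZ
  · simp [hadamard_mul_self]

theorem conjX_smul_one (s : Bool) :
    ConjX ((sph s 1) • 1) ((sph (!s) 1) • 1) False := fun θ => by
  have := sph_not_mul s 1
  simp [smul_smul, this]

theorem ConjX.congr {U V U' V' : Matrix (Fin 2) (Fin 2) ℂ} {b b' : Prop} [Decidable b]
    [Decidable b'] (h : ConjX U V b) (hU : U' = U) (hV : V' = V) (hb : b' ↔ b) :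
    ConjX U' V' b' := by
  subst hU hV
  intro θ
  rw [h θ]
  simp only [hb]

/-- The operator `D` of the word for a control `x` that is active in the state `0`: it inverts `rotX`
precisely when `x`, `e` and `l` are all `0`. -/
noncomputable def dlow (s : Bool) (x e l : Fin 2) : Matrix (Fin 2) (Fin 2) ℂ :=
  (matT true * px x * matT true) * (hadamard * quad s e l * hadamard) *
    (matT false * px x * matT false)

/-- The operator `D` of the word for a control `x` that is active in the state `1`: it inverts `rotX`
precisely when `x` is `1`, and `e` and `l` are `0`. -/
noncomputable def dhigh (s : Bool) (x e l : Fin 2) : Matrix (Fin 2) (Fin 2) ℂ :=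
  twist x * (hadamard * quad' s e l * hadamard) * twist x

theorem matT_pauliX_matT (s : Bool) : matT s * pauliX * matT s = tph s 1 • pauliX := by
  ext i j
  fin_cases i <;> fin_cases j <;> simp [matT, pauliX, Matrix.mul_apply, Fin.sum_univ_two]

theorem dlow_eq (s : Bool) (x e l : Fin 2) :
    dlow s x e l = if e = 0 ∧ l = 0 then (if x = 0 then pauliY else pauliX)
      else (sph s 1) • 1 := by
  have h1 := matT_mul true
  simp only [Bool.not_true] at h1
  have h2 := tph_not_mul false 1
  simp only [Bool.not_false] at h2
  rw [dlow, hadamard_quad]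
  rcases fin2_cases x with rfl | rfl
  · have e0 : px 0 = 1 := by simp [px]
    rw [e0, mul_one, mul_one, if_pos rfl]
    by_cases h : e = 0 ∧ l = 0
    · rw [if_pos h, if_pos h, ← twist_pauliX, twist_one_eq]
      have h3 := omega8_ne_zero
      ext i j
      fin_cases i <;> fin_cases j <;>
        simp [matT, pauliX, tph, Matrix.mul_apply, Fin.sum_univ_two]
    · rw [if_neg h, if_neg h, mul_smul_comm, mul_one, smul_mul_assoc, mul_assoc,
        ← mul_assoc (matT true) (matT false), h1, one_mul, h1]
  · have e1 : px 1 = pauliX := by simp [px]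
    rw [e1, matT_pauliX_matT, matT_pauliX_matT, if_neg one_ne_zero]
    by_cases h : e = 0 ∧ l = 0
    · rw [if_pos h, smul_mul_assoc, pauliX_mul_self, smul_mul_smul_comm, h2, one_smul,
        one_mul]
    · rw [if_neg h]
      simp only [smul_mul_assoc, mul_smul_comm, mul_one, pauliX_mul_self, smul_smul]
      congr 1
      linear_combination sph s 1 * h2

theorem dhigh_eq (s : Bool) (x e l : Fin 2) :
    dhigh s x e l = if e = 0 ∧ l = 0 then (if x = 1 then pauliY else pauliX)
      else (sph s 1) • 1 := by
  rw [dhigh, hadamard_quad']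
  rcases fin2_cases x with rfl | rfl
  · rw [twist_zero]; simp
  · split_ifs
    · exact twist_pauliX
    · simp at *
    · rw [mul_smul_comm, mul_one, smul_mul_assoc, twist_mul_self]

theorem conjX_dlow (x e l : Fin 2) :
    ConjX (dlow true x e l) (dlow false x e l) (x = 0 ∧ e = 0 ∧ l = 0) := by
  rw [dlow_eq, dlow_eq]
  split_ifs with h h'
  · exact conjX_pauliY.congr rfl rfl (by simp [h, h'])
  · exact conjX_pauliX.congr rfl rfl (by simp [h'])
  · exact (conjX_smul_one true).congr rfl rfl (by simp; tauto)

theorem conjX_dhigh (x e l : Fin 2) :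
    ConjX (dhigh true x e l) (dhigh false x e l) (x = 1 ∧ e = 0 ∧ l = 0) := by
  rw [dhigh_eq, dhigh_eq]
  split_ifs with h h'
  · exact conjX_pauliY.congr rfl rfl (by simp [h, h'])
  · exact conjX_pauliX.congr rfl rfl (by simp [h'])
  · exact (conjX_smul_one true).congr rfl rfl (by simp; tauto)

/-- The operator `E` of the word. -/
theorem twist_px_twist (v w : Fin 2) :
    ConjX (twist v * px w * twist v) (twist v * px w * twist v) (v = 1 ∧ w = 1) := by
  rcases fin2_cases v with rfl | rfl <;> rcases fin2_cases w with rfl | rfl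
  · intro θ; simp [twist_zero, px]
  · exact conjX_pauliX.congr (by simp [twist_zero, px]) (by simp [twist_zero, px]) (by simp)
  · intro θ; simp [px, twist_mul_self]
  · exact conjX_pauliY.congr (by simp [px, twist_pauliX]) (by simp [px, twist_pauliX]) (by simp)

end Word

/-! ### The tree of nodes -/

section Tree

/-- A node whose two inputs are controls in their original state. -/
def up (N : Node) (h : ℕ) (o : Option ℕ) : Prog := slow N h (h + 4) (h + 13) (h + 20) none o

/-- A node whose input `a` is the output of a node that ends at the label `z`. The variant `top` ends
one layer of `T` gates earlier. -/
def merge (top : Bool) (N : Node) (h z : ℕ) (o : Option ℕ) : Prog :=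
  if top then fast N h (h + 4) (z + 2) (z + 4) (z + 8) o none
  else slow N h (h + 4) (z + 3) (z + 4) o none

/-- The label at which `merge` ends. -/
def mergeEnd (top : Bool) (z : ℕ) : ℕ := if top then z + 8 else z + 16

/-- The label of the `S` gates, if there are any. -/
def sLab (sp : Bool) (l : ℕ) : Option ℕ := if sp then some l else none

/-- The innermost level of the tree, with `4 + e` controls numbered from `q + 4` on. The outputs of
the nodes overwrite the qubits `q`, `q + 2`, `q + 3`, and controls which are known to be `1` when the
nodes that consumed them are active. -/
def base (e : ℕ) (top : Bool) (q h : ℕ) (sp : Bool) : Prog :=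
  up ⟨q, q + 5, q + 4, true, true⟩ h (sLab sp (h + 17)) ++
  (if e = 0 ∧ top = true then
    fast ⟨q + 2, q + 7, q + 6, true, true⟩ h (h + 4) (h + 13) (h + 20) (h + 24) none
      (sLab sp (h + 17))
  else up ⟨q + 2, q + 7, q + 6, true, true⟩ h (sLab sp (h + 17))) ++
  match e with
  | 0 => []
  | 1 => merge top ⟨q + 4, q + 8, q + 2, true, false⟩ (h + 16) (h + 32) none
  | 2 =>
    (if sp then
      fast ⟨q + 3, q + 9, q, true, false⟩ (h + 16) (h + 20) (h + 34) (h + 36) (h + 48)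
        (some (h + 17)) none
    else slow ⟨q + 3, q + 9, q, true, false⟩ (h + 16) (h + 20) (h + 35) (h + 36) none none) ++
    merge top ⟨q + 4, q + 8, q + 2, true, false⟩ (h + 16) (h + 32) none
  | _ =>
    (if sp then
      fast ⟨q + 3, q + 8, q, true, false⟩ (h + 16) (h + 20) (h + 34) (h + 36) (h + 48)
        (some (h + 17)) none
    else slow ⟨q + 3, q + 8, q, true, false⟩ (h + 16) (h + 20) (h + 35) (h + 36) none none) ++
    up ⟨q + 6, q + 10, q + 9, true, true⟩ (h + 16) none ++
    merge top ⟨q + 5, q + 2, q + 6, false, false⟩ (h + 32) (h + 48) none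

/-- The nodes of `base`. -/
def baseNodes (e q : ℕ) : List Node :=
  [⟨q, q + 5, q + 4, true, true⟩, ⟨q + 2, q + 7, q + 6, true, true⟩] ++
  match e with
  | 0 => []
  | 1 => [⟨q + 4, q + 8, q + 2, true, false⟩]
  | 2 => [⟨q + 3, q + 9, q, true, false⟩, ⟨q + 4, q + 8, q + 2, true, false⟩]
  | _ => [⟨q + 3, q + 8, q, true, false⟩, ⟨q + 6, q + 10, q + 9, true, true⟩,
      ⟨q + 5, q + 2, q + 6, false, false⟩]

/-- The qubit holding the first output of the tree. -/
def rootA : ℕ → ℕ → ℕ → ℕ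
  | 0, e, q => if e < 2 then q else q + 3
  | _ + 1, _, q => q + 3

/-- The qubit holding the second output of the tree. -/
def rootB : ℕ → ℕ → ℕ → ℕ
  | 0, e, q => match e with
    | 0 => q + 2
    | 1 => q + 4
    | 2 => q + 4
    | _ => q + 5
  | _ + 1, _, q => q + 5

/-- The label at which the first output is ready. -/
def endA : ℕ → ℕ → ℕ → ℕ
  | 0, e, h => if e < 2 then h + 32 else h + 48
  | r + 1, e, h => endA r e (h + 16) + 16

/-- The label at which the second output is ready. -/
def endB : ℕ → ℕ → Bool → ℕ → ℕ
  | 0, e, top, h => match e with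
    | 0 => if top then h + 24 else h + 32
    | 1 => mergeEnd top (h + 32)
    | 2 => mergeEnd top (h + 32)
    | _ => mergeEnd top (h + 48)
  | r + 1, e, top, h => mergeEnd top (endB r e false (h + 16))

/-- A tree of nodes with `4 (r + 1) + e` controls numbered from `q + 4` on, starting at the label
`h`. It uses the qubits `q`, `q + 2`, `q + 3` as ancillas in the state `1`. Deeper levels use as
ancillas controls that are known to be in the state `1` whenever the result matters. An output is `0`
when it is active, since its node has flipped an ancilla. The two outputs are not combined, and the
flag `sp` decides whether some `T` gates are replaced by an `S` gate and an inverse `T` gate. -/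
def tree : ℕ → ℕ → Bool → ℕ → ℕ → Bool → Prog
  | 0, e, top, q, h, sp => base e top q h sp
  | r + 1, e, top, q, h, sp =>
    up ⟨q, q + 5, q + 4, true, true⟩ h none ++ up ⟨q + 2, q + 7, q + 6, true, true⟩ h none ++
    tree r e false (q + 4) (h + 16) sp ++
    merge false ⟨q + 3, q, rootA r e (q + 4), false, false⟩ (h + 16 * (r + 2))
      (endA r e (h + 16)) (sLab sp (h + 16 * (r + 2) + 1)) ++
    merge top ⟨q + 5, q + 2, rootB r e (q + 4), false, false⟩ (h + 16 * (r + 2))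
      (endB r e false (h + 16)) (sLab sp (h + 16 * (r + 2) + 1))

/-- The nodes of `tree`. -/
def treeNodes : ℕ → ℕ → ℕ → List Node
  | 0, e, q => baseNodes e q
  | r + 1, e, q =>
    [⟨q, q + 5, q + 4, true, true⟩] ++ [⟨q + 2, q + 7, q + 6, true, true⟩] ++
    treeNodes r e (q + 4) ++
    [⟨q + 3, q, rootA r e (q + 4), false, false⟩] ++
    [⟨q + 5, q + 2, rootB r e (q + 4), false, false⟩]

theorem rootA_mem (r e q : ℕ) : rootA r e q = q ∨ rootA r e q = q + 3 := by
  cases r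
  · show (if e < 2 then q else q + 3) = q ∨ (if e < 2 then q else q + 3) = q + 3
    split_ifs <;> simp
  · right; rfl

theorem rootB_mem (r e q : ℕ) :
    rootB r e q = q + 2 ∨ rootB r e q = q + 4 ∨ rootB r e q = q + 5 := by
  cases r
  · rcases e with _ | _ | _ | e <;> simp [rootB]
  · right; right; rfl

theorem base_nodes_ok {e q n : ℕ} (hq : 1 ≤ q) (he : e < 4) (hn : q + 7 + e ≤ n) :
    ∀ N ∈ baseNodes e q, N.Ok n := by
  interval_cases e <;> simp [baseNodes, Node.Ok] <;> omega

theorem tree_nodes_ok {r e q n : ℕ} (hq : 1 ≤ q) (he : e < 4) (hn : q + 7 + 4 * r + e ≤ n) :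
    ∀ N ∈ treeNodes r e q, N.Ok n := by
  induction r generalizing q with
  | zero => exact base_nodes_ok hq he (by omega)
  | succ r ih =>
    have h1 := rootA_mem r e (q + 4)
    have h2 := rootB_mem r e (q + 4)
    intro N hN
    simp only [treeNodes, List.mem_append, List.mem_singleton] at hN
    rcases hN with (((rfl | rfl) | hN) | rfl) | rfl
    · simp [Node.Ok]; omega
    · simp [Node.Ok]; omega
    · exact ih (by omega) (by omega) N hN
    · simp only [Node.Ok]; omega
    · simp only [Node.Ok]; omega

section

variable {Q : Type*} [DecidableEq Q] [Fintype Q] {f : ℕ → Q} {n : ℕ}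
  (hf : Set.InjOn f {i | i ≤ n})
include hf

theorem up_realizes {N : Node} (hN : N.Ok n) (h : ℕ) (o : Option ℕ) :
    Realizes f (up N h o) [N] :=
  (slow_realizes (hN.distinct hf) _ _ _ _ _ _).realizes

theorem merge_realizes {N : Node} (hN : N.Ok n) (top : Bool) (h z : ℕ) (o : Option ℕ) :
    Realizes f (merge top N h z o) [N] := by
  unfold merge
  split_ifs
  · exact (fast_realizes (hN.distinct hf) _ _ _ _ _ _ _).realizes
  · exact (slow_realizes (hN.distinct hf) _ _ _ _ _ _).realizes

theorem ite_realizes {c : Prop} [Decidable c] {L L' : Prog} {Ns : List Node}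
    (h : Realizes f L Ns) (h' : Realizes f L' Ns) : Realizes f (if c then L else L') Ns := by
  split_ifs <;> assumption

theorem base_realizes {e q : ℕ} (hq : 1 ≤ q) (he : e < 4) (hn : q + 7 + e ≤ n) (top : Bool)
    (h : ℕ) (sp : Bool) : Realizes f (base e top q h sp) (baseNodes e q) := by
  have hok := base_nodes_ok hq he hn
  have hs : ∀ N ∈ baseNodes e q, ∀ h0 p x q o0 o2, Realizes f (slow N h0 p x q o0 o2) [N] :=
    fun N hN _ _ _ _ _ _ => (slow_realizes ((hok N hN).distinct hf) _ _ _ _ _ _).realizes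
  have hfa : ∀ N ∈ baseNodes e q, ∀ h0 p x q he o0 o2, Realizes f (fast N h0 p x q he o0 o2) [N] :=
    fun N hN _ _ _ _ _ _ _ => (fast_realizes ((hok N hN).distinct hf) _ _ _ _ _ _ _).realizes
  have hm : ∀ N ∈ baseNodes e q, ∀ h z o, Realizes f (merge top N h z o) [N] :=
    fun N hN _ _ _ => merge_realizes hf (hok N hN) _ _ _ _
  have h2 : ∀ {L L' : Prog} {N N' : Node}, Realizes f L [N] → Realizes f L' [N'] →
    Realizes f (L ++ L') [N, N'] := fun a b => a.append b
  have h3 : ∀ {L L' L'' : Prog} {N N' N'' : Node}, Realizes f L [N] → Realizes f L' [N'] →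
    Realizes f L'' [N''] → Realizes f (L ++ L' ++ L'') [N, N', N''] :=
    fun a b c => (a.append b).append c
  unfold base baseNodes
  refine (h2 (hs _ (by simp [baseNodes]) _ _ _ _ _ _) (ite_realizes hf
    (hfa _ (by simp [baseNodes]) _ _ _ _ _ _ _) (hs _ (by simp [baseNodes]) _ _ _ _ _ _))).append ?_
  interval_cases e
  · intro y; simp [regMapL, regPhaseL]
  · exact hm _ (by simp [baseNodes]) _ _ _
  · exact h2 (ite_realizes hf (hfa _ (by simp [baseNodes]) _ _ _ _ _ _ _)
      (hs _ (by simp [baseNodes]) _ _ _ _ _ _)) (hm _ (by simp [baseNodes]) _ _ _)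
  · exact h3 (ite_realizes hf (hfa _ (by simp [baseNodes]) _ _ _ _ _ _ _)
      (hs _ (by simp [baseNodes]) _ _ _ _ _ _)) (hs _ (by simp [baseNodes]) _ _ _ _ _ _)
      (hm _ (by simp [baseNodes]) _ _ _)

theorem tree_realizes {r e q : ℕ} (hq : 1 ≤ q) (he : e < 4) (hn : q + 7 + 4 * r + e ≤ n)
    (top : Bool) (h : ℕ) (sp : Bool) : Realizes f (tree r e top q h sp) (treeNodes r e q) := by
  induction r generalizing q h top with
  | zero => exact base_realizes hf hq he (by omega) top h sp
  | succ r ih =>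
    have hok := tree_nodes_ok hq he hn
    unfold tree treeNodes
    refine ((((up_realizes hf (hok _ ?_) _ _).append (up_realizes hf (hok _ ?_) _ _)).append
      (ih (by omega) (by omega) _ _)).append (merge_realizes hf (hok _ ?_) _ _ _ _)).append
      (merge_realizes hf (hok _ ?_) _ _ _ _) <;> simp [treeNodes]

end

theorem node_map_of_ne (N : Node) (y : ℕ → Fin 2) {i : ℕ} (h : i ≠ N.b) : N.map y i = y i := by
  simp [Node.map, h]

/-- The tree changes its ancillas and controls only. -/
theorem tree_frame {r e q : ℕ} (he : e < 4) (y : ℕ → Fin 2) {i : ℕ} (hi : i < q ∨ i = q + 1) :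
    mapL (treeNodes r e q) y i = y i := by
  induction r generalizing q y with
  | zero =>
    interval_cases e <;>
      simp only [treeNodes, baseNodes, mapL_append, mapL] <;>
      simp only [Node.map] <;> simp (disch := omega) only [update_of_ne]
  | succ r ih =>
    simp only [treeNodes, mapL_append, mapL]
    rw [node_map_of_ne _ _ (by simp only; omega), node_map_of_ne _ _ (by simp only; omega),
      ih _ (by omega), node_map_of_ne _ _ (by simp only; omega),
      node_map_of_ne _ _ (by simp only; omega)]

theorem node_map_b (N : Node) (y : ℕ → Fin 2) (h : y N.b = 1) :
    N.map y N.b = 0 ↔ y N.c = act N.ch ∧ y N.a = act N.ah := by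
  rw [Node.map, update_self, h, Node.flip]
  split_ifs with h' <;> simp [h']

/-- The outputs of the tree are both active exactly when all its controls are `1`, provided that
the ancillas are in the state `1`. -/
theorem tree_spec {r e q : ℕ} (he : e < 4) (y : ℕ → Fin 2) (h0 : y q = 1) (h2 : y (q + 2) = 1)
    (h3 : y (q + 3) = 1) :
    (mapL (treeNodes r e q) y (rootA r e q) = 0 ∧ mapL (treeNodes r e q) y (rootB r e q) = 0) ↔
      ∀ i, q + 4 ≤ i → i < q + 8 + 4 * r + e → y i = 1 := by
  induction r generalizing q y with
  | zero =>
    have e1 : (∀ i, q + 4 ≤ i → i < q + 8 + 4 * 0 + e → y i = 1) ↔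
        (y (q + 4) = 1 ∧ y (q + 5) = 1 ∧ y (q + 6) = 1 ∧ y (q + 7) = 1) ∧
        (1 ≤ e → y (q + 8) = 1) ∧ (2 ≤ e → y (q + 9) = 1) ∧ (3 ≤ e → y (q + 10) = 1) := by
      constructor
      · intro h
        refine ⟨⟨h _ ?_ ?_, h _ ?_ ?_, h _ ?_ ?_, h _ ?_ ?_⟩, fun _ => h _ ?_ ?_,
          fun _ => h _ ?_ ?_, fun _ => h _ ?_ ?_⟩ <;> omega
      · rintro ⟨⟨a, b, c, d⟩, u, v, w⟩ i hi hi'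
        have : i = q + 4 ∨ i = q + 5 ∨ i = q + 6 ∨ i = q + 7 ∨ (i = q + 8 ∧ 1 ≤ e) ∨
          (i = q + 9 ∧ 2 ≤ e) ∨ (i = q + 10 ∧ 3 ≤ e) := by omega
        rcases this with rfl | rfl | rfl | rfl | ⟨rfl, hh⟩ | ⟨rfl, hh⟩ | ⟨rfl, hh⟩
        exacts [a, b, c, d, u hh, v hh, w hh]
    -- At most seven bits occur, and the claim is a finite check.
    rw [e1]
    generalize h4 : y (q + 4) = v4
    generalize h5 : y (q + 5) = v5
    generalize h6 : y (q + 6) = v6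
    generalize h7 : y (q + 7) = v7
    generalize h8 : y (q + 8) = v8
    generalize h9 : y (q + 9) = v9
    generalize h10 : y (q + 10) = v10
    interval_cases e <;>
      simp [treeNodes, baseNodes, rootA, rootB, mapL, Node.map, Node.flip, act, h0, h2,
        h3, h4, h5, h6, h7, h8, h9, h10] <;> clear * - <;> first
      | (revert v4 v5 v6 v7; decide)
      | (revert v4 v5 v6 v7 v8; decide)
      | (revert v4 v5 v6 v7 v8 v9; decide)
      | (revert v4 v5 v6 v7 v8 v9 v10; decide)
  | succ r ih =>
    have hA := rootA_mem r e (q + 4)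
    have hB := rootB_mem r e (q + 4)
    set uA : Node := ⟨q, q + 5, q + 4, true, true⟩ with huA
    set uB : Node := ⟨q + 2, q + 7, q + 6, true, true⟩ with huB
    set y1 := uB.map (uA.map y) with hy1
    have a0 : y1 q = 0 ↔ y (q + 5) = 1 ∧ y (q + 4) = 1 := by
      rw [hy1, node_map_of_ne _ _ (by simp [huB])]
      exact node_map_b uA y h0
    have a1 : y1 (q + 2) = 0 ↔ y (q + 7) = 1 ∧ y (q + 6) = 1 := by
      have h := node_map_b uB (uA.map y) (by rw [node_map_of_ne _ _ (by simp [huA, huB])]; exact h2)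
      rw [node_map_of_ne uA _ (by simp only [huA, huB]; omega),
        node_map_of_ne uA _ (by simp only [huA, huB]; omega)] at h
      exact h
    have a2 : ∀ i, q + 3 ≤ i → y1 i = y i := by
      intro i hi
      rw [hy1, node_map_of_ne _ _ (by simp only [huB]; omega),
        node_map_of_ne _ _ (by simp only [huA]; omega)]
    set y2 := mapL (treeNodes r e (q + 4)) y1 with hy2
    have b : ∀ i, (i < q + 4 ∨ i = q + 5) → y2 i = y1 i := fun i hi =>
      tree_frame he y1 (by omega)
    have hfin : ∀ i, mapL (treeNodes (r + 1) e q) y i =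
        (Node.map ⟨q + 5, q + 2, rootB r e (q + 4), false, false⟩
          (Node.map ⟨q + 3, q, rootA r e (q + 4), false, false⟩ y2)) i := by
      intro i
      simp only [treeNodes, mapL_append, mapL]
      rfl
    have c1 : mapL (treeNodes (r + 1) e q) y (q + 3) = 0 ↔
        y1 q = 0 ∧ y2 (rootA r e (q + 4)) = 0 := by
      rw [hfin, node_map_of_ne _ _ (by simp), ← b q (by omega)]
      exact node_map_b ⟨q + 3, q, rootA r e (q + 4), false, false⟩ y2
        (by simp only; rw [b _ (by omega), a2 _ (by omega), h3])
    have c2 : y (q + 5) = 1 → (mapL (treeNodes (r + 1) e q) y (q + 5) = 0 ↔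
        y1 (q + 2) = 0 ∧ y2 (rootB r e (q + 4)) = 0) := by
      intro h5
      have h := node_map_b ⟨q + 5, q + 2, rootB r e (q + 4), false, false⟩
        (Node.map ⟨q + 3, q, rootA r e (q + 4), false, false⟩ y2)
        (by rw [node_map_of_ne _ _ (by simp)]; simp only; rw [b _ (by omega), a2 _ (by omega), h5])
      rw [node_map_of_ne ⟨q + 3, q, rootA r e (q + 4), false, false⟩ y2
          (i := q + 2) (by simp only; omega),
        node_map_of_ne ⟨q + 3, q, rootA r e (q + 4), false, false⟩ y2
          (i := rootB r e (q + 4)) (by simp only; omega), b (q + 2) (by omega)] at h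
      rw [hfin]
      exact h
    -- The inner tree has as ancillas the controls `q + 4`, `q + 6`, `q + 7`, which are `1` when the
    -- two outer nodes are active.
    have inner := fun p4 p6 p7 => ih (q := q + 4) y1 p4 p6 p7
    show (mapL (treeNodes (r + 1) e q) y (q + 3) = 0 ∧
      mapL (treeNodes (r + 1) e q) y (q + 5) = 0) ↔ _
    constructor
    · rintro ⟨r1, r2⟩
      obtain ⟨s1, s2⟩ := c1.1 r1
      obtain ⟨s5, s4⟩ := a0.1 s1
      obtain ⟨s3, t2⟩ := (c2 s5).1 r2
      obtain ⟨s7, s6⟩ := a1.1 s3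
      have key := (inner (by rw [a2 _ (by omega), s4])
        (by rw [a2 _ (by omega)]; exact s6) (by rw [a2 _ (by omega)]; exact s7)).1 ⟨s2, t2⟩
      intro i hi hi'
      rcases (show i = q + 4 ∨ i = q + 5 ∨ i = q + 6 ∨ i = q + 7 ∨ q + 8 ≤ i by omega) with
        rfl | rfl | rfl | rfl | h8
      · exact s4
      · exact s5
      · exact s6
      · exact s7
      · rw [← a2 i (by omega)]
        exact key i (by omega) (by omega)
    · intro h
      have key := (inner (by rw [a2 _ (by omega)]; exact h _ (by omega) (by omega))
        (by rw [a2 _ (by omega)]; exact h _ (by omega) (by omega))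
        (by rw [a2 _ (by omega)]; exact h _ (by omega) (by omega))).2
        (fun i hi hi' => by rw [a2 _ (by omega)]; exact h _ (by omega) (by omega))
      exact ⟨c1.2 ⟨a0.2 ⟨h _ (by omega) (by omega), h _ (by omega) (by omega)⟩, key.1⟩,
        (c2 (h _ (by omega) (by omega))).2
          ⟨a1.2 ⟨h _ (by omega) (by omega), h _ (by omega) (by omega)⟩, key.2⟩⟩

end Tree

/-! ### Occupation of the qubits -/

section Run

/-- The time labels up to which the qubits are occupied, after an instruction. -/
def adv (f : ℕ → ℕ) (x : ℕ × Ins) : ℕ → ℕ := fun q => if q ∈ x.2.qs then x.1 else f q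

/-- The time labels up to which the qubits are occupied, after a program. -/
def advL (f : ℕ → ℕ) (L : Prog) : ℕ → ℕ := L.foldl adv f

/-- Each instruction of a program starts when its qubits, occupied up to the labels `f` at the
beginning, are free. -/
def Fits : (ℕ → ℕ) → Prog → Prop
  | _, [] => True
  | f, x :: L => (∀ q ∈ x.2.qs, f q < x.1) ∧ Fits (adv f x) L

/-- A program can be run when the qubits are occupied up to the labels `f`, and then it occupies
them up to the labels `g` at most. -/
def Run (f : ℕ → ℕ) (L : Prog) (g : ℕ → ℕ) : Prop := Fits f L ∧ ∀ q, advL f L q ≤ g q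

theorem adv_mono {f f' : ℕ → ℕ} (h : ∀ q, f q ≤ f' q) (x : ℕ × Ins) (q : ℕ) :
    adv f x q ≤ adv f' x q := by
  unfold adv
  split_ifs
  · exact le_rfl
  · exact h q

theorem advL_mono {f f' : ℕ → ℕ} (h : ∀ q, f q ≤ f' q) (L : Prog) (q : ℕ) :
    advL f L q ≤ advL f' L q := by
  induction L generalizing f f' with
  | nil => exact h q
  | cons x L ih => exact ih fun q => adv_mono h x q

theorem Fits.mono {f f' : ℕ → ℕ} (h : ∀ q, f q ≤ f' q) {L : Prog} (hL : Fits f' L) : Fits f L := by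
  induction L generalizing f f' with
  | nil => trivial
  | cons x L ih =>
    exact ⟨fun q hq => (h q).trans_lt (hL.1 q hq), ih (fun q => adv_mono h x q) hL.2⟩

theorem fits_append {f : ℕ → ℕ} {L L' : Prog} :
    Fits f (L ++ L') ↔ Fits f L ∧ Fits (advL f L) L' := by
  induction L generalizing f with
  | nil => simp [Fits, advL]
  | cons x L ih =>
    simp only [List.cons_append, Fits, ih, and_assoc]
    rfl

theorem advL_append (f : ℕ → ℕ) (L L' : Prog) : advL f (L ++ L') = advL (advL f L) L' :=
  List.foldl_append

theorem Run.append {f g h : ℕ → ℕ} {L L' : Prog} (a : Run f L g) (b : Run g L' h) :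
    Run f (L ++ L') h := by
  refine ⟨fits_append.2 ⟨a.1, b.1.mono a.2⟩, fun q => ?_⟩
  rw [advL_append]
  exact (advL_mono a.2 _ q).trans (b.2 q)

theorem Run.weaken {f f' g g' : ℕ → ℕ} {L : Prog} (a : Run f L g) (hf : ∀ q, f' q ≤ f q)
    (hg : ∀ q, g q ≤ g' q) : Run f' L g' :=
  ⟨a.1.mono hf, fun q => ((advL_mono hf L q).trans (a.2 q)).trans (hg q)⟩

theorem Run.ite {f g : ℕ → ℕ} {c : Prop} [Decidable c] {L L' : Prog} (a : c → Run f L g)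
    (b : ¬c → Run f L' g) : Run f (if c then L else L') g := by
  split_ifs with h
  · exact a h
  · exact b h

theorem run_nil (f : ℕ → ℕ) : Run f [] f := ⟨trivial, fun _ => le_rfl⟩

theorem Fits.lt_of_mem {f : ℕ → ℕ} {L : Prog} (h : Fits f L) {x : ℕ × Ins} (hx : x ∈ L) :
    ∀ q ∈ x.2.qs, f q < x.1 := by
  induction L generalizing f with
  | nil => simp at hx
  | cons y L ih =>
    intro q hq
    rcases List.mem_cons.1 hx with rfl | hx
    · exact h.1 q hq
    · have := ih h.2 hx q hq
      unfold adv at this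
      split_ifs at this with hy
      · exact (h.1 q hy).trans this
      · exact this

/-- Two instructions share no qubit, or are in the order of their labels. -/
def InsBefore (x y : ℕ × Ins) : Prop := ∀ q ∈ x.2.qs, q ∈ y.2.qs → x.1 < y.1

theorem Fits.pairwise {f : ℕ → ℕ} {L : Prog} (h : Fits f L) : L.Pairwise InsBefore := by
  induction L generalizing f with
  | nil => exact List.Pairwise.nil
  | cons x L ih =>
    refine List.Pairwise.cons (fun y hy q hq hq' => ?_) (ih h.2)
    have := h.2.lt_of_mem hy q hq'
    simpa [adv, hq] using this

theorem le_advL {f : ℕ → ℕ} {L : Prog} (h : Fits f L) (q : ℕ) : f q ≤ advL f L q := by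
  induction L generalizing f with
  | nil => exact le_rfl
  | cons x L ih =>
    refine le_trans ?_ (ih h.2)
    unfold adv
    split_ifs with hq
    · exact (h.1 q hq).le
    · exact le_rfl

theorem Run.le_of_mem {f g : ℕ → ℕ} {L : Prog} (h : Run f L g) {x : ℕ × Ins} (hx : x ∈ L) :
    ∀ q ∈ x.2.qs, x.1 ≤ g q := by
  intro q hq
  refine le_trans ?_ (h.2 q)
  have h1 := h.1
  clear h
  induction L generalizing f with
  | nil => simp at hx
  | cons y L ih =>
    rcases List.mem_cons.1 hx with rfl | hx
    · refine le_trans ?_ (le_advL h1.2 q)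
      simp [adv, hq]
    · exact ih hx h1.2

theorem run_of_pairwise {f g : ℕ → ℕ} {L : Prog} (h : L.Pairwise InsBefore)
    (h1 : ∀ x ∈ L, ∀ q ∈ x.2.qs, f q < x.1 ∧ x.1 ≤ g q) (h2 : ∀ q, f q ≤ g q) : Run f L g := by
  induction L generalizing f with
  | nil => exact ⟨trivial, h2⟩
  | cons x L ih =>
    rw [List.pairwise_cons] at h
    have : Run (adv f x) L g := by
      refine ih h.2 (fun y hy q hq => ⟨?_, (h1 y (by simp [hy]) q hq).2⟩) fun q => ?_
      · unfold adv
        split_ifs with hx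
        · exact h.1 y hy q hx hq
        · exact (h1 y (by simp [hy]) q hq).1
      · unfold adv
        split_ifs with hx
        · exact (h1 x (by simp) q hx).2
        · exact h2 q
    exact ⟨⟨fun q hq => (h1 x (by simp) q hq).1, this.1⟩, this.2⟩

theorem qs_inv (i : Ins) : i.inv.qs = i.qs := by cases i <;> rfl

/-- A mirrored program runs in the mirrored time. -/
theorem Run.mirror {f g : ℕ → ℕ} {L : Prog} (h : Run f L g) (Λ : ℕ)
    (hg : ∀ x ∈ L, x.1 ≤ Λ) {f' g' : ℕ → ℕ} (hf' : ∀ x ∈ L, ∀ q ∈ x.2.qs, f' q + g q < Λ)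
    (hg' : ∀ x ∈ L, ∀ q ∈ x.2.qs, Λ ≤ f q + g' q) (hfg : ∀ q, f' q ≤ g' q) :
    Run f' (invP Λ L) g' := by
  refine run_of_pairwise ?_ ?_ hfg
  · unfold invP
    rw [List.pairwise_reverse, List.pairwise_map]
    refine h.1.pairwise.imp_of_mem ?_
    intro x y hx hy hxy q hq hq'
    simp only [qs_inv] at hq hq'
    have := hxy q hq' hq
    have := hg y hy
    simp only
    omega
  · intro x hx q hq
    simp only [invP, List.mem_reverse, List.mem_map] at hx
    obtain ⟨y, hy, rfl⟩ := hx
    simp only [qs_inv] at hq ⊢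
    have a := h.le_of_mem hy q hq
    have b := h.1.lt_of_mem hy q hq
    have c := hf' y hy q hq
    have d := hg' y hy q hq
    have e := hg y hy
    omega

theorem mem_invP {Λ : ℕ} {L : Prog} {x : ℕ × Ins} (hx : x ∈ invP Λ L) :
    ∃ y ∈ L, x = (Λ - y.1, y.2.inv) := by
  simp only [invP, List.mem_reverse, List.mem_map] at hx
  obtain ⟨y, hy, rfl⟩ := hx
  exact ⟨y, hy, rfl⟩

/-- The time at which a slow node frees its qubits. -/
theorem run_slow {f g : ℕ → ℕ} {N : Node} {h0 p x q : ℕ} {o0 o2 : Option ℕ}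
    (hab : N.a ≠ N.b) (hcb : N.c ≠ N.b) (hac : N.a ≠ N.c)
    (h1 : f N.b < h0) (h2 : h0 < p) (h3 : f N.c < p + 1) (h4 : p + 8 < x) (h5 : f N.a < x)
    (h6 : x < q) (ho0 : ∀ l ∈ o0, h0 < l ∧ l < p) (ho2 : ∀ l ∈ o2, x < l ∧ l < q)
    (hg : ∀ i, (if i = N.b then q + 12 else if i = N.c then q + 1 else if i = N.a then x else f i) ≤
      g i) : Run f (slow N h0 p x q o0 o2) g := by
  have hg0 := hg N.b
  rw [if_pos rfl] at hg0
  have key : ∀ i, i ≠ N.b → i ≠ N.c → i ≠ N.a → f i ≤ g i := by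
    intro i a b c
    have := hg i
    rwa [if_neg a, if_neg b, if_neg c] at this
  have hgc := hg N.c
  rw [if_neg hcb, if_pos rfl] at hgc
  have hga := hg N.a
  rw [if_neg hab, if_neg hac, if_pos rfl] at hga
  refine ⟨?_, fun i => ?_⟩
  · cases o0 <;> cases o2 <;>
      simp [slow, sPart, tPart, Fits, adv, qs, hab, hcb, hac, hab.symm, hcb.symm, hac.symm] at * <;>
      omega
  · by_cases ib : i = N.b
    · subst ib
      cases o0 <;> cases o2 <;> simp [slow, sPart, tPart, advL, adv, qs] <;> omega
    · by_cases ic : i = N.c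
      · subst ic
        cases o0 <;> cases o2 <;> simp [slow, sPart, tPart, advL, adv, qs, ib] <;> omega
      · by_cases ia : i = N.a
        · subst ia
          cases o0 <;> cases o2 <;> simp [slow, sPart, tPart, advL, adv, qs, ib, ic] <;> omega
        · have := key i ib ic ia
          cases o0 <;> cases o2 <;> simp [slow, sPart, tPart, advL, adv, qs, ib, ic, ia] <;> omega

/-- The time at which a fast node frees its qubits. -/
theorem run_fast {f g : ℕ → ℕ} {N : Node} {h0 p x q he : ℕ} {o0 o1 : Option ℕ}
    (hab : N.a ≠ N.b) (hcb : N.c ≠ N.b) (hac : N.a ≠ N.c)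
    (h1 : f N.b < h0) (h2 : h0 + 1 < p) (h3 : f N.c + 1 < p) (h4 : p < x) (h5 : f N.a < x)
    (h6 : x + 1 < q) (h7 : q + 1 < he) (ho0 : ∀ l ∈ o0, h0 < l ∧ l + 1 < p)
    (ho1 : ∀ l ∈ o1, x < l ∧ l < q)
    (hg : ∀ i, (if i = N.b then he else if i = N.c then q + 1 else if i = N.a then x + 1 else f i) ≤
      g i) : Run f (fast N h0 p x q he o0 o1) g := by
  have hg0 := hg N.b
  rw [if_pos rfl] at hg0
  have key : ∀ i, i ≠ N.b → i ≠ N.c → i ≠ N.a → f i ≤ g i := by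
    intro i a b c
    have := hg i
    rwa [if_neg a, if_neg b, if_neg c] at this
  have hgc := hg N.c
  rw [if_neg hcb, if_pos rfl] at hgc
  have hga := hg N.a
  rw [if_neg hab, if_neg hac, if_pos rfl] at hga
  refine ⟨?_, fun i => ?_⟩
  · cases o0 <;> cases o1 <;>
      simp [fast, sPart, tPart, Fits, adv, qs, hab, hcb, hac, hab.symm, hcb.symm, hac.symm] at * <;>
      omega
  · by_cases ib : i = N.b
    · subst ib
      cases o0 <;> cases o1 <;> simp [fast, sPart, tPart, advL, adv, qs] <;> omega
    · by_cases ic : i = N.c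
      · subst ic
        cases o0 <;> cases o1 <;> simp [fast, sPart, tPart, advL, adv, qs, ib] <;> omega
      · by_cases ia : i = N.a
        · subst ia
          cases o0 <;> cases o1 <;> simp [fast, sPart, tPart, advL, adv, qs, ib, ic] <;> omega
        · have := key i ib ic ia
          cases o0 <;> cases o1 <;> simp [fast, sPart, tPart, advL, adv, qs, ib, ic, ia] <;> omega

end Run

/-! ### The time labels of the tree are feasible -/

section TreeRun

theorem run_up {f g : ℕ → ℕ} {N : Node} {h : ℕ} {o : Option ℕ}
    (hab : N.a ≠ N.b) (hcb : N.c ≠ N.b) (hac : N.a ≠ N.c)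
    (h1 : f N.b < h) (h3 : f N.c < h + 5) (h5 : f N.a < h + 13)
    (ho : ∀ l ∈ o, l = h + 17)
    (hg : ∀ i, (if i = N.b then h + 32 else if i = N.c then h + 21 else if i = N.a then h + 13
      else f i) ≤ g i) : Run f (up N h o) g := by
  refine run_slow hab hcb hac h1 (by omega) (by omega) (by omega) h5 (by omega) (by simp)
    (fun l hl => ?_) hg
  have := ho l hl
  omega

theorem run_merge {f g : ℕ → ℕ} {N : Node} {top : Bool} {h z : ℕ} {o : Option ℕ}
    (hab : N.a ≠ N.b) (hcb : N.c ≠ N.b) (hac : N.a ≠ N.c)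
    (h1 : f N.b < h) (h3 : f N.c + 1 < h + 4) (h5 : f N.a < z + 2) (hz : h + 9 < z)
    (ho : ∀ l ∈ o, l = h + 1)
    (hg : ∀ i, (if i = N.b then mergeEnd top z else if i = N.c then z + 5 else
      if i = N.a then z + 3 else f i) ≤ g i) : Run f (merge top N h z o) g := by
  unfold merge
  refine Run.ite (fun ht => ?_) fun ht => ?_
  · refine run_fast hab hcb hac h1 (by omega) (by omega) (by omega) h5 (by omega) (by omega)
      (fun l hl => ?_) (by simp) fun i => ?_
    · have := ho l hl; omega
    · have := hg i
      simpa [mergeEnd, ht] using this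
  · refine run_slow hab hcb hac h1 (by omega) (by omega) (by omega) (by omega) (by omega)
      (fun l hl => ?_) (by simp) fun i => ?_
    · have := ho l hl; omega
    · have := hg i
      simpa [mergeEnd, ht] using this

theorem sLab_eq {sp : Bool} {l : ℕ} : ∀ k ∈ sLab sp l, k = l := by
  cases sp <;> simp [sLab]

theorem endA_ge (r e h : ℕ) : h + 32 + 16 * r ≤ endA r e h := by
  induction r generalizing h with
  | zero => unfold endA; split_ifs <;> omega
  | succ r ih => have := ih (h + 16); simp only [endA]; omega

theorem endB_ge (r e h : ℕ) : h + 32 + 16 * r ≤ endB r e false h := by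
  induction r generalizing h with
  | zero => rcases e with _ | _ | _ | e <;> simp [endB, mergeEnd]
  | succ r ih => have := ih (h + 16); simp only [endB, mergeEnd, Bool.false_eq_true, if_false]; omega

/-- The bounds on the occupation of the qubits after a tree: `E` bounds the label of the end. -/
def treeBound (r e : ℕ) (top : Bool) (q h E : ℕ) (f : ℕ → ℕ) (i : ℕ) : ℕ :=
  if i < q ∨ i = q + 1 then f i else if i = rootA r e q then endA r e h
    else if i = rootB r e q then endB r e top h else E

theorem mergeEnd_ge (top : Bool) (z : ℕ) : z + 8 ≤ mergeEnd top z := by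
  unfold mergeEnd; split_ifs <;> omega

set_option maxHeartbeats 1000000 in
theorem base_run {e q h E : ℕ} (he : e < 4) {top sp : Bool} {f g : ℕ → ℕ} (h0 : f q < h)
    (h2 : f (q + 2) < h) (h3 : f (q + 3) < h + 16) (h4 : ∀ i, q + 4 ≤ i → f i < h)
    (hA : endA 0 e h ≤ E) (hB : endB 0 e top h ≤ E)
    (hg : ∀ i, treeBound 0 e top q h E f i ≤ g i) : Run f (base e top q h sp) g := by
  -- The occupation after the first and after the second node.
  set g1 : ℕ → ℕ := fun i => if i = q then h + 32 else if i = q + 5 then h + 21 else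
    if i = q + 4 then h + 13 else f i with hg1
  set w : ℕ := if e = 0 ∧ top = true then h + 24 else h + 32 with hw
  set g2 : ℕ → ℕ := fun i => if i = q + 2 then w else if i = q + 7 then h + 21 else
    if i = q + 6 then h + 14 else g1 i with hg2
  have f4 := h4 (q + 4) (by omega)
  have f5 := h4 (q + 5) (by omega)
  have f6 := h4 (q + 6) (by omega)
  have f7 := h4 (q + 7) (by omega)
  have f8 := h4 (q + 8) (by omega)
  have f9 := h4 (q + 9) (by omega)
  have f10 := h4 (q + 10) (by omega)
  have r1 : Run f (up ⟨q, q + 5, q + 4, true, true⟩ h (sLab sp (h + 17))) g1 :=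
    run_up (by simp) (by simp) (by simp) h0 (by simp only; omega) (by simp only; omega) sLab_eq
      (fun i => le_rfl)
  have r2 : Run g1 (if e = 0 ∧ top = true then
      fast ⟨q + 2, q + 7, q + 6, true, true⟩ h (h + 4) (h + 13) (h + 20) (h + 24) none
        (sLab sp (h + 17))
      else up ⟨q + 2, q + 7, q + 6, true, true⟩ h (sLab sp (h + 17))) g2 := by
    refine Run.ite (fun ht => ?_) fun ht => ?_
    · refine run_fast (by simp) (by simp) (by simp) ?_ (by omega) ?_ (by omega) ?_ (by omega)
        (by omega) (by simp) (fun l hl => by have := sLab_eq l hl; omega) fun i => ?_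
      · simp [hg1]; omega
      · simp [hg1]; omega
      · simp [hg1]; omega
      · simp only [hg2, hw, if_pos ht]; exact le_rfl
    · refine run_up (by simp) (by simp) (by simp) ?_ ?_ ?_ sLab_eq fun i => ?_
      · simp [hg1]; omega
      · simp [hg1]; omega
      · simp [hg1]; omega
      · simp only [hg2, hw, if_neg ht]; split_ifs <;> omega
  unfold base
  refine (r1.append r2).append ?_
  have hv : ∀ {N : Node} {z : ℕ} {k : ℕ → ℕ}, N.a = q → N.b = q + 3 → (N.c = q + 8 ∨ N.c = q + 9) →
      e ≠ 0 →
      (∀ i, (if i = q + 3 then h + 48 else if i = N.c then h + 37 else if i = q then h + 35 else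
        g2 i) ≤ k i) → Run g2 (if sp then fast N (h + 16) (h + 20) (h + 34) (h + 36) (h + 48)
        (some (h + 17)) none
      else slow N (h + 16) (h + 20) (h + 35) (h + 36) none none) k := by
    intro N z k ea eb ec he0 hk
    have v1 : g2 N.b < h + 16 := by rw [eb]; simp [hg2, hg1]; omega
    have v2 : g2 N.c < h := by rcases ec with ec | ec <;> rw [ec] <;> simp [hg2, hg1] <;> omega
    have v3 : g2 N.a = h + 32 := by rw [ea]; simp [hg2, hg1]
    refine Run.ite (fun _ => ?_) fun _ => ?_
    · refine run_fast (by omega) (by omega) (by omega) v1 (by omega) (by omega) (by omega)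
        (by omega) (by omega) (by omega) (by simp) (by simp) fun i => ?_
      have := hk i
      rw [ea, eb]
      exact this
    · refine run_slow (by omega) (by omega) (by omega) v1 (by omega) (by omega) (by omega)
        (by omega) (by omega) (by simp) (by simp) fun i => ?_
      have := hk i
      rw [ea, eb]
      exact this
  have hEh : h + 32 ≤ E := by
    have := endA_ge 0 e h
    omega
  have hm := mergeEnd_ge top
  have m1 := hm (h + 32)
  have m2 := hm (h + 48)
  interval_cases e
  · refine (run_nil g2).weaken (fun _ => le_rfl) ?_
    refine fun i => le_trans ?_ (hg i)
    have fi : q + 4 ≤ i → f i < h := h4 i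
    have f3 : i = q + 3 → f i < h + 16 := by rintro rfl; exact h3
    simp only [treeBound, rootA, rootB, endA, endB, hg2, hg1, hw, Nat.ofNat_pos, if_true,
      true_and] at hA hB ⊢
    split_ifs at hB ⊢ <;> omega
  · refine run_merge (by simp) (by simp) (by simp) ?_ ?_ ?_ (by omega) (by simp) ?_
    · simp [hg2, hg1]
    · simp [hg2, hg1]; omega
    · simp [hg2, hg1, hw]
    refine fun i => le_trans ?_ (hg i)
    have fi : q + 4 ≤ i → f i < h := h4 i
    have f3 : i = q + 3 → f i < h + 16 := by rintro rfl; exact h3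
    simp only [treeBound, rootA, rootB, endA, endB, hg2, hg1, hw, OfNat.ofNat_ne_zero, one_ne_zero,
      false_and, if_false, Nat.reduceLT, Nat.one_lt_ofNat, lt_self_iff_false, if_true] at hA hB ⊢
    split_ifs <;> omega
  · refine (hv (z := 0) rfl rfl (Or.inr rfl) (by omega) fun i => le_rfl).append ?_
    refine run_merge (by simp) (by simp) (by simp) ?_ ?_ ?_ (by omega) (by simp) ?_
    · simp [hg2, hg1]
    · simp [hg2, hg1]; omega
    · simp [hg2, hg1, hw]
    refine fun i => le_trans ?_ (hg i)
    have fi : q + 4 ≤ i → f i < h := h4 i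
    have f3 : i = q + 3 → f i < h + 16 := by rintro rfl; exact h3
    simp only [treeBound, rootA, rootB, endA, endB, hg2, hg1, hw, OfNat.ofNat_ne_zero, one_ne_zero,
      false_and, if_false, Nat.reduceLT, Nat.one_lt_ofNat, lt_self_iff_false, if_true] at hA hB ⊢
    split_ifs <;> omega
  · refine ((hv (z := 0) rfl rfl (Or.inl rfl) (by omega) fun i => le_rfl).append
      (run_up (g := fun i => if i = q + 6 then h + 48 else if i = q + 10 then h + 37 else
        if i = q + 9 then h + 29 else if i = q + 3 then h + 48 else if i = q + 8 then h + 37 else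
        if i = q then h + 35 else g2 i) (by simp) (by simp) (by simp) ?_ ?_ ?_ (by simp)
        fun i => le_rfl)).append ?_
    · simp [hg2, hg1]
    · simp [hg2, hg1]; omega
    · simp [hg2, hg1]; omega
    refine run_merge (by simp) (by simp) (by simp) ?_ ?_ ?_ (by omega) (by simp) ?_
    · simp [hg2, hg1]
    · simp [hg2, hg1, hw]
    · simp [hg2, hg1, hw]
    refine fun i => le_trans ?_ (hg i)
    have fi : q + 4 ≤ i → f i < h := h4 i
    have f3 : i = q + 3 → f i < h + 16 := by rintro rfl; exact h3
    simp only [treeBound, rootA, rootB, endA, endB, hg2, hg1, hw, OfNat.ofNat_ne_zero, one_ne_zero,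
      false_and, if_false, Nat.reduceLT, Nat.one_lt_ofNat, lt_self_iff_false, if_true] at hA hB ⊢
    split_ifs <;> omega

theorem tree_run {r e q h E : ℕ} (he : e < 4) {top sp : Bool} {f g : ℕ → ℕ} (h0 : f q < h)
    (h2 : f (q + 2) < h) (h3 : f (q + 3) < h + 16) (h4 : ∀ i, q + 4 ≤ i → f i < h)
    (hA : endA r e h ≤ E) (hB : endB r e top h ≤ E)
    (hg : ∀ i, treeBound r e top q h E f i ≤ g i) : Run f (tree r e top q h sp) g := by
  induction r generalizing q h top f g E with
  | zero => exact base_run he h0 h2 h3 h4 hA hB hg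
  | succ r ih =>
    -- The occupation after the first and after the second outer node.
    set g1 : ℕ → ℕ := fun i => if i = q then h + 32 else if i = q + 5 then h + 21 else
      if i = q + 4 then h + 13 else f i with hg1
    set g2 : ℕ → ℕ := fun i => if i = q + 2 then h + 32 else if i = q + 7 then h + 21 else
      if i = q + 6 then h + 13 else g1 i with hg2
    have f4 := h4 (q + 4) (by omega)
    have f5 := h4 (q + 5) (by omega)
    have f6 := h4 (q + 6) (by omega)
    have f7 := h4 (q + 7) (by omega)
    have r1 : Run f (up ⟨q, q + 5, q + 4, true, true⟩ h none) g1 :=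
      run_up (by simp) (by simp) (by simp) h0 (by simp only; omega) (by simp only; omega) (by simp)
        (fun i => le_rfl)
    have r2 : Run g1 (up ⟨q + 2, q + 7, q + 6, true, true⟩ h none) g2 := by
      refine run_up (by simp) (by simp) (by simp) ?_ ?_ ?_ (by simp) fun i => le_rfl
      · simp [hg1]; omega
      · simp [hg1]; omega
      · simp [hg1]; omega
    have gA := endA_ge r e (h + 16)
    have gB := endB_ge r e (h + 16)
    set zA := endA r e (h + 16) with hzA
    set zB := endB r e false (h + 16) with hzB
    have eA : endA (r + 1) e h = zA + 16 := rfl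
    have eB : endB (r + 1) e top h = mergeEnd top zB := rfl
    have eB' : zB + 8 ≤ mergeEnd top zB := by unfold mergeEnd; split_ifs <;> omega
    have mA := rootA_mem r e (q + 4)
    have mB := rootB_mem r e (q + 4)
    have r3 : Run g2 (tree r e false (q + 4) (h + 16) sp)
        (treeBound r e false (q + 4) (h + 16) E g2) := by
      refine ih ?_ ?_ ?_ ?_ ?_ ?_ fun i => le_rfl
      · simp [hg2, hg1]
      · simp [hg2]
      · simp [hg2]
      · intro i hi
        have := h4 i (by omega)
        simp only [hg2, hg1]
        split_ifs <;> omega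
      · omega
      · omega
    set g3 := treeBound r e false (q + 4) (h + 16) E g2 with hg3
    have b0 : g3 q = h + 32 := by simp [hg3, treeBound, hg2, hg1]
    have b2 : g3 (q + 2) = h + 32 := by simp [hg3, treeBound, hg2]
    have b3 : g3 (q + 3) = f (q + 3) := by simp [hg3, treeBound, hg2, hg1]
    have b5 : g3 (q + 5) = h + 21 := by simp [hg3, treeBound, hg2, hg1]
    have bA : g3 (rootA r e (q + 4)) = zA := by
      rw [hg3, treeBound, if_neg (by omega), if_pos rfl]
    have bB : g3 (rootB r e (q + 4)) = zB := by
      rw [hg3, treeBound, if_neg (by omega), if_neg (by omega), if_pos rfl]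
    set a := rootA r e (q + 4) with ha
    set b := rootB r e (q + 4) with hb
    set g4 : ℕ → ℕ := fun i => if i = q + 3 then zA + 16 else if i = q then zA + 5 else
      if i = a then zA + 3 else g3 i with hg4
    have r4 : Run g3 (merge false ⟨q + 3, q, a, false, false⟩ (h + 16 * (r + 2)) zA
        (sLab sp (h + 16 * (r + 2) + 1))) g4 := by
      refine run_merge (by simp only; omega) (by simp) (by simp only; omega) ?_ ?_ ?_ (by omega)
        sLab_eq fun i => le_rfl
      · simp only; omega
      · simp only; omega
      · simp only; omega
    have r5 : Run g4 (merge top ⟨q + 5, q + 2, b, false, false⟩ (h + 16 * (r + 2)) zB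
        (sLab sp (h + 16 * (r + 2) + 1))) g := by
      have c5 : g4 (q + 5) = h + 21 := by
        simp only [hg4]
        rw [if_neg (by omega), if_neg (by omega), if_neg (by omega), b5]
      have c2 : g4 (q + 2) = h + 32 := by
        simp only [hg4]
        rw [if_neg (by omega), if_neg (by omega), if_neg (by omega), b2]
      have cb : g4 b = zB := by
        simp only [hg4]
        rw [if_neg (by omega), if_neg (by omega), if_neg (by omega), bB]
      refine run_merge (by simp only; omega) (by simp) (by simp only; omega) ?_ ?_ ?_ (by omega)
        sLab_eq fun i => ?_
      · simp only; omega
      · simp only; omega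
      · simp only; omega
      refine le_trans ?_ (hg i)
      simp only [treeBound, rootA, rootB, eA, eB, hg4]
      by_cases i1 : i < q ∨ i = q + 1
      · rw [if_neg (by omega), if_neg (by omega), if_neg (by omega), if_neg (by omega),
          if_neg (by omega), if_neg (by omega), if_pos i1]
        simp only [hg3, treeBound, hg2, hg1]
        rw [if_pos (by omega), if_neg (by omega), if_neg (by omega), if_neg (by omega),
          if_neg (by omega), if_neg (by omega), if_neg (by omega)]
      · rw [if_neg i1]
        by_cases i2 : i = q + 3
        · rw [if_neg (by omega), if_neg (by omega), if_neg (by omega), if_pos i2, if_pos i2]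
        · by_cases i3 : i = q + 5
          · rw [if_pos i3, if_neg i2, if_pos i3]
          · simp only [if_neg i2, if_neg i3]
            have : g3 i ≤ E ∨ i = q ∨ i = q + 2 := by
              by_cases i4 : i = q ∨ i = q + 2
              · exact Or.inr i4
              · left
                simp only [hg3, treeBound]
                rw [if_neg (by omega)]
                split_ifs <;> omega
            split_ifs <;> omega
    exact (((r1.append r2).append r3).append r4).append r5

end TreeRun

/-! ### Counting gates, and the time labels of gates of each kind -/

section Count

namespace Ins

/-- The kind of the gate of an instruction. -/
def kind : Ins → Kind
  | cx _ _ => Kind.cnot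
  | tg _ _ => Kind.t
  | sg _ _ => Kind.s
  | hg _ => Kind.h
  | rx _ _ => Kind.rot
  | rz _ _ => Kind.rot

theorem kind_inv (i : Ins) : i.inv.kind = i.kind := by cases i <;> rfl

end Ins

/-- The number of instructions of the kind `k`. -/
def cnt (k : Kind) (L : Prog) : ℕ := L.countP fun x => decide (x.2.kind = k)

theorem cnt_nil (k : Kind) : cnt k [] = 0 := rfl

theorem cnt_cons (k : Kind) (x : ℕ × Ins) (L : Prog) :
    cnt k (x :: L) = cnt k L + if x.2.kind = k then 1 else 0 := by
  simp [cnt, List.countP_cons]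

theorem cnt_append (k : Kind) (L L' : Prog) : cnt k (L ++ L') = cnt k L + cnt k L' :=
  List.countP_append

theorem cnt_invP (k : Kind) (Λ : ℕ) (L : Prog) : cnt k (invP Λ L) = cnt k L := by
  simp [cnt, invP, List.countP_reverse, List.countP_map, Function.comp_def, Ins.kind_inv]

/-- The numbers of gates of a node with `c` gates `CNOT` and `s` gates `S`. -/
def nodeCost (c s : ℕ) : Kind → ℕ
  | .cnot => c
  | .t => 4
  | .s => s
  | .h => 2
  | .rot => 0

theorem cnt_slow (N : Node) (h0 p x q : ℕ) (o0 o2 : Option ℕ) (k : Kind) :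
    cnt k (slow N h0 p x q o0 o2) =
      nodeCost 3 ((if o0.isSome then 1 else 0) + if o2.isSome then 1 else 0) k := by
  cases o0 <;> cases o2 <;> cases k <;>
    simp [slow, sPart, tPart, cnt_cons, cnt_append, cnt_nil, Ins.kind, nodeCost]

theorem cnt_fast (N : Node) (h0 p x q he : ℕ) (o0 o1 : Option ℕ) (k : Kind) :
    cnt k (fast N h0 p x q he o0 o1) =
      nodeCost 4 ((if o0.isSome then 1 else 0) + if o1.isSome then 1 else 0) k := by
  cases o0 <;> cases o1 <;> cases k <;>
    simp [fast, sPart, tPart, cnt_cons, cnt_append, cnt_nil, Ins.kind, nodeCost]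

/-- The numbers of gates of a tree. -/
def treeCost (r e : ℕ) (top sp : Bool) : Kind → ℕ
  | .cnot => 3 * (2 + e + 4 * r) + (if top then 1 else 0) + (if sp ∧ 2 ≤ e then 1 else 0)
  | .t => 4 * (2 + e + 4 * r)
  | .s => if sp then 2 + 2 * r + (if 2 ≤ e then 1 else 0) else 0
  | .h => 2 * (2 + e + 4 * r)
  | .rot => 0

theorem cnt_tree {r e : ℕ} (he : e < 4) (top : Bool) (q h : ℕ) (sp : Bool) (k : Kind) :
    cnt k (tree r e top q h sp) = treeCost r e top sp k := by
  induction r generalizing q h top with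
  | zero =>
    simp only [tree, base]
    interval_cases e <;> cases top <;> cases sp <;> cases k <;>
      simp [cnt_append, up, merge, cnt_slow, cnt_fast, cnt_nil, treeCost, nodeCost, sLab]
  | succ r ih =>
    simp only [tree, cnt_append, ih, up, merge]
    cases top <;> cases sp <;> cases k <;>
      simp [cnt_append, cnt_slow, cnt_fast, cnt_nil, treeCost, nodeCost, sLab] <;> ring_nf

end Count

section Forall

/-- The instruction acts on distinct qubits with numbers up to `n`. -/
def WF (n : ℕ) : Ins → Prop
  | cx c t => c ≤ n ∧ t ≤ n ∧ c ≠ t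
  | tg _ q => q ≤ n
  | sg _ q => q ≤ n
  | hg q => q ≤ n
  | rx _ q => q ≤ n
  | rz _ q => q ≤ n

theorem WF.inv {n : ℕ} {i : Ins} (h : WF n i) : WF n i.inv := by cases i <;> exact h

theorem WF.le {n : ℕ} {i : Ins} (h : WF n i) : ∀ q ∈ i.qs, q ≤ n := by
  cases i <;> simp [qs, WF] at * <;> omega

/-- The regularity of the time labels: `T` gates have labels divisible by `8`, and `H` gates have
labels congruent to `12` modulo `16`, or equal to `B`; all `S` gates have the label `S`. -/
def Lab (B S : ℕ) (x : ℕ × Ins) : Prop :=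
  match x.2 with
  | cx _ _ => True
  | tg _ _ => x.1 % 8 = 0
  | sg _ _ => x.1 = S
  | hg _ => x.1 % 16 = 12 ∨ x.1 = B
  | rx _ _ => False
  | rz _ _ => False

theorem slow_wf {n : ℕ} {N : Node} (hN : N.Ok n) (h0 p x q : ℕ) (o0 o2 : Option ℕ) :
    ∀ y ∈ slow N h0 p x q o0 o2, WF n y.2 := by
  obtain ⟨⟨_, h1⟩, ⟨_, h2⟩, ⟨_, h3⟩, h4, h5, h6⟩ := hN
  cases o0 <;> cases o2 <;> simp [slow, sPart, tPart, WF, h1, h2, h3, h4, h5, h6]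

theorem fast_wf {n : ℕ} {N : Node} (hN : N.Ok n) (h0 p x q he : ℕ) (o0 o1 : Option ℕ) :
    ∀ y ∈ fast N h0 p x q he o0 o1, WF n y.2 := by
  obtain ⟨⟨_, h1⟩, ⟨_, h2⟩, ⟨_, h3⟩, h4, h5, h6⟩ := hN
  cases o0 <;> cases o1 <;> simp [fast, sPart, tPart, WF, h1, h2, h3, h4, h5, h6, h5.symm]

theorem slow_lab {B S : ℕ} (N : Node) {h0 p x q : ℕ} {o0 o2 : Option ℕ}
    (h1 : h0 % 16 = 12 ∨ h0 = B) (h2 : p % 8 = 0) (h3 : q % 8 = 0)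
    (h4 : (q + 12) % 16 = 12 ∨ q + 12 = B) (ho0 : ∀ l ∈ o0, l = S) (ho2 : ∀ l ∈ o2, l = S) :
    ∀ y ∈ slow N h0 p x q o0 o2, Lab B S y := by
  cases o0 <;> cases o2 <;> simp [slow, sPart, tPart, Lab] at * <;> omega

theorem fast_lab {B S : ℕ} (N : Node) {h0 p x q he : ℕ} {o0 o1 : Option ℕ}
    (h1 : h0 % 16 = 12 ∨ h0 = B) (h2 : p % 8 = 0) (h3 : q % 8 = 0)
    (h4 : he % 16 = 12 ∨ he = B) (ho0 : ∀ l ∈ o0, l = S) (ho1 : ∀ l ∈ o1, l = S) :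
    ∀ y ∈ fast N h0 p x q he o0 o1, Lab B S y := by
  cases o0 <;> cases o1 <;> simp [fast, sPart, tPart, Lab] at * <;> omega

theorem forall_append {P : ℕ × Ins → Prop} {L L' : Prog} (h : ∀ x ∈ L, P x) (h' : ∀ x ∈ L', P x) :
    ∀ x ∈ L ++ L', P x := by
  intro x hx
  rcases List.mem_append.1 hx with hx | hx
  · exact h x hx
  · exact h' x hx

theorem forall_ite {P : ℕ × Ins → Prop} {c : Prop} [Decidable c] {L L' : Prog}
    (h : c → ∀ x ∈ L, P x) (h' : ¬c → ∀ x ∈ L', P x) : ∀ x ∈ if c then L else L', P x := by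
  split_ifs with hc
  · exact h hc
  · exact h' hc

theorem merge_wf {n : ℕ} {N : Node} (hN : N.Ok n) (top : Bool) (h z : ℕ) (o : Option ℕ) :
    ∀ y ∈ merge top N h z o, WF n y.2 :=
  forall_ite (fun _ => fast_wf hN _ _ _ _ _ _ _) fun _ => slow_wf hN _ _ _ _ _ _

theorem merge_lab {B S : ℕ} (N : Node) {top : Bool} {h z : ℕ} {o : Option ℕ}
    (h1 : h % 16 = 12) (h2 : z % 16 = 12)
    (h4 : mergeEnd top z % 16 = 12 ∨ mergeEnd top z = B) (ho : ∀ l ∈ o, l = S) :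
    ∀ y ∈ merge top N h z o, Lab B S y := by
  unfold mergeEnd at h4
  refine forall_ite (fun ht => ?_) fun ht => ?_
  · rw [if_pos ht] at h4
    exact fast_lab N (Or.inl h1) (by omega) (by omega) h4 ho (by simp)
  · rw [if_neg ht] at h4
    exact slow_lab N (Or.inl h1) (by omega) (by omega) (by omega) ho (by simp)

theorem tree_wf {r e q n : ℕ} (hq : 1 ≤ q) (he : e < 4) (hn : q + 7 + 4 * r + e ≤ n) (top : Bool)
    (h : ℕ) (sp : Bool) : ∀ x ∈ tree r e top q h sp, WF n x.2 := by
  induction r generalizing q h top with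
  | zero =>
    have hok := base_nodes_ok hq he hn
    have hs : ∀ N ∈ baseNodes e q, ∀ h0 p x q o0 o2, ∀ y ∈ slow N h0 p x q o0 o2, WF n y.2 :=
      fun N hN _ _ _ _ _ _ => slow_wf (hok N hN) _ _ _ _ _ _
    have hfa : ∀ N ∈ baseNodes e q, ∀ h0 p x q he o0 o2, ∀ y ∈ fast N h0 p x q he o0 o2,
      WF n y.2 := fun N hN _ _ _ _ _ _ _ => fast_wf (hok N hN) _ _ _ _ _ _ _
    have hm : ∀ N ∈ baseNodes e q, ∀ h z o, ∀ y ∈ merge top N h z o, WF n y.2 :=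
      fun N hN _ _ _ => merge_wf (hok N hN) _ _ _ _
    simp only [tree, base]
    refine forall_append (forall_append (hs _ (by simp [baseNodes]) _ _ _ _ _ _) (forall_ite
      (fun _ => hfa _ (by simp [baseNodes]) _ _ _ _ _ _ _)
      (fun _ => hs _ (by simp [baseNodes]) _ _ _ _ _ _))) ?_
    interval_cases e
    · simp
    · exact hm _ (by simp [baseNodes]) _ _ _
    · exact forall_append (forall_ite (fun _ => hfa _ (by simp [baseNodes]) _ _ _ _ _ _ _)
        fun _ => hs _ (by simp [baseNodes]) _ _ _ _ _ _) (hm _ (by simp [baseNodes]) _ _ _)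
    · exact forall_append (forall_append (forall_ite
        (fun _ => hfa _ (by simp [baseNodes]) _ _ _ _ _ _ _)
        fun _ => hs _ (by simp [baseNodes]) _ _ _ _ _ _) (hs _ (by simp [baseNodes]) _ _ _ _ _ _))
        (hm _ (by simp [baseNodes]) _ _ _)
  | succ r ih =>
    have hok := tree_nodes_ok hq he hn
    unfold tree
    refine forall_append (forall_append (forall_append (forall_append (slow_wf (hok _ ?_) _ _ _ _ _ _)
      (slow_wf (hok _ ?_) _ _ _ _ _ _)) (ih (by omega) (by omega) _ _)) (merge_wf (hok _ ?_) _ _ _ _))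
      (merge_wf (hok _ ?_) _ _ _ _) <;> simp [treeNodes]

theorem endA_mod (r e h : ℕ) : endA r e h % 16 = h % 16 := by
  induction r generalizing h with
  | zero => unfold endA; split_ifs <;> omega
  | succ r ih => have := ih (h + 16); simp only [endA]; omega

theorem endB_mod (r e h : ℕ) : endB r e false h % 16 = h % 16 := by
  induction r generalizing h with
  | zero => rcases e with _ | _ | _ | e <;> simp [endB, mergeEnd] <;> omega
  | succ r ih =>
    have := ih (h + 16); simp only [endB, mergeEnd, Bool.false_eq_true, if_false]; omega

theorem tree_lab {r e : ℕ} (he : e < 4) (top : Bool) (q : ℕ) {h B S : ℕ} (sp : Bool)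
    (h1 : h % 16 = 12) (hB : top = true → endB r e top h = B) (hS : S = h + 16 * r + 17) :
    ∀ x ∈ tree r e top q h sp, Lab B S x := by
  subst hS
  induction r generalizing q h top with
  | zero =>
    simp only [tree, base]
    have hs : ∀ N h0, h0 % 16 = 12 → ∀ x o, (∀ l ∈ o, l = h + 17) →
        ∀ y ∈ slow N h0 (h0 + 4) x (h0 + 20) none o, Lab B (h + 17) y :=
      fun N h0 hh _ _ ho => slow_lab N (Or.inl hh) (by omega) (by omega) (by omega) (by simp) ho
    have hs1 := hs ⟨q, q + 5, q + 4, true, true⟩ h h1 (h + 13) _ (sLab_eq (sp := sp))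
    have hs2 := hs ⟨q + 2, q + 7, q + 6, true, true⟩ h h1 (h + 13) _ (sLab_eq (sp := sp))
    have hv : ∀ N, ∀ y ∈ (if sp = true then fast N (h + 16) (h + 20) (h + 34) (h + 36) (h + 48)
        (some (h + 17)) none
        else slow N (h + 16) (h + 20) (h + 35) (h + 36) none none), Lab B (h + 17) y := by
      intro N
      refine forall_ite (fun _ => ?_) fun _ => ?_
      · exact fast_lab N (Or.inl (by omega)) (by omega) (by omega) (Or.inl (by omega)) (by simp)
          (by simp)
      · exact slow_lab N (Or.inl (by omega)) (by omega) (by omega) (by omega) (by simp)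
          (by simp)
    have hm : ∀ z, z % 16 = 12 → (top = true → mergeEnd top z = B) →
        mergeEnd top z % 16 = 12 ∨ mergeEnd top z = B := by
      intro z hz hz'
      cases top
      · left; simp [mergeEnd]; omega
      · right; exact hz' rfl
    refine forall_append (forall_append hs1 (forall_ite (fun hc => ?_) fun _ => hs2)) ?_
    · refine fast_lab _ (Or.inl h1) (by omega) (by omega) (Or.inr ?_) (by simp) sLab_eq
      obtain ⟨rfl, rfl⟩ := hc
      simpa [endB] using hB rfl
    interval_cases e
    · simp
    · exact merge_lab _ (by omega) (by omega) (hm _ (by omega) hB) (by simp)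
    · exact forall_append (hv _) (merge_lab _ (by omega) (by omega) (hm _ (by omega) hB) (by simp))
    · exact forall_append (forall_append (hv _) (hs _ (h + 16) (by omega) _ none (by simp)))
        (merge_lab _ (by omega) (by omega) (hm _ (by omega) hB) (by simp))
  | succ r ih =>
    have mA := endA_mod r e (h + 16)
    have mB := endB_mod r e (h + 16)
    have hs : ∀ N, ∀ y ∈ up N h none, Lab B (h + 16 * (r + 1) + 17) y :=
      fun N => slow_lab N (Or.inl h1) (by omega) (by omega) (by omega) (by simp) (by simp)
    unfold tree
    refine forall_append (forall_append (forall_append (forall_append (hs _) (hs _)) ?_)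
      (merge_lab _ (by omega) (by omega) (Or.inl ?_) ?_)) (merge_lab _ (by omega) (by omega) ?_ ?_)
    · have := ih false (q + 4) (h := h + 16) (by omega) (by simp)
      rwa [show h + 16 + 16 * r + 17 = h + 16 * (r + 1) + 17 by ring] at this
    · simp [mergeEnd]; omega
    · intro l hl; rw [sLab_eq l hl]; ring
    · cases top
      · left; simp [mergeEnd]; omega
      · right; exact hB rfl
    · intro l hl; rw [sLab_eq l hl]; ring

end Forall

/-! ### The sweep -/

section Sweep

/-- The classical computation for `8 + 4 r + e` controls. The controls `1` and `2` serve as ancillas in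
the state `1`; the controls `3` and `4` are combined into the qubit `2`, and the others by a tree. -/
def sweep (r e : ℕ) (sp : Bool) (o : ℕ) : Prog :=
  fast ⟨2, 4, 3, true, true⟩ (o + 4) (o + 8) (o + 9) (o + 16) (o + 28) none none ++
    tree r e true 1 (o + 12) sp

/-- The nodes of `sweep`. -/
def sweepNodes (r e : ℕ) : List Node := [⟨2, 4, 3, true, true⟩] ++ treeNodes r e 1

/-- The output of the tree that is ready first. -/
def early (r e : ℕ) : ℕ := if e % 2 = 0 then rootB r e 1 else rootA r e 1

/-- The output of the tree that is ready last. -/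
def late (r e : ℕ) : ℕ := if e % 2 = 0 then rootA r e 1 else rootB r e 1

/-- The duration of a sweep. -/
def span (r e : ℕ) : ℕ := 40 + 32 * r + 8 * e

theorem roots (r e : ℕ) (he : e < 4) : early r e ≠ late r e ∧ 1 ≤ early r e ∧ 1 ≤ late r e ∧
    early r e ≠ 2 ∧ late r e ≠ 2 ∧ early r e ≤ 6 ∧ late r e ≤ 6 := by
  cases r <;> interval_cases e <;> simp [early, late, rootA, rootB]

theorem endA_eq (r e h : ℕ) : endA r e h = (if e < 2 then h + 32 else h + 48) + 32 * r := by
  induction r generalizing h with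
  | zero => rfl
  | succ r ih => simp only [endA, ih]; split_ifs <;> omega

theorem endB_false_eq (r e h : ℕ) (he : e < 4) : endB r e false h =
    (if e = 0 then h + 32 else if e = 3 then h + 64 else h + 48) + 32 * r := by
  induction r generalizing h with
  | zero => interval_cases e <;> simp [endB, mergeEnd]
  | succ r ih => simp [endB, mergeEnd, ih]; split_ifs <;> omega

theorem endB_true_eq (r e h : ℕ) (he : e < 4) : endB r e true h =
    (if e = 0 then h + 24 else if e = 3 then h + 56 else h + 40) + 32 * r := by
  cases r with
  | zero => interval_cases e <;> simp [endB, mergeEnd]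
  | succ r => simp [endB, mergeEnd, endB_false_eq _ _ _ he]; split_ifs <;> omega

theorem sweep_nodes_ok {r e n : ℕ} (he : e < 4) (hn : 8 + 4 * r + e ≤ n) :
    ∀ N ∈ sweepNodes r e, N.Ok n := by
  intro N hN
  rcases List.mem_append.1 hN with hN | hN
  · simp only [List.mem_singleton] at hN
    subst hN
    simp [Node.Ok]; omega
  · exact tree_nodes_ok le_rfl he (by omega) N hN

theorem sweep_realizes {Q : Type*} [DecidableEq Q] [Fintype Q] {f : ℕ → Q} {r e n : ℕ}
    (hf : Set.InjOn f {i | i ≤ n}) (he : e < 4) (hn : 8 + 4 * r + e ≤ n) (sp : Bool) (o : ℕ) :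
    Realizes f (sweep r e sp o) (sweepNodes r e) :=
  (fast_realizes ((sweep_nodes_ok he hn _ (by simp [sweepNodes])).distinct hf)
    _ _ _ _ _ _ _).realizes.append (tree_realizes hf le_rfl he (by omega) _ _ _)

/-- When the two ancillas are in the state `1`, the sweep tests whether all other controls are `1`. -/
theorem sweep_spec {r e : ℕ} (he : e < 4) (y : ℕ → Fin 2) :
    ((y 1 = 1 ∧ y 2 = 1) ∧ mapL (sweepNodes r e) y 2 = 0 ∧
      mapL (sweepNodes r e) y (early r e) = 0 ∧ mapL (sweepNodes r e) y (late r e) = 0) ↔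
      ∀ i, 1 ≤ i → i ≤ 8 + 4 * r + e → y i = 1 := by
  have hroots : ∀ z : ℕ → Fin 2, (z (early r e) = 0 ∧ z (late r e) = 0) ↔
      (z (rootA r e 1) = 0 ∧ z (rootB r e 1) = 0) := by
    intro z
    unfold early late
    split_ifs <;> tauto
  rw [hroots]
  set N : Node := ⟨2, 4, 3, true, true⟩ with hN
  have hm : ∀ i, mapL (sweepNodes r e) y i = mapL (treeNodes r e 1) (N.map y) i := fun i => by
    rw [sweepNodes, mapL_append]; rfl
  simp only [hm]
  rw [tree_frame he (N.map y) (i := 2) (by omega)]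
  have hne : ∀ i, i ≠ 2 → N.map y i = y i := fun i hi => node_map_of_ne N y hi
  constructor
  · rintro ⟨⟨h1, h2⟩, h3, h4⟩
    obtain ⟨a4, a3⟩ := (node_map_b N y h2).1 h3
    have a3 : y 3 = 1 := a3
    have a4 : y 4 = 1 := a4
    have key := (tree_spec he (N.map y) (by rw [hne _ (by omega), h1])
      (by rw [hne _ (by omega)]; exact a3) (by rw [hne _ (by omega)]; exact a4)).1 h4
    intro i hi hi'
    rcases (show i = 1 ∨ i = 2 ∨ i = 3 ∨ i = 4 ∨ 5 ≤ i by omega) with rfl | rfl | rfl | rfl | h5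
    · exact h1
    · exact h2
    · exact a3
    · exact a4
    · rw [← hne i (by omega)]
      exact key i (by omega) (by omega)
  · intro h
    have h1 := h 1 (by omega) (by omega)
    have h2 := h 2 (by omega) (by omega)
    have h3 := h 3 (by omega) (by omega)
    have h4 := h 4 (by omega) (by omega)
    refine ⟨⟨h1, h2⟩, (node_map_b N y h2).2 ⟨h4, h3⟩, ?_⟩
    exact (tree_spec he (N.map y) (by rw [hne _ (by omega), h1])
      (by rw [hne _ (by omega)]; exact h3) (by rw [hne _ (by omega)]; exact h4)).2
      fun i hi hi' => by rw [hne _ (by omega)]; exact h i (by omega) (by omega)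

/-- The occupation of the qubits after a sweep. -/
def sweepBound (r e o b : ℕ) (i : ℕ) : ℕ :=
  if i = 0 then b else if i = 2 then o + 28 else if i = early r e then o + span r e - 4
    else o + span r e + 4

theorem sweep_run {r e o b : ℕ} (he : e < 4) (sp : Bool) {f : ℕ → ℕ} (h0 : f 0 ≤ b)
    (h1 : f 1 ≤ o + 11) (h2 : ∀ i, 2 ≤ i → f i ≤ o + 3) :
    Run f (sweep r e sp o) (sweepBound r e o b) := by
  have f2 := h2 2 (by omega)
  have f3 := h2 3 (by omega)
  have f4 := h2 4 (by omega)
  set g : ℕ → ℕ := fun i => if i = 2 then o + 28 else if i = 4 then o + 17 else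
    if i = 3 then o + 10 else f i with hg
  have hA := endA_eq r e (o + 12)
  have hB := endB_true_eq r e (o + 12) he
  have hr := roots r e he
  refine Run.append (g := g) (run_fast (by simp) (by simp) (by simp) ?_ (by omega) ?_ (by omega) ?_
    (by omega) (by omega) (by simp) (by simp) fun i => le_rfl) ?_
  · simp only; omega
  · simp only; omega
  · simp only; omega
  refine tree_run (E := o + span r e + 4) he ?_ ?_ ?_ ?_ ?_ ?_ fun i => ?_
  · simp [hg]; omega
  · simp [hg]
  · simp [hg]
  · intro i hi
    have := h2 i (by omega)
    simp only [hg]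
    split_ifs <;> omega
  · rw [hA, span]; split_ifs <;> omega
  · rw [hB, span]; split_ifs <;> omega
  · unfold treeBound sweepBound
    by_cases i0 : i = 0
    · subst i0; simp [hg]; exact h0
    · by_cases i2 : i = 2
      · subst i2; simp [hg]
      · rw [if_neg (by omega), if_neg i0, if_neg i2]
        by_cases iA : i = rootA r e 1
        · rw [if_pos iA, hA]
          have hne := hr.1
          unfold early late at hne
          unfold early span
          clear hA hB
          rcases (show e = 0 ∨ e = 1 ∨ e = 2 ∨ e = 3 by omega) with rfl | rfl | rfl | rfl <;>
            norm_num at hne ⊢ <;> split_ifs <;> omega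
        · rw [if_neg iA]
          by_cases iB : i = rootB r e 1
          · rw [if_pos iB, hB]
            have hne := hr.1
            unfold early late at hne
            unfold early span
            clear hA hB
            rcases (show e = 0 ∨ e = 1 ∨ e = 2 ∨ e = 3 by omega) with rfl | rfl | rfl | rfl <;>
              norm_num at hne ⊢ <;> split_ifs <;> omega
          · rw [if_neg iB, if_neg]
            unfold early
            split_ifs <;> omega

/-- The operator on the target between two sweeps. -/
def dlowP (s : Bool) (o b e l : ℕ) : Prog :=
  [(o + 24, tg false 0), (o + 31, cx 2 0), (o + 32, tg false 0), (b - 4, hg 0),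
    (b - 1, cx e 0), (b, tg s 0), (b + 7, cx l 0), (b + 8, tg s 0), (b + 9, cx e 0),
    (b + 16, tg s 0), (b + 17, cx l 0), (b + 24, tg s 0), (b + 28, hg 0), (b + 32, tg true 0),
    (b + 33, cx 2 0), (b + 40, tg true 0)]

theorem dlowP_run {o b e l : ℕ} (s : Bool) (hb : o + 40 ≤ b) (h0e : e ≠ 0) (h0l : l ≠ 0)
    (h2e : e ≠ 2) (h2l : l ≠ 2) (hel : e ≠ l) {f : ℕ → ℕ} (f0 : f 0 < o + 24) (f2 : f 2 < o + 31)
    (fe : f e < b - 1) (fl : f l < b + 7) :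
    Run f (dlowP s o b e l) fun i => if i = 0 then b + 40 else if i = 2 then b + 33 else
      if i = e then b + 9 else if i = l then b + 17 else f i := by
  refine ⟨?_, fun i => ?_⟩
  · simp [dlowP, Fits, adv, qs, h0e, h0l, h2e, h2l, hel, h0e.symm, h0l.symm, h2e.symm, h2l.symm,
      hel.symm]
    omega
  · by_cases i0 : i = 0
    · subst i0; simp [dlowP, advL, adv, qs]
    · by_cases i2 : i = 2
      · subst i2
        simp [dlowP, advL, adv, qs, h2e.symm, h2l.symm]
      · by_cases ie : i = e
        · subst ie; simp [dlowP, advL, adv, qs, i0, i2, hel]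
        · by_cases il : i = l
          · subst il; simp [dlowP, advL, adv, qs, i0, i2, ie]
          · simp [dlowP, advL, adv, qs, i0, i2, ie, il]

/-- A sweep, the operator on the target, and the inverse sweep in mirrored time. -/
def conjP (r e : ℕ) (s sp : Bool) (o : ℕ) : Prog :=
  sweep r e sp o ++ dlowP s o (o + span r e) (early r e) (late r e) ++
    invP (2 * o + 2 * span r e + 24) (sweep r e false o)

theorem qs_ne_nil (i : Ins) : ∃ q, q ∈ i.qs := by cases i <;> simp [qs]

theorem Run.label_le {f g : ℕ → ℕ} {L : Prog} (h : Run f L g) {B : ℕ} (hB : ∀ q, g q ≤ B) :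
    ∀ x ∈ L, x.1 ≤ B := fun x hx => by
  obtain ⟨q, hq⟩ := qs_ne_nil x.2
  exact (h.le_of_mem hx q hq).trans (hB q)

theorem conjP_run {r e o : ℕ} (he : e < 4) (s sp : Bool) {f : ℕ → ℕ} (h0 : f 0 ≤ o + 23)
    (h1 : f 1 ≤ o + 11) (h2 : ∀ i, 2 ≤ i → f i ≤ o + 3) :
    Run f (conjP r e s sp o) fun i => if i = 0 then o + span r e + 40 else
      if i = 1 then o + 2 * span r e + 13 else o + 2 * span r e + 21 := by
  obtain ⟨r1, r2, r3, r4, r5, -, -⟩ := roots r e he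
  have hk : 40 ≤ span r e := by unfold span; omega
  refine ((sweep_run he sp h0 h1 h2).append (dlowP_run s (by omega) (by omega) (by omega) r4 r5 r1
    ?_ ?_ ?_ ?_)).append ?_
  · simp [sweepBound]
  · simp [sweepBound]
  · rw [sweepBound, if_neg (by omega), if_neg r4, if_pos rfl]; omega
  · rw [sweepBound, if_neg (by omega), if_neg r5, if_neg (by omega)]; omega
  · set f' : ℕ → ℕ := fun i => if i = 0 then 0 else if i = 1 then o + 11 else o + 3 with hf'
    have hr : Run f' (sweep r e false o) (sweepBound r e o 0) :=
      sweep_run he false (by simp [hf']) (by simp [hf']) fun i hi => by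
        simp only [hf']; rw [if_neg (by omega), if_neg (by omega)]
    have hq : ∀ x ∈ sweep r e false o, ∀ q ∈ x.2.qs, q ≠ 0 := by
      rintro x hx q hq rfl
      have a := hr.1.lt_of_mem hx 0 hq
      have b := hr.le_of_mem hx 0 hq
      simp [sweepBound] at b
      omega
    refine hr.mirror _ ?_ ?_ ?_ ?_
    · refine hr.label_le fun q => ?_
      unfold sweepBound; split_ifs <;> omega
    · intro x hx q hq'
      have := hq x hx q hq'
      unfold sweepBound
      split_ifs <;> omega
    · intro x hx q hq'
      have := hq x hx q hq'
      simp only [hf']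
      split_ifs <;> omega
    · intro q
      unfold sweepBound
      split_ifs <;> omega

theorem sweep_wf {r e n : ℕ} (he : e < 4) (hn : 8 + 4 * r + e ≤ n) (sp : Bool) (o : ℕ) :
    ∀ x ∈ sweep r e sp o, WF n x.2 :=
  forall_append (fast_wf (sweep_nodes_ok he hn _ (by simp [sweepNodes])) _ _ _ _ _ _ _)
    (tree_wf le_rfl he (by omega) _ _ _)

/-- The label of an early final Hadamard gate of a sweep. -/
def oddH (r e o : ℕ) : ℕ := endB r e true (o + 12)

theorem sweep_lab {r e o : ℕ} (he : e < 4) (ho : o % 16 = 0) (sp : Bool) :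
    ∀ x ∈ sweep r e sp o, Lab (oddH r e o) (o + 16 * r + 29) x ∨ x = (o + 4, hg 2) := by
  refine forall_append (fun x hx => ?_) fun x hx => Or.inl ?_
  · simp [fast, sPart, tPart] at hx
    rcases hx with rfl | rfl | rfl | rfl | rfl | rfl | rfl | rfl | rfl | rfl <;> simp [Lab] <;> omega
  · exact tree_lab he true 1 sp (by omega) (fun _ => rfl) (by ring) x hx

theorem cnt_sweep {r e : ℕ} (he : e < 4) (sp : Bool) (o : ℕ) (k : Kind) :
    cnt k (sweep r e sp o) = nodeCost 4 0 k + treeCost r e true sp k := by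
  rw [sweep, cnt_append, cnt_fast, cnt_tree he]; rfl

end Sweep

/-! ### The required costs, and the conjugation by a sweep -/

section Target

/-- The numbers of gates of the circuit with `n` controls. -/
def costs (n : ℕ) : Kind → ℕ
  | .cnot => if n % 2 = 0 then (25 * n - 60) / 2 else (25 * n - 53) / 2
  | .t => 16 * n - 48
  | .s => if n % 2 = 0 then (n - 4) / 2 else (n - 5) / 2
  | .h => if n % 2 = 0 then 9 * n - 36 else 9 * n - 37
  | .rot => 8

/-- The depths of the circuit with `n` controls. The value for the rotations, whose depth is not
prescribed, is not used. -/
def depths (n : ℕ) : Kind → ℕ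
  | .cnot => if n % 2 = 0 then 12 * n - 27 else 12 * n - 24
  | .t => 4 * n
  | .s => 1
  | .h => 4 * n - 10
  | .rot => 0

/-- A program on the qubits `0, …, n` that yields a circuit with the desired costs, and with at
most the desired depths. -/
structure Meets (n : ℕ) (L : Prog) : Prop where
  fits : Fits (fun _ => 0) L
  wf : ∀ x ∈ L, WF n x.2
  cost : ∀ k, cnt k L = costs n k
  depth : ∀ k, k ≠ .rot → ∃ A : Finset ℕ, A.card ≤ depths n k ∧ ∀ x ∈ L, x.2.kind = k → x.1 ∈ A

end Target

section Conj

theorem dlowP_mux {Q : Type*} [DecidableEq Q] [Fintype Q] {f : ℕ → Q} {n : ℕ}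
    (hf : Set.InjOn f {i | i ≤ n}) (s : Bool) (o b : ℕ) {e l : ℕ} (h2 : 2 ≤ n)
    (he : 1 ≤ e ∧ e ≤ n) (hl : 1 ≤ l ∧ l ≤ n) :
    Mux f (dlowP s o b e l) fun y => dlow s (y (f 2)) (y (f e)) (y (f l)) := by
  have h := mux_target (f := f) (L := dlowP s o b e l) hf (by
    simp [dlowP, OnTarget, h2, he.1, he.2, hl.1, hl.2])
  convert h using 2 with y
  simp only [dlowP, tmatL, tmat, dlow, quad, px, one_mul, mul_assoc]

/-- The operator that `conjP` applies to the target. -/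
noncomputable def conjF {Q : Type*} (f : ℕ → Q) (r e : ℕ) (s : Bool) (z : Q → Fin 2) :
    Matrix (Fin 2) (Fin 2) ℂ :=
  dlow s (z (f 2)) (z (f (early r e))) (z (f (late r e)))

theorem conjP_mux {Q : Type*} [DecidableEq Q] [Fintype Q] {f : ℕ → Q} {r e n : ℕ}
    (hf : Set.InjOn f {i | i ≤ n}) (he : e < 4) (hn : 8 + 4 * r + e ≤ n) (s sp : Bool) (o : ℕ) :
    Mux f (conjP r e s sp o) fun y => conjF f r e s (regMapL f (sweepNodes r e) y) := by
  obtain ⟨-, h1, h2, -, -, h3, h4⟩ := roots r e he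
  exact Mux.conj hf (sweep_nodes_ok he hn) (sweep_realizes hf he hn sp o)
    (sweep_realizes hf he hn false o)
    (dlowP_mux hf s o (o + span r e) (by omega) ⟨h1, by omega⟩ ⟨h2, by omega⟩) _

theorem dlowP_wf {n : ℕ} (s : Bool) (o b : ℕ) {e l : ℕ} (h2 : 2 ≤ n)
    (he : 1 ≤ e ∧ e ≤ n) (hl : 1 ≤ l ∧ l ≤ n) : ∀ x ∈ dlowP s o b e l, WF n x.2 := by
  have := he.1
  have := hl.1
  simp [dlowP, WF, h2, he.2, hl.2]; omega

theorem wf_invP {n Λ : ℕ} {L : Prog} (h : ∀ x ∈ L, WF n x.2) : ∀ x ∈ invP Λ L, WF n x.2 := by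
  intro x hx
  obtain ⟨y, hy, rfl⟩ := mem_invP hx
  exact (h y hy).inv

theorem conjP_wf {r e n : ℕ} (he : e < 4) (hn : 8 + 4 * r + e ≤ n) (s sp : Bool) (o : ℕ) :
    ∀ x ∈ conjP r e s sp o, WF n x.2 := by
  obtain ⟨-, h1, h2, -, -, h3, h4⟩ := roots r e he
  exact forall_append (forall_append (sweep_wf he hn sp o)
    (dlowP_wf s _ _ (by omega) ⟨h1, by omega⟩ ⟨h2, by omega⟩)) (wf_invP (sweep_wf he hn false o))

theorem cnt_conjP {r e : ℕ} (he : e < 4) (s sp : Bool) (o : ℕ) (k : Kind) :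
    cnt k (conjP r e s sp o) = 2 * nodeCost 4 0 k + treeCost r e true sp k +
      treeCost r e true false k + (match k with | .cnot => 6 | .t => 8 | .h => 2 | _ => 0) := by
  rw [conjP, cnt_append, cnt_append, cnt_invP, cnt_sweep he, cnt_sweep he]
  cases k <;> simp [dlowP, cnt_cons, cnt_nil, Ins.kind] <;> ring

/-- The labels of the Hadamard gates of a sweep. -/
def hLabels (r e o : ℕ) : Finset ℕ :=
  insert (o + 4) (insert (oddH r e o)
    ((Finset.range (3 + 2 * r + e / 2)).image fun i => o + 12 + 16 * i))

theorem card_hLabels (r e o : ℕ) : (hLabels r e o).card ≤ 5 + 2 * r + e / 2 := by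
  refine (Finset.card_insert_le _ _).trans ?_
  have h := Finset.card_insert_le (oddH r e o)
    ((Finset.range (3 + 2 * r + e / 2)).image fun i => o + 12 + 16 * i)
  have h' := Finset.card_image_le (s := Finset.range (3 + 2 * r + e / 2))
    (f := fun i => o + 12 + 16 * i)
  rw [Finset.card_range] at h'
  omega

/-- The labels of the Hadamard gates of `conjP`. -/
def hLabelsConj (r e o : ℕ) : Finset ℕ :=
  hLabels r e o ∪ (hLabels r e o).image fun l => 2 * o + 2 * span r e + 24 - l

theorem card_hLabelsConj (r e o : ℕ) : (hLabelsConj r e o).card ≤ 10 + 4 * r + 2 * (e / 2) := by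
  refine (Finset.card_union_le _ _).trans ?_
  have h := card_hLabels r e o
  have h' := Finset.card_image_le (s := hLabels r e o)
    (f := fun l => 2 * o + 2 * span r e + 24 - l)
  omega

theorem mem_hLabels {r e o l : ℕ} (hl : l % 16 = 12) (ho : o % 16 = 0) (h1 : o ≤ l)
    (h2 : l ≤ o + span r e + 4) : l ∈ hLabels r e o := by
  unfold span at h2
  simp only [hLabels, Finset.mem_insert, Finset.mem_image, Finset.mem_range]
  right; right
  exact ⟨(l - o) / 16, by omega, by omega⟩

theorem dlowP_hLabel {r e o : ℕ} (he : e < 4) (ho : o % 16 = 0) :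
    o + span r e - 4 ∈ hLabels r e o := by
  by_cases h : e % 2 = 1
  · exact mem_hLabels (by unfold span; omega) ho (by unfold span; omega) (by omega)
  · have : oddH r e o = o + span r e - 4 := by
      rw [oddH, endB_true_eq _ _ _ he, span]
      split_ifs <;> omega
    rw [← this]
    simp [hLabels]

theorem sweep_labels {r e o : ℕ} (he : e < 4) (ho : o % 16 = 0) (sp : Bool) :
    ∀ x ∈ sweep r e sp o, (x.2.kind = .t → x.1 % 8 = 0) ∧
      (x.2.kind = .h → x.1 ∈ hLabels r e o) ∧ (x.2.kind = .s → x.1 = o + 16 * r + 29) := by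
  intro x hx
  have hrun : Run (fun _ => o + 3) (sweep r e sp o) (sweepBound r e o (o + 3)) :=
    sweep_run he sp le_rfl (by omega) (fun _ _ => le_rfl)
  have hlow : ∃ q ∈ x.2.qs, o + 3 < x.1 := by
    obtain ⟨q, hq⟩ := qs_ne_nil x.2
    exact ⟨q, hq, hrun.1.lt_of_mem hx q hq⟩
  have hup : x.1 ≤ o + span r e + 4 := by
    refine hrun.label_le (fun q => ?_) x hx
    unfold sweepBound span; split_ifs <;> omega
  obtain ⟨-, -, hlow⟩ := hlow
  rcases sweep_lab he ho sp x hx with h | rfl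
  · obtain ⟨l, i⟩ := x
    cases i <;> simp [Lab, Ins.kind] at h ⊢
    · exact h
    · exact h
    · rcases h with h | h
      · exact mem_hLabels h ho (by simp at hlow; omega) hup
      · simp [hLabels, h]
  · simp [Ins.kind, hLabels]

theorem conjP_lab {r e o : ℕ} (he : e < 4) (ho : o % 16 = 0) (s sp : Bool) :
    ∀ x ∈ conjP r e s sp o, (x.2.kind = .t → x.1 % 8 = 0) ∧
      (x.2.kind = .h → x.1 ∈ hLabelsConj r e o) := by
  have hspan : span r e % 8 = 0 ∧ 40 ≤ span r e := by unfold span; omega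
  refine forall_append (forall_append (fun x hx => ?_) ?_) fun x hx => ?_
  · obtain ⟨h1, h2, -⟩ := sweep_labels he ho sp x hx
    exact ⟨h1, fun h => Finset.mem_union_left _ (h2 h)⟩
  · have h1 : o + span r e - 4 ∈ hLabelsConj r e o := Finset.mem_union_left _ (dlowP_hLabel he ho)
    have h2 : o + span r e + 28 ∈ hLabelsConj r e o := Finset.mem_union_right _
      (Finset.mem_image.2 ⟨_, dlowP_hLabel he ho, by omega⟩)
    simp [dlowP, Ins.kind, h1, h2]
    omega
  · obtain ⟨y, hy, rfl⟩ := mem_invP hx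
    obtain ⟨h1, h2, -⟩ := sweep_labels he ho false y hy
    simp only [Ins.kind_inv]
    exact ⟨fun h => by have := h1 h; omega,
      fun h => Finset.mem_union_right _ (Finset.mem_image.2 ⟨_, h2 h, rfl⟩)⟩

theorem not_mem_of_cnt_eq_zero {k : Kind} {L : Prog} (h : cnt k L = 0) {x : ℕ × Ins} (hx : x ∈ L) :
    x.2.kind ≠ k := by
  have := List.countP_eq_zero.1 h x hx
  simpa using this

theorem conjP_s {r e o : ℕ} (he : e < 4) (ho : o % 16 = 0) (s : Bool) :
    (∀ x ∈ conjP r e s true o, x.2.kind = .s → x.1 = o + 16 * r + 29) ∧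
      ∀ x ∈ conjP r e s false o, x.2.kind ≠ .s := by
  constructor
  · refine forall_append (forall_append (fun x hx => (sweep_labels he ho true x hx).2.2) ?_)
      fun x hx h => absurd h (not_mem_of_cnt_eq_zero ?_ hx)
    · simp [dlowP, Ins.kind]
    · rw [cnt_invP, cnt_sweep he]; simp [nodeCost, treeCost]
  · exact fun x hx => not_mem_of_cnt_eq_zero (by rw [cnt_conjP he]; simp [nodeCost, treeCost]) hx

end Conj

section Pad

/-- A list of instructions, each of them performed twice. -/
def echoes (l l' : ℕ) (g : ℕ → Ins) : ℕ → Prog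
  | 0 => []
  | m + 1 => echoes l l' g m ++ [(l, g m), (l', g m)]

theorem opL_echoes {Q : Type*} [DecidableEq Q] [Fintype Q] {f : ℕ → Q} (l l' : ℕ) {g : ℕ → Ins}
    (h : ∀ i, (g i).inv = g i) (m : ℕ) : opL f (echoes l l' g m) = 1 := by
  induction m with
  | zero => rfl
  | succ m ih =>
    have := opL_append_invP (f := f) (l' + l) [(l, g m)]
    simp only [invP, List.map_cons, List.map_nil, List.reverse_singleton, h, List.singleton_append,
      Nat.add_sub_cancel] at this
    rw [echoes, opL_append, ih, this, one_mul]

theorem mem_echoes {l l' : ℕ} {g : ℕ → Ins} {m : ℕ} {x : ℕ × Ins} (h : x ∈ echoes l l' g m) :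
    (x.1 = l ∨ x.1 = l') ∧ ∃ i < m, x.2 = g i := by
  induction m with
  | zero => simp [echoes] at h
  | succ m ih =>
    simp only [echoes, List.mem_append, List.mem_cons, List.not_mem_nil, or_false] at h
    rcases h with h | rfl | rfl
    · obtain ⟨a, i, hi, b⟩ := ih h
      exact ⟨a, i, by omega, b⟩
    · exact ⟨Or.inl rfl, m, by omega, rfl⟩
    · exact ⟨Or.inr rfl, m, by omega, rfl⟩

theorem cnt_echoes (k k' : Kind) (l l' : ℕ) {g : ℕ → Ins} (h : ∀ i, (g i).kind = k') (m : ℕ) :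
    cnt k (echoes l l' g m) = if k' = k then 2 * m else 0 := by
  induction m with
  | zero => simp [echoes, cnt_nil]
  | succ m ih =>
    simp only [echoes, cnt_append, ih, cnt_cons, cnt_nil, h]
    split_ifs <;> omega

theorem run_echoes {l l' : ℕ} (hl : l < l') {g : ℕ → Ins} (a w : ℕ)
    (hg : ∀ i, ∀ q ∈ (g i).qs, a + w * i ≤ q ∧ q < a + w * (i + 1)) (m : ℕ) {f : ℕ → ℕ}
    (hf : ∀ q, a ≤ q → f q < l) :
    Run f (echoes l l' g m) fun q => if a ≤ q ∧ q < a + w * m then l' else f q := by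
  induction m with
  | zero =>
    exact (run_nil f).weaken (fun _ => le_rfl) fun q => by
      split_ifs with h
      · omega
      · exact le_rfl
  | succ m ih =>
    refine ih.append ⟨⟨fun q hq => ?_, fun q hq => ?_, trivial⟩, fun q => ?_⟩
    · have := hg m q hq
      simp only
      rw [if_neg (by omega)]
      exact hf q (by omega)
    · simp only [adv] at hq ⊢
      rw [if_pos hq]
      exact hl
    · have := hg m q
      have h2 : w * (m + 1) = w * m + w := by ring
      simp only [advL, List.foldl, adv]
      rw [h2] at this ⊢
      by_cases hq : q ∈ (g m).qs
      · have := this hq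
        rw [if_pos hq, if_pos (by omega)]
      · rw [if_neg hq, if_neg hq]
        split_ifs with h3 h4 h4
        · exact le_rfl
        · omega
        · exact (hf q (by omega)).le.trans hl.le
        · exact le_rfl

end Pad

/-! ### At least eight controls -/

section Big

/-- The operator `twist` of the control `1`. -/
def twistP (l lc l' : ℕ) : Prog := [(l, tg false 0), (lc, cx 1 0), (l', tg true 0)]

/-- The part before the first conjugation. -/
def front (α β φ : ℝ) : Prog :=
  [(1, rz (-φ) 0), (2, rx (-β) 0), (3, cx 2 0)] ++ twistP 8 11 16 ++ [(17, rx (-α) 0)] ++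
    twistP 24 25 32 ++ [(33, cx 2 0)] ++ twistP 40 41 48 ++ [(49, rx α 0)]

/-- The part between the two conjugations, where `k` is the duration of a sweep. -/
def middle (α : ℝ) (k : ℕ) : Prog :=
  [(k + 73, rx (-α) 0)] ++ twistP (k + 80) (2 * k + 47) (2 * k + 48) ++ [(2 * k + 55, cx 2 0)] ++
    twistP (2 * k + 56) (2 * k + 57) (2 * k + 64) ++ [(2 * k + 65, rx α 0)] ++
    twistP (2 * k + 72) (2 * k + 73) (2 * k + 80) ++ [(2 * k + 81, cx 2 0)] ++
    twistP (2 * k + 88) (2 * k + 89) (2 * k + 96)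

/-- The part after the second conjugation. -/
def back (β φ : ℝ) (k : ℕ) : Prog :=
  twistP (3 * k + 128) (4 * k + 95) (4 * k + 96) ++
    [(4 * k + 97, rx β 0), (4 * k + 98, rz φ 0)]

/-- Pairs of `CNOT` and of `H` gates, each pair without effect, that bring the costs to the desired
values. -/
def pads (r e : ℕ) : Prog :=
  echoes 3 11 (fun i => cx (3 + 2 * i) (4 + 2 * i)) (if e % 2 = 0 then r + 1 else r + 3) ++
    echoes 12 20 (fun i => hg (3 + i)) (4 + 2 * r + e / 2)

/-- The program for `8 + 4 r + e` controls, apart from `pads`. -/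
def core (α β φ : ℝ) (r e : ℕ) : Prog :=
  front α β φ ++ conjP r e false true 32 ++ middle α (span r e) ++
    conjP r e true false (2 * span r e + 80) ++ back β φ (span r e)

section Semantics

variable {Q : Type*} [DecidableEq Q] [Fintype Q] {f : ℕ → Q} {n : ℕ}

theorem tmatL_append (y : Q → Fin 2) (L L' : Prog) :
    tmatL f y (L ++ L') = tmatL f y L' * tmatL f y L := by
  induction L with
  | nil => simp [tmatL]
  | cons x L ih => simp only [List.cons_append, tmatL, ih, mul_assoc]

theorem tmatL_twistP (y : Q → Fin 2) (l lc l' : ℕ) :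
    tmatL f y (twistP l lc l') = twist (y (f 1)) := by
  simp only [twistP, tmatL, tmat, twist, px, one_mul]

theorem opL_pads (r e : ℕ) : opL f (pads r e) = 1 := by
  rw [pads, opL_append, opL_echoes _ _ fun _ => rfl, opL_echoes _ _ fun _ => rfl, one_mul]

/-- When all controls are `1`, the word is `rotX (2 * θ)`, which `twist` turns into a rotation about the
`y`-axis, and the outermost rotations turn that into `W`. -/
theorem core_op {C : Finset Q} {W : Matrix (Fin 2) (Fin 2) ℂ} {r e : ℕ} (he : e < 4)
    (hn : n = 8 + 4 * r + e) (hf : Set.InjOn f {i | i ≤ n})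
    (hC : ∀ q, q ∈ C ↔ ∃ i, 1 ≤ i ∧ i ≤ n ∧ f i = q) {θ φ β : ℝ}
    (hW : W = rotZ φ * rotX β * quat (Real.cos θ) 0 (Real.sin θ) 0 * rotX (-β) * rotZ (-φ)) :
    opL f (core (θ / 2) β φ r e) = controlled C (f 0) W := by
  subst hn
  have m1 := mux_target (L := front (θ / 2) β φ) hf (by
    simp [front, twistP, OnTarget]; omega)
  have m2 := mux_target (L := middle (θ / 2) (span r e)) hf (by
    simp [middle, twistP, OnTarget]; omega)
  have m3 := mux_target (L := back β φ (span r e)) hf (by simp [back, twistP, OnTarget]; omega)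
  refine ((((m1.append (conjP_mux hf he le_rfl false true 32)).append m2).append
    (conjP_mux hf he le_rfl true false _)).append m3).op_eq_controlled C W fun y => ?_
  set z := regMapL f (sweepNodes r e) y with hz
  have hcomp := regMapL_comp hf (sweep_nodes_ok he le_rfl) (y := y) (z := fun i => y (f i))
    fun i _ => rfl
  obtain ⟨-, -, -, -, -, he6, hl6⟩ := roots r e he
  have key : ((y (f 1) = 1 ∧ y (f 2) = 1) ∧ z (f 2) = 0 ∧ z (f (early r e)) = 0 ∧
      z (f (late r e)) = 0) ↔ ∀ q ∈ C, y q = 1 := by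
    rw [hz, hcomp 2 (by omega), hcomp _ (by omega), hcomp _ (by omega),
      sweep_spec he fun i => y (f i)]
    constructor
    · intro h q hq
      obtain ⟨i, h1, h2, rfl⟩ := (hC q).1 hq
      exact h i h1 h2
    · exact fun h i h1 h2 => h _ ((hC _).2 ⟨i, h1, h2, rfl⟩)
  have hword := commutator_word (twist_px_twist (y (f 1)) (y (f 2)))
    (conjX_dlow (z (f 2)) (z (f (early r e))) (z (f (late r e)))) (θ / 2)
  set v := y (f 1) with hv
  set w := y (f 2) with hw
  set Dp := conjF f r e true z with hDp
  set Dm := conjF f r e false z with hDm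
  change Dp * _ * Dm * _ = _ at hword
  have hpx : (if y (f 2) = 1 then pauliX else 1) = px w := rfl
  have t2 := twist_mul_self v
  -- The word is conjugated by `twist v`, which cancels the outermost factors of the first `E`.
  have hrw : tmatL f y (back β φ (span r e)) * (Dp * (tmatL f y (middle (θ / 2) (span r e)) *
      (Dm * tmatL f y (front (θ / 2) β φ)))) =
      rotZ φ * rotX β * (twist v * (Dp * (twist v * px w * twist v * rotX (θ / 2) *
        (twist v * px w * twist v) * rotX (-(θ / 2))) * Dm * (rotX (θ / 2) *
        (twist v * px w * twist v) * rotX (-(θ / 2)) * (twist v * px w * twist v))) * twist v) *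
        rotX (-β) * rotZ (-φ) := by
    simp only [front, middle, back, tmatL_append, tmatL_twistP, tmatL, tmat, hpx, ← hv, mul_assoc,
      one_mul]
    rw [← mul_assoc (twist v) (twist v) (rotX (-β) * _), t2, one_mul]
  rw [hrw, hword]
  by_cases hall : ∀ q ∈ C, y q = 1
  · obtain ⟨⟨h1, h2⟩, h3⟩ := key.2 hall
    rw [if_pos ⟨⟨h1, h2⟩, h3⟩, if_pos hall, h1, twist_rotX, hW,
      show 4 * (θ / 2) / 2 = θ by ring]
  · rw [if_neg fun h => hall (key.1 h), if_neg hall, mul_one, t2, mul_one, mul_assoc (rotZ φ),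
      rotX_add, add_neg_cancel, rotX_zero, mul_one, rotZ_add, add_neg_cancel, rotZ_zero]

end Semantics

theorem span_mod (r e : ℕ) : span r e % 8 = 0 ∧ 40 ≤ span r e := by unfold span; omega

theorem front_run (α β φ : ℝ) : Run (fun i => if 3 ≤ i then 20 else 0) (front α β φ)
    fun i => if i = 0 then 49 else if i = 1 then 41 else 33 := by
  refine ⟨?_, fun i => ?_⟩
  · simp [front, twistP, Fits, adv, qs]
  · by_cases i0 : i = 0
    · subst i0; simp [front, twistP, advL, adv, qs]
    · by_cases i1 : i = 1
      · subst i1; simp [front, twistP, advL, adv, qs]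
      · by_cases i2 : i = 2
        · subst i2; simp [front, twistP, advL, adv, qs]
        · simp [front, twistP, advL, adv, qs, i0, i1, i2]; split_ifs <;> omega

theorem middle_run {k : ℕ} (hk : 40 ≤ k) (α : ℝ) : Run (fun i => if i = 0 then k + 72 else
    if i = 1 then 2 * k + 45 else 2 * k + 53) (middle α k)
    fun i => if i = 0 then 2 * k + 96 else if i = 1 then 2 * k + 89 else 2 * k + 81 := by
  refine ⟨?_, fun i => ?_⟩
  · simp [middle, twistP, Fits, adv, qs]; omega
  · by_cases i0 : i = 0
    · subst i0; simp [middle, twistP, advL, adv, qs]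
    · by_cases i1 : i = 1
      · subst i1; simp [middle, twistP, advL, adv, qs]
      · by_cases i2 : i = 2
        · subst i2; simp [middle, twistP, advL, adv, qs]
        · simp [middle, twistP, advL, adv, qs, i0, i1, i2]

theorem back_run {k : ℕ} (hk : 40 ≤ k) (β φ : ℝ) : Run (fun i => if i = 0 then 3 * k + 120 else
    if i = 1 then 4 * k + 93 else 4 * k + 101) (back β φ k)
    fun i => if i = 0 then 4 * k + 98 else 4 * k + 101 := by
  refine ⟨?_, fun i => ?_⟩
  · simp [back, twistP, Fits, adv, qs]; omega
  · by_cases i0 : i = 0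
    · subst i0; simp [back, twistP, advL, adv, qs]
    · by_cases i1 : i = 1
      · subst i1; simp [back, twistP, advL, adv, qs]
      · simp [back, twistP, advL, adv, qs, i0, i1]

theorem core_run {r e : ℕ} (he : e < 4) (α β φ : ℝ) :
    Run (fun i => if 3 ≤ i then 20 else 0) (core α β φ r e)
      fun i => if i = 0 then 4 * span r e + 98 else 4 * span r e + 101 := by
  obtain ⟨-, hk⟩ := span_mod r e
  have h2 : Run _ (conjP r e false true 32) fun i => if i = 0 then span r e + 72 else
      if i = 1 then 2 * span r e + 45 else 2 * span r e + 53 :=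
    (conjP_run he false true (f := fun i => if i = 0 then 49 else if i = 1 then 41 else 33)
      (by simp) (by simp) fun i hi => by split_ifs <;> omega).weaken
      (fun _ => le_rfl) fun i => by split_ifs <;> omega
  have h4 : Run _ (conjP r e true false (2 * span r e + 80)) fun i => if i = 0 then
      3 * span r e + 120 else if i = 1 then 4 * span r e + 93 else 4 * span r e + 101 :=
    (conjP_run he true false (f := fun i => if i = 0 then 2 * span r e + 96 else
      if i = 1 then 2 * span r e + 89 else 2 * span r e + 81)
      (by simp) (by simp) fun i hi => by split_ifs <;> omega).weaken
      (fun _ => le_rfl) fun i => by split_ifs <;> omega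
  exact ((((front_run α β φ).append h2).append (middle_run hk α)).append h4).append
    (back_run hk β φ)

theorem pads_run (r e : ℕ) :
    Run (fun _ => 0) (pads r e) fun i => if 3 ≤ i then 20 else 0 := by
  refine (Run.append (run_echoes (by omega) 3 2 ?_ _ (by simp))
    (run_echoes (by omega) 3 1 ?_ _ ?_)).weaken (fun _ => le_rfl) ?_
  · intro i q hq; simp [qs] at hq; omega
  · intro i q hq; simp [qs] at hq; omega
  · intro q hq; split_ifs <;> omega
  · intro q; split_ifs <;> omega

theorem big_run {r e : ℕ} (he : e < 4) (α β φ : ℝ) :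
    Run (fun _ => 0) (pads r e ++ core α β φ r e)
      fun i => if i = 0 then 4 * span r e + 98 else 4 * span r e + 101 :=
  (pads_run r e).append (core_run he α β φ)

theorem cnt_core {r e : ℕ} (he : e < 4) (α β φ : ℝ) (k : Kind) :
    cnt k (core α β φ r e) = (match k with | .cnot => 12 | .t => 16 | .rot => 8 | _ => 0) +
      (cnt k (conjP r e false true 32) + cnt k (conjP r e true false 32)) := by
  simp only [core, cnt_append, cnt_conjP he]
  cases k <;> simp [front, middle, back, twistP, cnt_cons, cnt_append, cnt_nil, Ins.kind] <;> ring

theorem cnt_big {r e : ℕ} (he : e < 4) (α β φ : ℝ) (k : Kind) :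
    cnt k (pads r e ++ core α β φ r e) = costs (8 + 4 * r + e) k := by
  rw [cnt_append, cnt_core he, cnt_conjP he, cnt_conjP he, pads, cnt_append,
    cnt_echoes k .cnot _ _ fun _ => rfl, cnt_echoes k .h _ _ fun _ => rfl]
  rcases (show e = 0 ∨ e = 1 ∨ e = 2 ∨ e = 3 by omega) with rfl | rfl | rfl | rfl <;>
    cases k <;> simp [nodeCost, treeCost, costs] <;> (try split_ifs) <;> omega

theorem big_wf {r e : ℕ} (he : e < 4) (α β φ : ℝ) :
    ∀ x ∈ pads r e ++ core α β φ r e, WF (8 + 4 * r + e) x.2 := by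
  have hn : 8 + 4 * r + e ≤ 8 + 4 * r + e := le_rfl
  refine forall_append (forall_append ?_ ?_) (forall_append (forall_append (forall_append
    (forall_append ?_ (conjP_wf he hn _ _ _)) ?_) (conjP_wf he hn _ _ _)) ?_)
  · intro x hx
    obtain ⟨-, i, hi, h⟩ := mem_echoes hx
    rw [h]
    split_ifs at hi <;> simp only [WF] <;> omega
  · intro x hx
    obtain ⟨-, i, hi, h⟩ := mem_echoes hx
    rw [h]
    simp only [WF]; omega
  · simp [front, twistP, WF]; omega
  · simp [middle, twistP, WF]; omega
  · simp [back, twistP, WF]; omega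

theorem big_lab {r e : ℕ} (he : e < 4) (α β φ : ℝ) :
    ∀ x ∈ pads r e ++ core α β φ r e, (x.2.kind = .t → x.1 % 8 = 0) ∧
      (x.2.kind = .s → x.1 = 16 * r + 61) ∧
      (x.2.kind = .h → x.1 ∈ {12, 20} ∪ (hLabelsConj r e 32 ∪ hLabelsConj r e (2 * span r e + 80))) ∧
      (x.2.kind = .cnot → x ∈ core α β φ r e ∨ x.1 = 3 ∨ x.1 = 11) := by
  obtain ⟨hm, -⟩ := span_mod r e
  have hm' : (2 * span r e + 80) % 16 = 0 := by omega
  refine forall_append (forall_append ?_ ?_) fun x hx => ?_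
  · intro x hx
    obtain ⟨h1, i, hi, h⟩ := mem_echoes hx
    rw [h]
    simp [Ins.kind, h1]
  · intro x hx
    obtain ⟨h1, i, hi, h⟩ := mem_echoes hx
    rw [h]
    simp [Ins.kind]
    tauto
  · suffices h : (x.2.kind = .t → x.1 % 8 = 0) ∧ (x.2.kind = .s → x.1 = 16 * r + 61) ∧
      (x.2.kind = .h → x.1 ∈ {12, 20} ∪ (hLabelsConj r e 32 ∪ hLabelsConj r e (2 * span r e + 80))) from
      ⟨h.1, h.2.1, h.2.2, fun _ => Or.inl hx⟩
    revert x
    refine forall_append (forall_append (forall_append (forall_append ?_ fun x hx => ?_) ?_)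
      fun x hx => ?_) ?_
    · simp [front, twistP, Ins.kind]
    · obtain ⟨h1, h2⟩ := conjP_lab he (by norm_num) false true x hx
      refine ⟨h1, fun h => ?_, fun h => ?_⟩
      · have := (conjP_s he (by norm_num) false).1 x hx h
        omega
      · simp [h2 h]
    · simp [middle, twistP, Ins.kind]; omega
    · obtain ⟨h1, h2⟩ := conjP_lab he hm' true false x hx
      refine ⟨h1, fun h => absurd h ((conjP_s he hm' true).2 x hx), fun h => ?_⟩
      simp [h2 h]
    · simp [back, twistP, Ins.kind]; omega

theorem big_meets {r e : ℕ} (he : e < 4) (α β φ : ℝ) :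
    Meets (8 + 4 * r + e) (pads r e ++ core α β φ r e) := by
  have hrun := big_run (r := r) he α β φ
  refine ⟨hrun.1, big_wf he α β φ, cnt_big he α β φ, fun k hk => ?_⟩
  have hl := big_lab (r := r) he α β φ
  cases k with
  | cnot =>
    -- The padding gates have labels at which `core` has `CNOT` gates as well.
    refine ⟨(((core α β φ r e).filter fun x => x.2.kind = .cnot).map Prod.fst).toFinset, ?_,
      fun x hx hk => ?_⟩
    · refine (List.toFinset_card_le _).trans ?_
      rw [List.length_map, ← List.countP_eq_length_filter]
      have h : cnt .cnot (core α β φ r e) ≤ depths (8 + 4 * r + e) .cnot := by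
        rw [cnt_core he, cnt_conjP he, cnt_conjP he]
        simp only [nodeCost, treeCost, depths]
        simp
        split_ifs <;> omega
      exact h
    · have hcore : ∀ y ∈ core α β φ r e, y.2.kind = .cnot → y.1 ∈ (((core α β φ r e).filter
          fun x => x.2.kind = .cnot).map Prod.fst).toFinset := fun y hy hk => by
        rw [List.mem_toFinset, List.mem_map]
        exact ⟨y, by simp [hy, hk], rfl⟩
      rcases (hl x hx).2.2.2 hk with h | h | h
      · exact hcore x h hk
      · rw [h]
        exact hcore (3, cx 2 0) (by simp [core, front]) rfl
      · rw [h]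
        exact hcore (11, cx 1 0) (by simp [core, front, twistP]) rfl
  | t =>
    refine ⟨(Finset.Icc 1 (4 * (8 + 4 * r + e))).image (8 * ·), ?_, fun x hx hk => ?_⟩
    · exact Finset.card_image_le.trans (by simp [depths])
    · have h1 := (hl x hx).1 hk
      obtain ⟨q, hq⟩ := qs_ne_nil x.2
      have h2 := hrun.1.lt_of_mem hx q hq
      have h3 := hrun.label_le (B := 4 * span r e + 101) (fun q => by split_ifs <;> omega) x hx
      unfold span at h3
      exact Finset.mem_image.2 ⟨x.1 / 8, Finset.mem_Icc.2 ⟨by omega, by omega⟩, by omega⟩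
  | s =>
    exact ⟨{16 * r + 61}, by simp [depths], fun x hx hk => by simp [(hl x hx).2.1 hk]⟩
  | h =>
    refine ⟨_, ?_, fun x hx hk => (hl x hx).2.2.1 hk⟩
    refine (Finset.card_union_le _ _).trans ?_
    have h1 := Finset.card_union_le (hLabelsConj r e 32) (hLabelsConj r e (2 * span r e + 80))
    have h2 := card_hLabelsConj r e 32
    have h3 := card_hLabelsConj r e (2 * span r e + 80)
    have h4 : ({12, 20} : Finset ℕ).card = 2 := rfl
    simp only [depths]
    omega
  | rot => exact absurd rfl hk

end Big

/-! ### Six and seven controls -/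

section Check

/-- The part of a program on which its feasibility and its costs depend. -/
def shape (L : Prog) : List (ℕ × Kind × List ℕ) := L.map fun x => (x.1, x.2.kind, x.2.qs)

/-- A decision procedure for `Fits`. -/
def fitsCheck : (ℕ → ℕ) → List (ℕ × Kind × List ℕ) → Bool
  | _, [] => true
  | f, x :: L =>
    (x.2.2.all fun q => decide (f q < x.1)) && fitsCheck (fun q => if q ∈ x.2.2 then x.1 else f q) L

theorem fits_of_check {f : ℕ → ℕ} {L : Prog} (h : fitsCheck f (shape L) = true) : Fits f L := by
  induction L generalizing f with
  | nil => trivial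
  | cons x L ih =>
    simp only [shape, List.map_cons, fitsCheck, Bool.and_eq_true, List.all_eq_true,
      decide_eq_true_eq] at h
    exact ⟨h.1, ih h.2⟩

theorem wf_of_qs {n : ℕ} {i : Ins} (h : (∀ q ∈ i.qs, q ≤ n) ∧ i.qs.Nodup) : WF n i := by
  cases i <;> simp [qs, WF] at * <;> tauto

/-- A decidable condition on the shape of a program that implies `Meets`. -/
def Checks (n : ℕ) (S : List (ℕ × Kind × List ℕ)) : Prop :=
  fitsCheck (fun _ => 0) S = true ∧
  (∀ x ∈ S, (∀ q ∈ x.2.2, q ≤ n) ∧ x.2.2.Nodup) ∧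
  (∀ k ∈ [Kind.cnot, .t, .s, .h, .rot], S.countP (fun x => decide (x.2.1 = k)) = costs n k) ∧
  ∀ k ∈ [Kind.cnot, .t, .s, .h],
    ((S.filter fun x => decide (x.2.1 = k)).map Prod.fst).dedup.length ≤ depths n k

instance (n : ℕ) (S : List (ℕ × Kind × List ℕ)) : Decidable (Checks n S) := by
  unfold Checks; infer_instance

theorem meets_of_checks {n : ℕ} {L : Prog} (h : Checks n (shape L)) : Meets n L := by
  obtain ⟨h1, h2, h3, h4⟩ := h
  refine ⟨fits_of_check h1, fun x hx => wf_of_qs (h2 _ (List.mem_map.2 ⟨x, hx, rfl⟩)),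
    fun k => ?_, fun k hk => ?_⟩
  · have := h3 k (by cases k <;> simp)
    rwa [shape, List.countP_map] at this
  · refine ⟨(((shape L).filter fun x => decide (x.2.1 = k)).map Prod.fst).toFinset, ?_,
      fun x hx hxk => ?_⟩
    · rw [List.card_toFinset]
      exact h4 k (by cases k <;> simp at *)
    · rw [List.mem_toFinset, List.mem_map]
      exact ⟨(x.1, x.2.kind, x.2.qs), List.mem_filter.2 ⟨List.mem_map.2 ⟨x, hx, rfl⟩, by simp [hxk]⟩,
        rfl⟩

end Check

section Word

/-- The commutator word with a controlled `Z` gate, given the two conjugations `A` and `B`, from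
which Hadamard gates on the qubit `1` are removed at both ends. -/
def wordP (α β φ : ℝ) (b Λ : ℕ) (A B : Prog) : Prog :=
  [(1, rx (-β) 0), (2, rz (-φ) 0), (4, hg 1), (5, cx 0 1), (6, rx (-α) 0), (7, cx 0 1),
    (8, rx α 0)] ++ A ++ [(b, rx (-α) 0), (Λ + 2, cx 0 1), (Λ + 3, rx α 0), (Λ + 4, cx 0 1)] ++ B ++
    [(2 * Λ, hg 1), (2 * Λ + 1, rz φ 0), (2 * Λ + 2, rx β 0)]

variable {Q : Type*} [DecidableEq Q] [Fintype Q] {f : ℕ → Q} {n : ℕ}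

/-- A `CNOT` gate from the target to the qubit `1`, between Hadamard gates, is a controlled `Z` gate. -/
theorem cz_mux (hf : f 0 ≠ f 1) (l l' l'' : ℕ) : Mux f [(l, hg 1), (l', cx 0 1), (l'', hg 1)]
    fun y => if y (f 1) = 1 then pauliZ else 1 := by
  refine ⟨fun y => ?_, fun y v => by rw [update_of_ne hf.symm]⟩
  have h2 := hamp_mul_self
  have hy := update_eq_self (f 1) y
  have hy0 := update_eq_self (f 0) y
  simp only [opL_cons_ket, opL_nil, one_mulVec, hg_ket, cx_ket f hf, mulVec_smul, mulVec_add,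
    update_of_ne hf, update_self, update_idem, Fin.sum_univ_two]
  rcases fin2_cases (y (f 0)) with h0 | h0 <;> rcases fin2_cases (y (f 1)) with h1 | h1 <;>
    rw [h0] at hy0 ⊢ <;> rw [h1] at hy ⊢ <;>
    simp [sgn, pauliZ, hy, hy0, smul_smul] <;>
    match_scalars <;> first | ring1 | linear_combination 2 * h2 | linear_combination -2 * h2

theorem commute_hg_rx (hf : f 0 ≠ f 1) (θ : ℝ) :
    ((rx θ 0).gate f).op * ((hg 1).gate f).op = ((hg 1).gate f).op * ((rx θ 0).gate f).op :=
  Gate.commute (by simp [gate, Gate.qubits, hf])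

/-- The pairs of Hadamard gates that are missing in `wordP` cancel each other. -/
theorem opL_wordP (hf : f 0 ≠ f 1) (α β φ : ℝ) (b Λ a a' c c' : ℕ) (A B : Prog) :
    opL f (wordP α β φ b Λ A B) = opL f ([(1, rx (-β) 0), (2, rz (-φ) 0)] ++
      [(4, hg 1), (5, cx 0 1), (5, hg 1)] ++ [(6, rx (-α) 0)] ++
      [(6, hg 1), (7, cx 0 1), (7, hg 1)] ++ [(8, rx α 0)] ++ ([(a, hg 1)] ++ A ++ [(a', hg 1)]) ++
      [(b, rx (-α) 0)] ++ [(Λ, hg 1), (Λ + 2, cx 0 1), (Λ + 2, hg 1)] ++ [(Λ + 3, rx α 0)] ++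
      [(Λ + 3, hg 1), (Λ + 4, cx 0 1), (Λ + 4, hg 1)] ++ ([(c, hg 1)] ++ B ++ [(c', hg 1)]) ++
      [(2 * Λ + 1, rz φ 0), (2 * Λ + 2, rx β 0)]) := by
  have hH : ((hg 1).gate f).op * ((hg 1).gate f).op = 1 := inv_op_mul_op (f := f) (hg 1)
  have hc := commute_hg_rx hf α
  have hc' := commute_hg_rx hf (-α)
  simp only [wordP, opL_append, opL_cons, opL_nil, one_mul]
  generalize ((hg 1).gate f).op = H at *
  generalize ((rx α 0).gate f).op = R at *
  generalize ((rx (-α) 0).gate f).op = R' at *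
  have hH' : ∀ X, H * (H * X) = X := fun X => by rw [← mul_assoc, hH, one_mul]
  have hR : ∀ X, R * (H * X) = H * (R * X) := fun X => by rw [← mul_assoc, hc, mul_assoc]
  have hR' : ∀ X, R' * (H * X) = H * (R' * X) := fun X => by rw [← mul_assoc, hc', mul_assoc]
  simp only [mul_assoc, hH', hR, hR']

/-- The word implements the multi-controlled `W` if the control `1`, together with the condition `P`
under which `D` inverts `rotX`, expresses that all controls are `1`. -/
theorem wordP_op {A B : Prog} (hf : Set.InjOn f {i | i ≤ n}) (hn : 1 ≤ n) {a a' c c' : ℕ}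
    {C : Finset Q} {W : Matrix (Fin 2) (Fin 2) ℂ} {Dm Dp : (Q → Fin 2) → Matrix (Fin 2) (Fin 2) ℂ}
    (hA : Mux f ([(a, hg 1)] ++ A ++ [(a', hg 1)]) Dm)
    (hB : Mux f ([(c, hg 1)] ++ B ++ [(c', hg 1)]) Dp) {α φ β : ℝ}
    (hW : W = rotX β * rotZ φ * rotX (4 * α) * rotZ (-φ) * rotX (-β))
    {P : (Q → Fin 2) → Prop} [∀ y, Decidable (P y)] (hD : ∀ y, ConjX (Dp y) (Dm y) (P y))
    (hP : ∀ y, (y (f 1) = 1 ∧ P y) ↔ ∀ q ∈ C, y q = 1) (b Λ : ℕ) :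
    opL f (wordP α β φ b Λ A B) = controlled C (f 0) W := by
  have h01 : f 0 ≠ f 1 := f_ne hf (by omega) hn (by omega)
  rw [opL_wordP h01 α β φ b Λ a a' c c']
  have hr : ∀ θ l, Mux f [(l, rx θ 0)] fun _ => rotX θ := fun θ l =>
    mux_single hf (x := (l, rx θ 0)) rfl
  have hfront : Mux f [(1, rx (-β) 0), (2, rz (-φ) 0)] fun _ => rotZ (-φ) * rotX (-β) :=
    (hr _ 1).append (mux_single hf (x := (2, rz (-φ) 0)) rfl)
  have hback : Mux f [(2 * Λ + 1, rz φ 0), (2 * Λ + 2, rx β 0)] fun _ => rotX β * rotZ φ :=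
    (mux_single hf (x := (2 * Λ + 1, rz φ 0)) rfl).append (hr _ _)
  refine (((((((((((hfront.append (cz_mux h01 _ _ _)).append
    (hr _ _)).append (cz_mux h01 _ _ _)).append (hr _ _)).append hA).append (hr _ _)).append
    (cz_mux h01 _ _ _)).append (hr _ _)).append (cz_mux h01 _ _ _)).append hB).append
    hback).op_eq_controlled C W fun y => ?_
  have hE : ConjX (if y (f 1) = 1 then pauliZ else 1) (if y (f 1) = 1 then pauliZ else 1)
      (y (f 1) = 1) := by
    by_cases h : y (f 1) = 1
    · exact conjX_pauliZ.congr (by simp [h]) (by simp [h]) (by simp [h])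
    · intro θ; simp [h]
  have hword := commutator_word hE (hD y) α
  generalize (if y (f 1) = 1 then pauliZ else 1) = E at *
  calc _ = rotX β * rotZ φ * (Dp y * (E * rotX α * E * rotX (-α)) * Dm y *
        (rotX α * E * rotX (-α) * E)) * rotZ (-φ) * rotX (-β) := by
        simp only [mul_assoc]
    _ = _ := by
      rw [hword]
      by_cases hall : ∀ q ∈ C, y q = 1
      · rw [if_pos ((hP y).2 hall), if_pos hall, hW]
      · rw [if_neg fun h => hall ((hP y).1 h), if_neg hall, mul_one, mul_assoc (rotX β),
          rotZ_add, add_neg_cancel, rotZ_zero, mul_one, rotX_add, add_neg_cancel, rotX_zero]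

end Word

section Six

/-- The node that acts on the qubit `1`. -/
def node1 : Node := ⟨1, 3, 2, true, true⟩

/-- The node that acts on the qubit `2`. -/
def node2 : Node := ⟨2, 5, 4, true, true⟩

/-- The node that acts on the qubit `3`, for seven controls. -/
def node3 : Node := ⟨3, 7, 6, true, true⟩

theorem one_add_flip (b c a : ℕ) (va vc : Fin 2) :
    1 + (⟨b, c, a, true, true⟩ : Node).flip va vc = 0 ↔ va = 1 ∧ vc = 1 := by
  rcases fin2_cases va with rfl | rfl <;> rcases fin2_cases vc with rfl | rfl <;>
    simp [Node.flip, act]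

/-- The first node of the sweeps for six and seven controls. -/
def firstNode (sp : Bool) (o : ℕ) : Prog :=
  slow node1 (o + 4) (o + 8) (o + 17) (o + 24) none (sLab sp (o + 21))

/-- A variant of `firstNode` with four `CNOT` gates. -/
def firstNodeFast (x : ℕ) (o : ℕ) : Prog :=
  fast node1 (o + 4) (o + 8) (o + x) (o + x + 7) (o + 36) none none

/-- The second half of the sweep for six controls. -/
def second6 (o : ℕ) : Prog :=
  fast node2 (o + 20) (o + 24) (o + 30) (o + 32) (o + 36) none none

/-- The second half of the sweep for seven controls. -/
def second7 (o : ℕ) : Prog :=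
  fast node2 (o + 20) (o + 24) (o + 25) (o + 32) (o + 36) none none ++
    fast node3 (o + 28) (o + 32) (o + 38) (o + 40) (o + 44) none none

/-- The operator on the target between two sweeps, for six controls. -/
def dhighP (s : Bool) (o : ℕ) : Prog :=
  [(o + 8, tg false 0), (o + 9, cx 6 0), (o + 16, tg true 0), (o + 20, hg 0), (o + 32, tg s 0),
    (o + 38, cx 1 0), (o + 40, tg s 0), (o + 46, cx 2 0), (o + 48, tg s 0), (o + 49, cx 1 0),
    (o + 56, tg s 0), (o + 57, cx 2 0), (o + 60, hg 0), (o + 64, tg false 0), (o + 65, cx 6 0),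
    (o + 72, tg true 0)]

/-- The operator on the target between two sweeps, for seven controls. -/
def dlowP7 (s : Bool) (o : ℕ) : Prog :=
  [(o + 8, tg false 0), (o + 39, cx 1 0), (o + 40, tg false 0), (o + 44, hg 0), (o + 46, cx 2 0),
    (o + 48, tg s 0), (o + 54, cx 3 0), (o + 56, tg s 0), (o + 57, cx 2 0), (o + 64, tg s 0),
    (o + 65, cx 3 0), (o + 72, tg s 0), (o + 76, hg 0), (o + 80, tg true 0), (o + 81, cx 1 0),
    (o + 88, tg true 0)]

/-- The program for six controls. -/
def prog6 (α β φ : ℝ) : Prog :=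
  wordP α β φ 81 96
    (((firstNode true 8).tail ++ second6 8) ++ dhighP false 8 ++
      invP 112 ((firstNodeFast 17 8).tail ++ second6 8))
    (((firstNode false 96).tail ++ second6 96) ++ dhighP true 96 ++
      invP 288 ((firstNode false 96).tail ++ second6 96))

/-- The program for seven controls. -/
def prog7 (α β φ : ℝ) : Prog :=
  wordP α β φ 97 120
    (((firstNode true 8).tail ++ second7 8) ++ dlowP7 false 8 ++
      invP 136 ((firstNodeFast 9 8).tail ++ second7 8))
    (((firstNode false 120).tail ++ second7 120) ++ dlowP7 true 120 ++
      invP 360 ((firstNode false 120).tail ++ second7 120))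

set_option maxRecDepth 4000 in
theorem shape_prog6 (α β φ : ℝ) : shape (prog6 α β φ) = shape (prog6 0 0 0) := rfl

set_option maxRecDepth 4000 in
theorem shape_prog7 (α β φ : ℝ) : shape (prog7 α β φ) = shape (prog7 0 0 0) := rfl

theorem meets_prog6 (α β φ : ℝ) : Meets 6 (prog6 α β φ) :=
  meets_of_checks (by rw [shape_prog6]; decide +kernel)

theorem meets_prog7 (α β φ : ℝ) : Meets 7 (prog7 α β φ) :=
  meets_of_checks (by rw [shape_prog7]; decide +kernel)

section Semantics

variable {Q : Type*} [DecidableEq Q] [Fintype Q] {f : ℕ → Q} {n : ℕ}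

/-- A conjugation without the outermost Hadamard gates on the qubit `1`. -/
theorem tail_conj (hf : Set.InjOn f {i | i ≤ n}) {K J K' J' D : Prog} {l l' : ℕ} {Ns : List Node}
    {F : (Q → Fin 2) → Matrix (Fin 2) (Fin 2) ℂ} (hN : ∀ N ∈ Ns, N.Ok n)
    (hK : Realizes f ((l, hg 1) :: K ++ K') Ns) (hJ : Realizes f ((l', hg 1) :: J ++ J') Ns)
    (hD : Mux f D F) (Λ : ℕ) :
    Mux f ([(l, hg 1)] ++ ((K ++ K') ++ D ++ invP Λ (J ++ J')) ++ [(Λ - l', hg 1)])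
      fun y => F (regMapL f Ns y) := by
  have h := Mux.conj hf hN hK hJ hD Λ
  have e : (l, hg 1) :: K ++ K' ++ D ++ invP Λ ((l', hg 1) :: J ++ J') =
      [(l, hg 1)] ++ ((K ++ K') ++ D ++ invP Λ (J ++ J')) ++ [(Λ - l', hg 1)] := by
    simp [invP, Ins.inv]
  rwa [e] at h

theorem dhighP_mux (hf : Set.InjOn f {i | i ≤ n}) (hn : 6 ≤ n) (s : Bool) (o : ℕ) :
    Mux f (dhighP s o) fun y => dhigh s (y (f 6)) (y (f 1)) (y (f 2)) := by
  have h := mux_target (f := f) (L := dhighP s o) hf (by simp [dhighP, OnTarget]; omega)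
  convert h using 2 with y
  simp only [dhighP, tmatL, tmat, dhigh, quad', twist, px, one_mul, mul_assoc]

theorem dlowP7_mux (hf : Set.InjOn f {i | i ≤ n}) (hn : 3 ≤ n) (s : Bool) (o : ℕ) :
    Mux f (dlowP7 s o) fun y => dlow s (y (f 1)) (y (f 2)) (y (f 3)) := by
  have h := mux_target (f := f) (L := dlowP7 s o) hf (by simp [dlowP7, OnTarget]; omega)
  convert h using 2 with y
  simp only [dlowP7, tmatL, tmat, dlow, quad, px, one_mul, mul_assoc]

theorem prog6_op (hf : Set.InjOn f {i | i ≤ 6}) {C : Finset Q}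
    (hC : ∀ q, q ∈ C ↔ ∃ i, 1 ≤ i ∧ i ≤ 6 ∧ f i = q) {W : Matrix (Fin 2) (Fin 2) ℂ} {α φ β : ℝ}
    (hW : W = rotX β * rotZ φ * rotX (4 * α) * rotZ (-φ) * rotX (-β)) :
    opL f (prog6 α β φ) = controlled C (f 0) W := by
  have hok : ∀ N ∈ [node1, node2], N.Ok 6 := by decide
  have d1 := (hok node1 (by simp)).distinct hf
  have d2 := (hok node2 (by simp)).distinct hf
  have r1 : ∀ sp o, Realizes f (firstNode sp o ++ second6 o) [node1, node2] := fun sp o =>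
    (slow_realizes d1 _ _ _ _ _ _).realizes.append (fast_realizes d2 _ _ _ _ _ _ _).realizes
  have r2 : ∀ x o, Realizes f (firstNodeFast x o ++ second6 o) [node1, node2] := fun x o =>
    (fast_realizes d1 _ _ _ _ _ _ _).realizes.append (fast_realizes d2 _ _ _ _ _ _ _).realizes
  refine wordP_op hf (by omega)
    (tail_conj hf hok (l := 12) (l' := 12) (r1 true 8) (r2 17 8) (dhighP_mux hf le_rfl false 8) 112)
    (tail_conj hf hok (l := 100) (l' := 100) (r1 false 96) (r1 false 96)
      (dhighP_mux hf le_rfl true 96) 288) hW (fun y => conjX_dhigh _ _ _) (fun y => ?_) 81 96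
  have hcomp := regMapL_comp hf hok (y := y) (z := fun i => y (f i)) fun i _ => rfl
  rw [hcomp 6 (by omega), hcomp 1 (by omega), hcomp 2 (by omega)]
  have key : ∀ z : ℕ → Fin 2, (z 1 = 1 ∧ mapL [node1, node2] z 6 = 1 ∧
      mapL [node1, node2] z 1 = 0 ∧ mapL [node1, node2] z 2 = 0) ↔ ∀ i, 1 ≤ i → i ≤ 6 → z i = 1 := by
    intro z
    have h6 : mapL [node1, node2] z 6 = z 6 := rfl
    have h1 : mapL [node1, node2] z 1 = z 1 + node1.flip (z 2) (z 3) := rfl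
    have h2 : mapL [node1, node2] z 2 = z 2 + node2.flip (z 4) (z 5) := rfl
    rw [h6, h1, h2]
    have e : (∀ i, 1 ≤ i → i ≤ 6 → z i = 1) ↔
        (z 1 = 1 ∧ z 2 = 1 ∧ z 3 = 1 ∧ z 4 = 1 ∧ z 5 = 1 ∧ z 6 = 1) := by
      constructor
      · intro h; refine ⟨?_, ?_, ?_, ?_, ?_, ?_⟩ <;> exact h _ (by omega) (by omega)
      · rintro ⟨h1, h2, h3, h4, h5, h6⟩ i hi hi'
        interval_cases i <;> assumption
    rw [e]
    have e1 := one_add_flip 1 3 2 (z 2) (z 3)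
    have e2 := one_add_flip 2 5 4 (z 4) (z 5)
    constructor
    · rintro ⟨h1, h6, a1, a2⟩
      rw [h1] at a1
      obtain ⟨h2, h3⟩ := e1.1 a1
      rw [h2] at a2
      obtain ⟨h4, h5⟩ := e2.1 a2
      exact ⟨h1, h2, h3, h4, h5, h6⟩
    · rintro ⟨h1, h2, h3, h4, h5, h6⟩
      exact ⟨h1, h6, by rw [h1]; exact e1.2 ⟨h2, h3⟩, by rw [h2]; exact e2.2 ⟨h4, h5⟩⟩
  refine (key fun i => y (f i)).trans ?_
  constructor
  · intro h q hq
    obtain ⟨i, h1, h2, rfl⟩ := (hC q).1 hq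
    exact h i h1 h2
  · exact fun h i h1 h2 => h _ ((hC _).2 ⟨i, h1, h2, rfl⟩)

theorem prog7_op (hf : Set.InjOn f {i | i ≤ 7}) {C : Finset Q}
    (hC : ∀ q, q ∈ C ↔ ∃ i, 1 ≤ i ∧ i ≤ 7 ∧ f i = q) {W : Matrix (Fin 2) (Fin 2) ℂ} {α φ β : ℝ}
    (hW : W = rotX β * rotZ φ * rotX (4 * α) * rotZ (-φ) * rotX (-β)) :
    opL f (prog7 α β φ) = controlled C (f 0) W := by
  have hok : ∀ N ∈ [node1, node2, node3], N.Ok 7 := by decide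
  have d1 := (hok node1 (by simp)).distinct hf
  have d2 := (hok node2 (by simp)).distinct hf
  have d3 := (hok node3 (by simp)).distinct hf
  have r0 : ∀ o, Realizes f (second7 o) [node2, node3] := fun o =>
    (fast_realizes d2 _ _ _ _ _ _ _).realizes.append (fast_realizes d3 _ _ _ _ _ _ _).realizes
  have r1 : ∀ sp o, Realizes f (firstNode sp o ++ second7 o) [node1, node2, node3] := fun sp o =>
    (slow_realizes d1 _ _ _ _ _ _).realizes.append (r0 o)
  have r2 : ∀ x o, Realizes f (firstNodeFast x o ++ second7 o) [node1, node2, node3] := fun x o =>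
    (fast_realizes d1 _ _ _ _ _ _ _).realizes.append (r0 o)
  refine wordP_op hf (by omega)
    (tail_conj hf hok (l := 12) (l' := 12) (r1 true 8) (r2 9 8)
      (dlowP7_mux hf (by omega) false 8) 136)
    (tail_conj hf hok (l := 124) (l' := 124) (r1 false 120) (r1 false 120)
      (dlowP7_mux hf (by omega) true 120) 360) hW (fun y => conjX_dlow _ _ _) (fun y => ?_) 97 120
  have hcomp := regMapL_comp hf hok (y := y) (z := fun i => y (f i)) fun i _ => rfl
  rw [hcomp 1 (by omega), hcomp 2 (by omega), hcomp 3 (by omega)]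
  have key : ∀ z : ℕ → Fin 2, (z 1 = 1 ∧ mapL [node1, node2, node3] z 1 = 0 ∧
      mapL [node1, node2, node3] z 2 = 0 ∧ mapL [node1, node2, node3] z 3 = 0) ↔
      ∀ i, 1 ≤ i → i ≤ 7 → z i = 1 := by
    intro z
    have h1 : mapL [node1, node2, node3] z 1 = z 1 + node1.flip (z 2) (z 3) := rfl
    have h2 : mapL [node1, node2, node3] z 2 = z 2 + node2.flip (z 4) (z 5) := rfl
    have h3 : mapL [node1, node2, node3] z 3 = z 3 + node3.flip (z 6) (z 7) := rfl
    rw [h1, h2, h3]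
    have e : (∀ i, 1 ≤ i → i ≤ 7 → z i = 1) ↔
        (z 1 = 1 ∧ z 2 = 1 ∧ z 3 = 1 ∧ z 4 = 1 ∧ z 5 = 1 ∧ z 6 = 1 ∧ z 7 = 1) := by
      constructor
      · intro h; refine ⟨?_, ?_, ?_, ?_, ?_, ?_, ?_⟩ <;> exact h _ (by omega) (by omega)
      · rintro ⟨h1, h2, h3, h4, h5, h6, h7⟩ i hi hi'
        interval_cases i <;> assumption
    rw [e]
    have e1 := one_add_flip 1 3 2 (z 2) (z 3)
    have e2 := one_add_flip 2 5 4 (z 4) (z 5)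
    have e3 := one_add_flip 3 7 6 (z 6) (z 7)
    constructor
    · rintro ⟨h1, a1, a2, a3⟩
      rw [h1] at a1
      obtain ⟨h2, h3⟩ := e1.1 a1
      rw [h2] at a2
      obtain ⟨h4, h5⟩ := e2.1 a2
      rw [h3] at a3
      obtain ⟨h6, h7⟩ := e3.1 a3
      exact ⟨h1, h2, h3, h4, h5, h6, h7⟩
    · rintro ⟨h1, h2, h3, h4, h5, h6, h7⟩
      exact ⟨h1, by rw [h1]; exact e1.2 ⟨h2, h3⟩, by rw [h2]; exact e2.2 ⟨h4, h5⟩,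
        by rw [h3]; exact e3.2 ⟨h6, h7⟩⟩
  refine (key fun i => y (f i)).trans ?_
  constructor
  · intro h q hq
    obtain ⟨i, h1, h2, rfl⟩ := (hC q).1 hq
    exact h i h1 h2
  · exact fun h i h1 h2 => h _ ((hC _).2 ⟨i, h1, h2, rfl⟩)

end Semantics

end Six

/-! ### The circuit of a program -/

section Final

variable {Q : Type*} [DecidableEq Q] [Fintype Q] {f : ℕ → Q} {n : ℕ}

/-- For each number `n` of controls there is a program with the desired costs. -/
theorem exists_meets (hn : 6 ≤ n) (hf : Set.InjOn f {i | i ≤ n}) {C : Finset Q}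
    (hC : ∀ q, q ∈ C ↔ ∃ i, 1 ≤ i ∧ i ≤ n ∧ f i = q) {W : Matrix (Fin 2) (Fin 2) ℂ}
    (hW : W ∈ specialUnitaryGroup (Fin 2) ℂ) :
    ∃ L, opL f L = controlled C (f 0) W ∧ Meets n L := by
  rcases (show n = 6 ∨ n = 7 ∨ 8 ≤ n by omega) with rfl | rfl | h8
  · obtain ⟨α, φ, β, h⟩ := exists_rotX_conj hW
    exact ⟨prog6 α β φ, prog6_op hf hC h, meets_prog6 α β φ⟩
  · obtain ⟨α, φ, β, h⟩ := exists_rotX_conj hW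
    exact ⟨prog7 α β φ, prog7_op hf hC h, meets_prog7 α β φ⟩
  · obtain ⟨θ, φ, β, h⟩ := exists_rotY_conj hW
    obtain ⟨r, e, he, rfl⟩ : ∃ r e, e < 4 ∧ n = 8 + 4 * r + e :=
      ⟨(n - 8) / 4, (n - 8) % 4, by omega, by omega⟩
    refine ⟨pads r e ++ core (θ / 2) β φ r e, ?_, big_meets he _ _ _⟩
    rw [opL_append, opL_pads, mul_one, core_op he rfl hf hC h]

theorem gate_kind (hf : Set.InjOn f {i | i ≤ n}) {i : Ins} (h : WF n i) :
    (i.gate f).kind = i.kind := by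
  cases i with
  | cx c t =>
    have := f_ne hf h.1 h.2.1 h.2.2
    simp [gate, this, Gate.kind, Ins.kind]
  | tg s q => cases s <;> rfl
  | sg s q => cases s <;> rfl
  | hg q => rfl
  | rx θ q => rfl
  | rz θ q => rfl

theorem mem_gate_qubits {i : Ins} {q : Q} (h : q ∈ (i.gate f).qubits) : ∃ j ∈ i.qs, f j = q := by
  cases i with
  | cx c t =>
    simp only [gate] at h
    split_ifs at h <;> simp [Gate.qubits] at h
    · rcases h with rfl | rfl <;> simp [qs]
    · subst h; simp [qs]
  | tg s j => cases s <;> simp [gate, Gate.qubits, qs] at h ⊢ <;> exact h.symm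
  | sg s j => cases s <;> simp [gate, Gate.qubits, qs] at h ⊢ <;> exact h.symm
  | hg j => simp [gate, Gate.qubits, qs] at h ⊢; exact h.symm
  | rx θ j => simp [gate, Gate.qubits, qs] at h ⊢; exact h.symm
  | rz θ j => simp [gate, Gate.qubits, qs] at h ⊢; exact h.symm

/-- The depths of several kinds of gates can be raised simultaneously. -/
theorem exists_depths_eq (c : Circuit Q) (d : Kind → ℕ) (ks : List Kind) (hks : ks.Nodup)
    (h1 : ∀ k ∈ ks, c.depth k ≤ d k) (h2 : ∀ k ∈ ks, d k ≤ c.cost k) :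
    ∃ c' : Circuit Q, c'.op = c.op ∧ c'.gates.Perm c.gates ∧ ∀ k ∈ ks, c'.depth k = d k := by
  suffices h : ∃ c' : Circuit Q, c'.op = c.op ∧ c'.gates.Perm c.gates ∧
      (∀ k ∈ ks, c'.depth k = d k) ∧ ∀ k ∉ ks, c'.depth k = c.depth k by
    obtain ⟨c', a, b, e, -⟩ := h
    exact ⟨c', a, b, e⟩
  induction ks with
  | nil => exact ⟨c, rfl, .refl _, by simp, by simp⟩
  | cons k ks ih =>
    rw [List.nodup_cons] at hks
    obtain ⟨c', a1, a2, a3, a4⟩ := ih hks.2 (fun k' hk => h1 k' (by simp [hk]))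
      fun k' hk => h2 k' (by simp [hk])
    have hc : c'.cost k = c.cost k := a2.countP_eq _
    obtain ⟨c'', b1, b2, b3, b4⟩ := c'.exists_depth_eq k (d k)
      (by rw [a4 k hks.1]; exact h1 k (by simp)) (by rw [hc]; exact h2 k (by simp))
    refine ⟨c'', b1.trans a1, b2.trans a2, fun k' hk' => ?_, fun k' hk' => ?_⟩
    · by_cases h : k' = k
      · rw [h, b3]
      · rw [b4 k' h, a3 k' (by simpa [h] using hk')]
    · simp only [List.mem_cons, not_or] at hk'
      rw [b4 k' hk'.1, a4 k' hk'.2]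

/-- A program with the desired costs yields a circuit with the desired costs and depths. -/
theorem Meets.exists_circuit (hn : 6 ≤ n) (hf : Set.InjOn f {i | i ≤ n}) {L : Prog}
    (h : Meets n L) : ∃ c : Circuit Q, c.op = opL f L ∧
      (∀ g ∈ c.gates, ∀ q ∈ g.qubits, ∃ i ≤ n, f i = q) ∧ (∀ k, c.cost k = costs n k) ∧
      ∀ k, k ≠ .rot → c.depth k = depths n k := by
  set G : List (ℕ × Gate Q) := L.map fun x => (x.1, x.2.gate f) with hG
  have hwf : ∀ x ∈ L, ∀ q ∈ (x.2.gate f).qubits, ∃ j ∈ x.2.qs, j ≤ n ∧ f j = q := by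
    intro x hx q hq
    obtain ⟨j, hj, hj'⟩ := mem_gate_qubits hq
    exact ⟨j, hj, (h.wf x hx).le j hj, hj'⟩
  have hpair : G.Pairwise Before := by
    rw [hG, List.pairwise_map]
    refine h.fits.pairwise.imp_of_mem fun {x y} hx hy hxy => ?_
    by_cases hd : Disjoint (x.2.gate f).qubits (y.2.gate f).qubits
    · exact Or.inl hd
    · obtain ⟨q, hq, hq'⟩ := Finset.not_disjoint_iff.1 hd
      obtain ⟨j, hj, hjn, rfl⟩ := hwf x hx q hq
      obtain ⟨i, hi, hin, hij⟩ := hwf y hy _ hq'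
      obtain rfl := hf hin hjn hij
      exact Or.inr (hxy i hj hi)
  obtain ⟨N, hN⟩ : ∃ N, ∀ x ∈ G, x.1 < N := by
    refine ⟨(G.map Prod.fst).sum + 1, fun x hx => ?_⟩
    have := List.single_le_sum (l := G.map Prod.fst) (by simp) x.1 (List.mem_map_of_mem hx)
    omega
  have hmap : G.map Prod.snd = L.map fun x => x.2.gate f := by simp [hG]
  have hperm := schedule_gates_perm G hpair N hN
  rw [hmap] at hperm
  have hcost : ∀ k, (schedule G hpair N).cost k = costs n k := by
    intro k
    rw [← h.cost k, Circuit.cost, hperm.countP_eq, List.countP_map, cnt]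
    refine List.countP_congr fun x hx => ?_
    simp [gate_kind hf (h.wf x hx)]
  have hdepth : ∀ k ∈ [Kind.cnot, .t, .s, .h], (schedule G hpair N).depth k ≤ depths n k := by
    intro k hk
    obtain ⟨A, hA, hA'⟩ := h.depth k (by rintro rfl; simp at hk)
    refine (schedule_depth_le G hpair N k A fun x hx hxk => ?_).trans hA
    obtain ⟨y, hy, rfl⟩ := List.mem_map.1 hx
    exact hA' y hy (by rw [← gate_kind hf (h.wf y hy)]; exact hxk)
  obtain ⟨c, h1, h2, h3⟩ := exists_depths_eq (schedule G hpair N) (depths n) [.cnot, .t, .s, .h]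
    (by decide) hdepth fun k hk => by
      rw [hcost]
      cases k <;> simp only [depths, costs] <;> (try split_ifs) <;> omega
  refine ⟨c, ?_, fun g hg q hq => ?_, fun k => ?_, fun k hk => h3 k (by cases k <;> simp at *)⟩
  · rw [h1, schedule_op G hpair N hN, hmap]; rfl
  · obtain ⟨x, hx, rfl⟩ := List.mem_map.1 (hperm.subset (h2.subset hg))
    obtain ⟨j, -, hj, hj'⟩ := hwf x hx q hq
    exact ⟨j, hj, hj'⟩
  · rw [← hcost k]; exact h2.countP_eq _

/-- A numbering of the qubits: `t` has the number `0`, and the elements of `C` follow. -/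
theorem exists_numbering {C : Finset Q} {t : Q} (ht : t ∉ C) (hC : C.card = n) :
    ∃ f : ℕ → Q, f 0 = t ∧ Set.InjOn f {i | i ≤ n} ∧
      ∀ q, q ∈ C ↔ ∃ i, 1 ≤ i ∧ i ≤ n ∧ f i = q := by
  have hl : C.toList.length = n := by simp [hC]
  refine ⟨fun i => (t :: C.toList).getD i t, rfl, ?_, fun q => ?_⟩
  · intro i hi j hj hij
    change i ≤ n at hi
    change j ≤ n at hj
    have hnd : (t :: C.toList).Nodup := List.nodup_cons.2 ⟨by simpa using ht, C.nodup_toList⟩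
    have hi' : i < (t :: C.toList).length := by simp [hC]; omega
    have hj' : j < (t :: C.toList).length := by simp [hC]; omega
    simp only [List.getD_eq_getElem _ _ hi', List.getD_eq_getElem _ _ hj'] at hij
    exact (hnd.getElem_inj_iff).1 hij
  · rw [← Finset.mem_toList, List.mem_iff_getElem]
    constructor
    · rintro ⟨i, hi, rfl⟩
      refine ⟨i + 1, by omega, by omega, ?_⟩
      simp only
      rw [List.getD_cons_succ, List.getD_eq_getElem _ _ hi]
    · rintro ⟨i, h1, h2, rfl⟩
      obtain ⟨i, rfl⟩ : ∃ k, i = k + 1 := ⟨i - 1, by omega⟩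
      refine ⟨i, by omega, ?_⟩
      have : i < C.toList.length := by omega
      simp only
      rw [List.getD_cons_succ, List.getD_eq_getElem _ _ this]

end Final

end QCircuit

theorem mainTheorem9 {Q : Type*} [Fintype Q] [DecidableEq Q]
    (C : Finset Q) (t : Q) (ht : t ∉ C) (n : ℕ) (hC : C.card = n) (hn : 6 ≤ n)
    (W : Matrix (Fin 2) (Fin 2) ℂ) (hW : W ∈ Matrix.specialUnitaryGroup (Fin 2) ℂ) :
    ∃ c : QCircuit.Circuit Q,
      c.op = QCircuit.controlled C t W ∧
      c.ActsOn (insert t C) ∧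
      c.cost QCircuit.Kind.rot = 8 ∧
      (c.cost QCircuit.Kind.cnot : ℚ) =
        (if Even n then 25 / 2 * (n : ℚ) - 30 else 25 / 2 * (n : ℚ) - 53 / 2) ∧
      (c.depth QCircuit.Kind.cnot : ℚ) =
        (if Even n then 12 * (n : ℚ) - 27 else 12 * (n : ℚ) - 24) ∧
      (c.cost QCircuit.Kind.t : ℚ) = 16 * (n : ℚ) - 48 ∧
      (c.depth QCircuit.Kind.t : ℚ) = 4 * (n : ℚ) ∧
      (c.cost QCircuit.Kind.h : ℚ) =
        (if Even n then 9 * (n : ℚ) - 36 else 9 * (n : ℚ) - 37) ∧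
      (c.depth QCircuit.Kind.h : ℚ) = 4 * (n : ℚ) - 10 ∧
      (c.cost QCircuit.Kind.s : ℚ) =
        (if Even n then 1 / 2 * (n : ℚ) - 2 else 1 / 2 * (n : ℚ) - 5 / 2) ∧
      c.depth QCircuit.Kind.s = 1 := by
  obtain ⟨f, rfl, hf, hfC⟩ := QCircuit.exists_numbering ht hC
  obtain ⟨L, hL, hL'⟩ := QCircuit.exists_meets hn hf hfC hW
  obtain ⟨c, h1, h2, h3, h4⟩ := hL'.exists_circuit hn hf
  have hact : c.ActsOn (insert (f 0) C) := by
    intro g hg q hq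
    obtain ⟨i, hi, rfl⟩ := h2 g hg q hq
    rcases Nat.eq_zero_or_pos i with rfl | hi'
    · exact Finset.mem_insert_self _ _
    · exact Finset.mem_insert_of_mem ((hfC _).2 ⟨i, hi', hi, rfl⟩)
  refine ⟨c, h1.trans hL, hact, h3 _, ?_⟩
  simp only [h3, h4 _ (show QCircuit.Kind.cnot ≠ .rot by decide),
    h4 _ (show QCircuit.Kind.t ≠ .rot by decide), h4 _ (show QCircuit.Kind.s ≠ .rot by decide),
    h4 _ (show QCircuit.Kind.h ≠ .rot by decide), QCircuit.costs, QCircuit.depths]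
  obtain ⟨m, rfl | rfl⟩ : ∃ m, n = 2 * (m + 3) ∨ n = 2 * (m + 3) + 1 :=
    ⟨n / 2 - 3, by omega⟩
  · have he : Even (2 * (m + 3)) := even_two_mul _
    have e0 : 2 * (m + 3) % 2 = 0 := by omega
    simp only [if_pos he, if_pos e0]
    rw [show (25 * (2 * (m + 3)) - 60) / 2 = 25 * m + 45 by omega,
      show 12 * (2 * (m + 3)) - 27 = 24 * m + 45 by omega,
      show 16 * (2 * (m + 3)) - 48 = 32 * m + 48 by omega,
      show 9 * (2 * (m + 3)) - 36 = 18 * m + 18 by omega,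
      show 4 * (2 * (m + 3)) - 10 = 8 * m + 14 by omega,
      show (2 * (m + 3) - 4) / 2 = m + 1 by omega]
    push_cast
    refine ⟨?_, ?_, ?_, ?_, ?_, ?_, ?_, trivial⟩ <;> ring
  · have he : ¬Even (2 * (m + 3) + 1) := by simp
    have e0 : ¬(2 * (m + 3) + 1) % 2 = 0 := by omega
    simp only [if_neg he, if_neg e0]
    rw [show (25 * (2 * (m + 3) + 1) - 53) / 2 = 25 * m + 61 by omega,
      show 12 * (2 * (m + 3) + 1) - 24 = 24 * m + 60 by omega,
      show 16 * (2 * (m + 3) + 1) - 48 = 32 * m + 64 by omega,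
      show 9 * (2 * (m + 3) + 1) - 37 = 18 * m + 26 by omega,
      show 4 * (2 * (m + 3) + 1) - 10 = 8 * m + 18 by omega,
      show (2 * (m + 3) + 1 - 5) / 2 = m + 1 by omega]
    push_cast
    refine ⟨?_, ?_, ?_, ?_, ?_, ?_, ?_, trivial⟩ <;> ring
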